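/- All graphs are simple, and a graph $G$ has a graph $H$ as a minor if $H$ can be obtained from $G$ by vertex deletions, edge deletions and edge contractions; equivalently, $G$ has pairwise disjoint vertex sets $B_a$ ($a\in V(H)$), each inducing a connected nonempty subgraph, with an edge of $G$ between $B_a$ and $B_b$ whenever $ab\in E(H)$. A graph is $\mathbb{F}$-minor-free if no member of the family $\mathbb{F}$ is a minor of it. Write $|H|$ for the number of vertices of $H$ and $\alpha_H$ for its independence number. Let $\mathbb{H}$ be a nonempty (possibly infinite) family of finite nonempty graphs, each of minimum degree at least $1$ and none of them isomorphic to a star $K_{1,t}$. Put $\gamma_H=|H|-\alpha_H-1$ and $\gamma_{\mathbb{H}}=\min_{H\in\mathbb{H}}\gamma_H$. For an integer $s$ let $\Gamma_s(H)$ be the set of $s$-vertex induced subgraphs of $H$, let $\Gamma_s^*(H)$ be the set of those $H[S]\in\Gamma_s(H)$ such that no member of $\Gamma_s(H)$ is isomorphic to a proper subgraph of $H[S]$, and put $$\Gamma(\mathbb{H})=\bigcup_{H\in\mathbb{H}}\Gamma^*_{|H|-\gamma_{\mathbb{H}}}(H).$$ For a family $\mathbb{F}$, let $SPEX(n,\mathbb{F}_{minor})$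 be the set of $n$-vertex $\mathbb{F}$-minor-free graphs whose adjacency spectral radius is maximum among all $n$-vertex $\mathbb{F}$-minor-free graphs, and let $EX(n,\mathbb{F}_{minor})$ be the set of $n$-vertex $\mathbb{F}$-minor-free graphs with the maximum number of edges among all $n$-vertex $\mathbb{F}$-minor-free graphs. **Theorem 1.3.** Suppose that every member of $\Gamma(\mathbb{H})$ is connected. Then there is an $N$, depending only on $\mathbb{H}$, such that for every $n\ge N$ and every $G^*\in SPEX(n,\mathbb{H}_{minor})$ the following holds: if $L$ is the set of dominating vertices of $G^*$ (the vertices adjacent to all other vertices), then $$G^*-L\in EX(n-\gamma_{\mathbb{H}},\Gamma(\mathbb{H})_{minor}),$$ that is, $G^*-L$ has exactly $n-\gamma_{\mathbb{H}}$ vertices, is $\Gamma(\mathbb{H})$-minor-free, and has the maximum number of edges among all $\Gamma(\mathbb{H})$-minor-free graphs on $n-\gamma_{\mathbb{H}}$ vertices. -/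

import Mathlib

open scoped ENNReal

namespace MinorSpex

universe u v w

/-- `H` is a minor of `G`: there is a model of `H` in `G`, that is, there are pairwise disjoint
sets `B a` of vertices of `G`, one for each vertex `a` of `H`, each inducing a (nonempty)
connected subgraph of `G`, such that for every edge `ab` of `H` some edge of `G` has one end in
`B a` and the other in `B b`. -/
def IsMinor {W : Type u} {V : Type v} (H : SimpleGraph W) (G : SimpleGraph V) : Prop :=
  ∃ B : W → Set V,
    (∀ a, (G.induce (B a)).Connected) ∧
    (∀ a b, a ≠ b → Disjoint (B a) (B b)) ∧
    ∀ a b, H.Adj a b → ∃ p ∈ B a, ∃ q ∈ B b, G.Adj p q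

/-- `G` contains no member of the family `F` as a minor. -/
def MinorFree {ι : Type u} {W : ι → Type v} (F : ∀ i, SimpleGraph (W i))
    {V : Type w} (G : SimpleGraph V) : Prop :=
  ∀ i, ¬ IsMinor (F i) G

/-- The (adjacency) spectral radius of a finite graph. The adjacency matrix is a real symmetric
matrix, so all of its eigenvalues are real. -/
noncomputable def rho {V : Type u} [Fintype V] [DecidableEq V] (G : SimpleGraph V) : ℝ≥0∞ :=
  open Classical in spectralRadius ℝ (G.adjMatrix ℝ)

/-- The set `SPEX(n, F_minor)` of `F`-minor-free graphs on `n` vertices whose spectral radius is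
maximum among all `F`-minor-free graphs on `n` vertices. -/
def SPEX {ι : Type u} {W : ι → Type v} (n : ℕ) (F : ∀ i, SimpleGraph (W i)) :
    Set (SimpleGraph (Fin n)) :=
  {G | MinorFree F G ∧ ∀ G' : SimpleGraph (Fin n), MinorFree F G' → rho G' ≤ rho G}

/-- `G` belongs to `EX(m, F_minor)`: it is an `F`-minor-free graph with exactly `m` vertices, and
it has the maximum number of edges among all `F`-minor-free graphs on `m` vertices. -/
def IsEX {ι : Type u} {W : ι → Type v} (m : ℕ) (F : ∀ i, SimpleGraph (W i))
    {V : Type w} [Finite V] (G : SimpleGraph V) : Prop :=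
  Nat.card V = m ∧ MinorFree F G ∧
    ∀ G' : SimpleGraph (Fin m), MinorFree F G' → G'.edgeSet.ncard ≤ G.edgeSet.ncard

/-- `γ_H = |H| - α_H - 1`, where `α_H` is the independence number of `H`. (For a graph with at
least one edge one has `α_H + 1 ≤ |H|`, so the subtraction is not truncated.) -/
noncomputable def gamma {W : Type u} [Fintype W] (H : SimpleGraph W) : ℕ :=
  Fintype.card W - H.indepNum - 1

/-- `γ` of a nonempty family: the minimum of `γ_H` over its members `H`. -/
noncomputable def gammaFam {ι : Type u} {W : ι → Type v} [∀ i, Fintype (W i)]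
    (F : ∀ i, SimpleGraph (W i)) : ℕ :=
  ⨅ i, gamma (F i)

/-- `H[S]` is a member of `Γ*_s(H)`: the set `S` has `s` elements, and no subgraph of `H` induced
by `s` vertices is isomorphic to a proper subgraph of `H[S]`. -/
def IsIrreducible {W : Type u} (H : SimpleGraph W) (s : ℕ) (S : Finset W) : Prop :=
  S.card = s ∧
    ∀ T : Finset W, T.card = s →
      ∀ K : (H.induce (S : Set W)).Subgraph, K ≠ ⊤ →
        IsEmpty (H.induce (T : Set W) ≃g K.coe)

/-- The index set of the family `Γ(F)`: pairs of a member `H` of the family and a vertex set `S`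
of `H` such that `H[S]` belongs to `Γ*_s(H)`, where `s = |H| - γ` and `γ` is that of the
family. -/
def GammaIndex {ι : Type u} {W : ι → Type v} [∀ i, Fintype (W i)]
    (F : ∀ i, SimpleGraph (W i)) : Type (max u v) :=
  Σ i, {S : Finset (W i) // IsIrreducible (F i) (Fintype.card (W i) - gammaFam F) S}

/-- The family `Γ(F)`, the union over all members `H` of `F` of `Γ*_s(H)` with `s = |H| - γ`. -/
def Gamma {ι : Type u} {W : ι → Type v} [∀ i, Fintype (W i)]
    (F : ∀ i, SimpleGraph (W i)) (p : GammaIndex F) :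
    SimpleGraph ((p.2.1 : Finset (W p.1)) : Set (W p.1)) :=
  (F p.1).induce ((p.2.1 : Finset (W p.1)) : Set (W p.1))

/-- `G - L`, where `L` is the set of dominating vertices of `G` (those adjacent to every other
vertex of `G`). -/
def deleteDominating {V : Type u} (G : SimpleGraph V) :
    SimpleGraph ((G.universalVertsᶜ : Set V)) :=
  G.induce (G.universalVertsᶜ : Set V)

end MinorSpex

namespace MinorSpex

universe u v w

/-! ### Models of minors -/

section Minor

variable {W : Type u} {W' : Type*} {V : Type v} {V' : Type w}

/-! Write g for γ of the family. Deleting g vertices from a graph spoils at most g branch sets of a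
minor model, so joining g vertices to a Γ-minor-free graph gives an H-minor-free graph
(`minorFree_join`). Conversely, g pairwise adjacent vertices joined to R can serve as g missing
branch sets, so in an H-minor-free graph such an R induces a Γ-minor-free graph
(`minorFree_Gamma_induce`). It remains to show that an extremal graph is a g-clique joined to some
F, and that F has the maximum number of edges.

The dominating clique: H-minor-free graphs have bounded degeneracy (`exists_orientation`) and
contain no large K_{g+1,M} (`card_common_neighbors_lt`), while comparison with the join of g
vertices to an empty graph gives l² ≥ g(n-g) for the spectral radius l. This concentrates the Perron
vector on exactly g vertices L with at least n/2 common neighbours (`exists_core_of_large`). Unless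
L is dominating, replacing the graph by the join of L with what it induces on (most of) the common
neighbours contradicts extremality (`adj_of_core`).

The number of edges: Γ-minor-free graphs have no large star minor (`no_star_minor`), hence bounded
degrees, and the Perron entries outside L are nearly equal. One extra edge in F then raises the
spectral radius, provided that the accumulated errors stay bounded. The test vector takes the value
g/(l-2) on the altered set X, which is the exact entry for a 2-regular graph; so the error is
governed by the boundary of X and the sum of |deg - 2| over X, not by the size of X
(`quad_lt_of_swap`, `exists_rho_join_lt`).

Such controlled improvements always exist (`IsSparseClass.exists_improvable`). As the members of Γ
are connected, the Γ-minor-free graphs are closed under disjoint unions, so pieces can be exchanged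
freely. If some path is excluded, components are bounded and boundedly many are exchanged. If some
n-vertex graph in the class has more than n edges, three copies of it replace a run of degree-two
vertices in a long geodesic. Otherwise every component is a tree or unicyclic, and the sizes
carrying as many edges as vertices form a numerical semigroup, which tells how to absorb a tree
component. -/

lemma subset_of_connected {G : SimpleGraph V} {B X : Set V} (hB : (G.induce B).Connected)
    (hX : ∀ p ∈ B, ∀ q ∈ B, G.Adj p q → p ∈ X → q ∈ X) {a : V} (ha : a ∈ B) (haX : a ∈ X) :
    B ⊆ X := by
  intro b hb
  obtain ⟨w⟩ := hB.preconnected ⟨a, ha⟩ ⟨b, hb⟩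
  have key : ∀ (p q : B), (G.induce B).Walk p q → (p : V) ∈ X → (q : V) ∈ X := by
    intro p q w
    induction w with
    | nil => exact id
    | cons h _ ih => exact fun hp => ih (hX _ (Subtype.prop _) _ (Subtype.prop _) h hp)
  exact key _ _ w haX

lemma connected_induce_singleton (G : SimpleGraph V) (a : V) :
    (G.induce ({a} : Set V)).Connected := by
  have : Subsingleton ({a} : Set V) := by simp
  have : Nonempty ({a} : Set V) := ⟨⟨a, rfl⟩⟩
  exact SimpleGraph.Connected.mk SimpleGraph.Preconnected.of_subsingleton

lemma connected_induce_image {G : SimpleGraph V} {G' : SimpleGraph V'} {B : Set V}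
    (hB : (G.induce B).Connected) (g : V → V')
    (hg : ∀ p ∈ B, ∀ q ∈ B, G.Adj p q → G'.Adj (g p) (g q)) :
    (G'.induce (g '' B)).Connected := by
  refine SimpleGraph.Connected.map (G := G.induce B)
    ⟨fun p => ⟨g p, p, p.2, rfl⟩, ?_⟩ ?_ hB
  · intro p q h
    exact hg _ p.2 _ q.2 h
  · rintro ⟨_, p, hp, rfl⟩
    exact ⟨⟨p, hp⟩, rfl⟩

lemma IsMinor.comp {H : SimpleGraph W} {H' : SimpleGraph W'} {G : SimpleGraph V}
    (h : IsMinor H G) (f : W' → W) (hf : Function.Injective f)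
    (hadj : ∀ a b, H'.Adj a b → H.Adj (f a) (f b)) : IsMinor H' G := by
  obtain ⟨B, h1, h2, h3⟩ := h
  exact ⟨fun a => B (f a), fun a => h1 _, fun a b hab => h2 _ _ (hf.ne hab),
    fun a b hab => h3 _ _ (hadj _ _ hab)⟩

lemma IsMinor.map {H : SimpleGraph W} {G : SimpleGraph V} {G' : SimpleGraph V'}
    (h : IsMinor H G) (g : V → V') (hg : Function.Injective g)
    (hadj : ∀ p q, G.Adj p q → G'.Adj (g p) (g q)) : IsMinor H G' := by
  obtain ⟨B, h1, h2, h3⟩ := h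
  refine ⟨fun a => g '' B a, fun a => connected_induce_image (h1 a) g
    fun p _ q _ => hadj p q, fun a b hab => ?_, fun a b hab => ?_⟩
  · exact Set.disjoint_image_of_injective hg (h2 a b hab)
  · obtain ⟨p, hp, q, hq, hpq⟩ := h3 a b hab
    exact ⟨g p, ⟨p, hp, rfl⟩, g q, ⟨q, hq, rfl⟩, hadj _ _ hpq⟩

/-- The pieces `P k` are pairwise adjacent and adjacent to every vertex of `R`, so they can host the
vertices of `H` outside `S`, whatever edges `H` has there. -/
lemma IsMinor.glue {G : SimpleGraph V} {H : SimpleGraph W} {S : Finset W} {κ : Type*}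
    (P : κ → Set V) (hPc : ∀ k, (G.induce (P k)).Connected)
    (hPd : ∀ k l, k ≠ l → Disjoint (P k) (P l))
    (hPa : ∀ k l, k ≠ l → ∃ p ∈ P k, ∃ q ∈ P l, G.Adj p q)
    (R : Set V) (hPR : ∀ k, Disjoint (P k) R) (hR : ∀ k, ∀ r ∈ R, ∃ p ∈ P k, G.Adj p r)
    (e : {w // w ∉ S} → κ) (he : Function.Injective e)
    (h : IsMinor (H.induce (S : Set W)) (G.induce R)) : IsMinor H G := by
  classical
  obtain ⟨B, h1, h2, h3⟩ := h
  have hsub : ∀ a, Subtype.val '' B a ⊆ R := by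
    rintro a _ ⟨p, _, rfl⟩
    exact p.2
  have hex : ∀ (k : κ) (a : (S : Set W)), ∃ p ∈ P k, ∃ q ∈ (Subtype.val '' B a : Set V),
      G.Adj p q := by
    intro k a
    obtain ⟨q⟩ := (h1 a).nonempty
    obtain ⟨p, hp, hpq⟩ := hR k q.1 q.1.2
    exact ⟨p, hp, q.1, ⟨q.1, q.2, rfl⟩, hpq⟩
  set B' : W → Set V := fun w => if hw : w ∈ S then Subtype.val '' B ⟨w, hw⟩ else P (e ⟨w, hw⟩)
  have hpos : ∀ a (ha : a ∈ S), B' a = Subtype.val '' B ⟨a, ha⟩ := fun a ha => dif_pos ha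
  have hneg : ∀ a (ha : a ∉ S), B' a = P (e ⟨a, ha⟩) := fun a ha => dif_neg ha
  refine ⟨B', ?_, ?_, ?_⟩
  · intro a
    by_cases ha : a ∈ S
    · rw [hpos a ha]
      exact connected_induce_image (h1 ⟨a, ha⟩) Subtype.val fun p _ q _ hpq => hpq
    · rw [hneg a ha]
      exact hPc _
  · intro a b hab
    by_cases ha : a ∈ S <;> by_cases hb : b ∈ S <;>
      simp only [hpos _, hneg _, ha, hb, not_false_iff]
    · exact Set.disjoint_image_of_injective Subtype.val_injective
        (h2 ⟨a, ha⟩ ⟨b, hb⟩ (by simpa using hab))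
    · exact ((hPR _).mono_right (hsub _)).symm
    · exact (hPR _).mono_right (hsub _)
    · exact hPd _ _ (he.ne (by simpa using hab))
  · intro a b hab
    by_cases ha : a ∈ S <;> by_cases hb : b ∈ S <;>
      simp only [hpos _, hneg _, ha, hb, not_false_iff]
    · obtain ⟨p, hp, q, hq, hpq⟩ := h3 ⟨a, ha⟩ ⟨b, hb⟩ hab
      exact ⟨p, ⟨p, hp, rfl⟩, q, ⟨q, hq, rfl⟩, hpq⟩
    · obtain ⟨p, hp, q, hq, hpq⟩ := hex (e ⟨b, hb⟩) ⟨a, ha⟩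
      exact ⟨q, hq, p, hp, hpq.symm⟩
    · exact hex _ _
    · exact hPa _ _ (he.ne (by simpa using hab.ne))

/-- The graph obtained from `F` by joining all vertices of `L` to all other vertices. -/
def join (L : Finset V) (F : SimpleGraph V) : SimpleGraph V where
  Adj a b := a ≠ b ∧ (a ∈ L ∨ b ∈ L ∨ F.Adj a b)
  symm := ⟨by
    rintro a b ⟨h, h'⟩
    refine ⟨h.symm, ?_⟩
    rcases h' with h' | h' | h'
    exacts [Or.inr (Or.inl h'), Or.inl h', Or.inr (Or.inr h'.symm)]⟩
  loopless := ⟨fun a h => h.1 rfl⟩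

/-- Branch sets are disjoint, so at most `L.card` of them meet `L`. The others use only vertices and
edges of `F`. -/
lemma IsMinor.of_join [Fintype W] {H : SimpleGraph W} {L : Finset V} {F : SimpleGraph V}
    (h : IsMinor H (join L F)) :
    ∃ S : Finset W, S.card = Fintype.card W - L.card ∧ IsMinor (H.induce (S : Set W)) F := by
  classical
  obtain ⟨B, h1, h2, h3⟩ := h
  set T : Finset W := Finset.univ.filter fun w => ∃ a ∈ L, a ∈ B w with hT
  have hTL : T.card ≤ L.card := by
    have : ∀ w : T, ∃ a : L, a.1 ∈ B w := fun w => by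
      obtain ⟨a, ha, h⟩ := (Finset.mem_filter.1 w.2).2
      exact ⟨⟨a, ha⟩, h⟩
    choose f hf using this
    rw [← Fintype.card_coe, ← Fintype.card_coe]
    refine Fintype.card_le_of_injective f fun w w' hww' => ?_
    by_contra hne
    refine Set.disjoint_left.1 (h2 w w' fun h => hne (Subtype.ext h)) (hf w) ?_
    rw [hww']
    exact hf w'
  have hc : Fintype.card W - L.card ≤ (Finset.univ \ T).card := by
    rw [Finset.card_sdiff_of_subset (Finset.subset_univ _), Finset.card_univ]
    omega
  obtain ⟨S, hST, hS⟩ := Finset.exists_subset_card_eq hc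
  have hout : ∀ w ∈ S, ∀ a ∈ B w, a ∉ L := by
    intro w hw a ha haL
    have := hST hw
    simp only [hT, Finset.mem_sdiff, Finset.mem_univ, true_and, Finset.mem_filter] at this
    exact this ⟨a, haL, ha⟩
  have hadj : ∀ p q, (join L F).Adj p q → p ∉ L → q ∉ L → F.Adj p q := by
    rintro p q ⟨_, h | h | h⟩ hp hq
    exacts [absurd h hp, absurd h hq, h]
  refine ⟨S, hS, fun w => B w, fun w => ?_, fun a b hab => h2 _ _ (by simpa using hab), ?_⟩
  · have := connected_induce_image (G' := F) (h1 w) id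
      (fun p hp q hq hpq => hadj _ _ hpq (hout _ w.2 _ hp) (hout _ w.2 _ hq))
    rwa [Set.image_id] at this
  · intro a b hab
    obtain ⟨p, hp, q, hq, hpq⟩ := h3 a b hab
    exact ⟨p, hp, q, hq, hadj _ _ hpq (hout _ a.2 _ hp) (hout _ b.2 _ hq)⟩

/-- Excluding the irreducible induced subgraphs as minors is therefore the same as excluding all
induced subgraphs of that order, which is how Γ is used below. -/
lemma exists_isIrreducible [Fintype W] (H : SimpleGraph W) (S : Finset W) :
    ∃ T : Finset W, IsIrreducible H S.card T ∧
      ∃ f : ↥(T : Set W) → ↥(S : Set W), Function.Injective f ∧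
        ∀ a b, (H.induce (T : Set W)).Adj a b → (H.induce (S : Set W)).Adj (f a) (f b) := by
  classical
  let p : Finset W → Prop := fun T => T.card = S.card ∧
      ∃ f : ↥(T : Set W) → ↥(S : Set W), Function.Injective f ∧
        ∀ a b, (H.induce (T : Set W)).Adj a b → (H.induce (S : Set W)).Adj (f a) (f b)
  have hne : (Finset.univ.filter p).Nonempty :=
    ⟨S, Finset.mem_filter.2 ⟨Finset.mem_univ _, rfl, id, Function.injective_id, fun _ _ h => h⟩⟩
  -- A set with fewest edges among those embedding into `H[S]` is irreducible: a proper subgraph of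
  -- the same order is spanning, hence has strictly fewer edges.
  obtain ⟨T, hT, hmin⟩ := Finset.exists_min_image (Finset.univ.filter p)
    (fun T => (H.induce (T : Set W)).edgeSet.ncard) hne
  obtain ⟨-, hTc, f, hf, hfa⟩ := Finset.mem_filter.1 hT
  refine ⟨T, ⟨hTc, ?_⟩, f, hf, hfa⟩
  intro T' hT' K hK
  refine ⟨fun e => ?_⟩
  have hverts : K.IsSpanning := by
    have h1 : Nat.card K.verts = Nat.card (T : Set W) := by
      rw [← Nat.card_congr e.toEquiv]
      simp [hT', hTc]
    rw [SimpleGraph.Subgraph.isSpanning_iff]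
    exact Set.eq_of_subset_of_ncard_le (Set.subset_univ _)
      (by rw [Set.ncard_univ, ← h1, Nat.card_coe_set_eq])
  let e' : H.induce (T' : Set W) ≃g K.spanningCoe :=
    e.trans (K.spanningCoeEquivCoeOfSpanning hverts).symm
  have hlt : K.spanningCoe < H.induce (T : Set W) := by
    refine lt_of_le_of_ne K.spanningCoe_le fun h => hK ?_
    refine SimpleGraph.Subgraph.ext ?_ ?_
    · rw [SimpleGraph.Subgraph.isSpanning_iff] at hverts
      simpa using hverts
    · funext a b
      have : K.spanningCoe.Adj a b = (H.induce (T : Set W)).Adj a b := by rw [h]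
      simpa using this
  have hcard : (H.induce (T' : Set W)).edgeSet.ncard = K.spanningCoe.edgeSet.ncard := by
    rw [← Nat.card_coe_set_eq, ← Nat.card_coe_set_eq]
    exact Nat.card_congr e'.mapEdgeSet
  have h2 : (H.induce (T' : Set W)).edgeSet.ncard < (H.induce (T : Set W)).edgeSet.ncard := by
    rw [hcard]
    exact Set.ncard_lt_ncard (SimpleGraph.edgeSet_strict_mono hlt) (Set.toFinite _)
  refine absurd (hmin T' (Finset.mem_filter.2 ⟨Finset.mem_univ _, hT', fun a => f (e' a), ?_, ?_⟩))
    (not_le.2 h2)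
  · exact hf.comp e'.injective
  · intro a b hab
    exact hfa _ _ (hlt.le (e'.map_adj_iff.2 hab))

end Minor

/-! ### The family `Γ` -/

section Family

variable {ι : Type u} {W : ι → Type v} [∀ i, Fintype (W i)] {H : ∀ i, SimpleGraph (W i)}
variable {V : Type w} {V' : Type*}

lemma gammaFam_le (H : ∀ i, SimpleGraph (W i)) (i : ι) : gammaFam H ≤ gamma (H i) :=
  ciInf_le (OrderBot.bddBelow _) i

lemma minorFree_Gamma_iff {F : SimpleGraph V} : MinorFree (Gamma H) F ↔
    ∀ i, ∀ S : Finset (W i), S.card = Fintype.card (W i) - gammaFam H →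
      ¬ IsMinor ((H i).induce (S : Set (W i))) F := by
  constructor
  · intro h i S hS hm
    obtain ⟨T, hT, f, hf, hfa⟩ := exists_isIrreducible (H i) S
    rw [hS] at hT
    exact h ⟨i, T, hT⟩ (hm.comp f hf hfa)
  · rintro h ⟨i, T, hT⟩ hm
    exact h i T hT.1 hm

lemma MinorFree.comap {κ : Type*} {U : κ → Type*} {Fam : ∀ i, SimpleGraph (U i)}
    {F : SimpleGraph V} {F' : SimpleGraph V'} (h : MinorFree Fam F')
    (g : V → V') (hg : Function.Injective g) (hadj : ∀ p q, F.Adj p q → F'.Adj (g p) (g q)) :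
    MinorFree Fam F :=
  fun i hm => h i (hm.map g hg hadj)

/-- The source of all competitors to an extremal graph. -/
lemma minorFree_join {F : SimpleGraph V} (h : MinorFree (Gamma H) F) {L : Finset V}
    (hL : L.card = gammaFam H) : MinorFree H (join L F) := by
  intro i hm
  obtain ⟨S, hS, hS'⟩ := hm.of_join
  rw [hL] at hS
  exact minorFree_Gamma_iff.1 h i S hS hS'

/-- A model of a connected graph cannot spread over two sides with no edge between them: one branch
set lies on one side, and adjacency of branch sets carries the others along. -/
lemma minorFree_of_disjoint_union (hconn : ∀ p : GammaIndex H, (Gamma H p).Connected)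
    {F : SimpleGraph V} {X : Set V} (hX : ∀ p ∈ X, ∀ q ∉ X, ¬ F.Adj p q)
    (h1 : MinorFree (Gamma H) (F.induce X)) (h2 : MinorFree (Gamma H) (F.induce Xᶜ)) :
    MinorFree (Gamma H) F := by
  rintro p ⟨B, hB1, hB2, hB3⟩
  have key : ∀ (Y : Set V), (∀ p ∈ Y, ∀ q ∉ Y, ¬ F.Adj p q) → ∀ a : _, (B a ∩ Y).Nonempty →
      IsMinor (Gamma H p) (F.induce Y) := by
    intro Y hY a hne
    have hsub : ∀ b, (B b ∩ Y).Nonempty → B b ⊆ Y := by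
      rintro b ⟨x, hx, hxY⟩
      refine subset_of_connected (hB1 b) (fun p _ q _ hpq hp => ?_) hx hxY
      by_contra hq
      exact hY p hp q hq hpq
    have hall : ∀ b, B b ⊆ Y := by
      intro b
      obtain ⟨wk⟩ := (hconn p).preconnected a b
      have aux : ∀ (x y : _), (Gamma H p).Walk x y → B x ⊆ Y → B y ⊆ Y := by
        intro x y wk
        induction wk with
        | nil => exact id
        | cons hadj _ ih =>
          intro hx
          apply ih
          obtain ⟨s, hs, t, ht, hst⟩ := hB3 _ _ hadj
          refine hsub _ ⟨t, ht, ?_⟩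
          by_contra htY
          exact hY s (hx hs) t htY hst
      exact aux a b wk (hsub a hne)
    refine ⟨fun b => Subtype.val ⁻¹' B b, fun b => ?_, fun b c hbc => ?_, fun b c hbc => ?_⟩
    · classical
      have himg := connected_induce_image (G' := F.induce Y) (hB1 b)
        (fun v => if hv : v ∈ Y then ⟨v, hv⟩ else ⟨hne.some, hne.some_mem.2⟩) (by
          intro s hs t ht hst
          simpa [hall b hs, hall b ht] using hst)
      have heq : Subtype.val ⁻¹' B b =
          (fun v => if hv : v ∈ Y then (⟨v, hv⟩ : Y) else ⟨hne.some, hne.some_mem.2⟩) '' B b := by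
        ext ⟨v, hv⟩
        simp only [Set.mem_preimage, Set.mem_image]
        constructor
        · intro h
          exact ⟨v, h, by simp [hv]⟩
        · rintro ⟨w, hw, hwv⟩
          simp only [hall b hw, dif_pos, Subtype.mk.injEq] at hwv
          exact hwv ▸ hw
      show ((F.induce Y).induce (Subtype.val ⁻¹' B b)).Connected
      rw [heq]
      exact himg
    · exact Disjoint.preimage _ (hB2 b c hbc)
    · obtain ⟨s, hs, t, ht, hst⟩ := hB3 _ _ hbc
      exact ⟨⟨s, hall b hs⟩, hs, ⟨t, hall c ht⟩, ht, hst⟩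
  obtain ⟨a⟩ := (hconn p).nonempty
  obtain ⟨x⟩ := (hB1 a).nonempty
  by_cases hx : (x : V) ∈ X
  · exact h1 p (key X hX a ⟨x, x.2, hx⟩)
  · refine h2 p (key Xᶜ ?_ a ⟨x, x.2, hx⟩)
    intro s hs t ht hst
    exact hX t (not_not.1 ht) s hs hst.symm

end Family

/-! ### Consequences of minimum degree one: forbidden bipartite subgraphs and star minors -/

section Family

variable {ι : Type u} {W : ι → Type v} [∀ i, Fintype (W i)] {H : ∀ i, SimpleGraph (W i)}
variable {V : Type w}

lemma exists_gammaFam_eq [Nonempty ι] (H : ∀ i, SimpleGraph (W i)) :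
    ∃ i, gamma (H i) = gammaFam H :=
  Nat.sInf_mem (Set.range_nonempty fun i => gamma (H i))

lemma indepNum_lt_card {U : Type*} [Fintype U] [Nonempty U] {K : SimpleGraph U}
    (hdeg : ∀ a : U, ∃ b, K.Adj a b) : K.indepNum < Fintype.card U := by
  obtain ⟨I, hI⟩ := K.exists_isNIndepSet_indepNum
  rw [← hI.card_eq, Finset.card_lt_iff_ne_univ]
  rintro rfl
  obtain ⟨a⟩ := ‹Nonempty U›
  obtain ⟨b, hab⟩ := hdeg a
  exact hI.isIndepSet (by simp) (by simp) hab.ne hab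

lemma indepNum_pos {U : Type*} [Fintype U] [Nonempty U] (K : SimpleGraph U) :
    0 < K.indepNum := by
  obtain ⟨a⟩ := ‹Nonempty U›
  have : ({a} : Finset U).card ≤ K.indepNum :=
    SimpleGraph.IsIndepSet.card_le_indepNum (t := {a}) (by simp [SimpleGraph.IsIndepSet])
  simpa [Nat.one_le_iff_ne_zero, Nat.pos_iff_ne_zero] using this

/-- If the value were 0, a maximum independent set would miss a single vertex `r`; every edge would
contain `r`, and minimum degree one would make `K` a star centred at `r`. -/
lemma gamma_pos {U : Type*} [Fintype U] [Nonempty U] {K : SimpleGraph U}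
    (hdeg : ∀ a : U, ∃ b, K.Adj a b) (hstar : ∀ r, K ≠ SimpleGraph.starGraph r) :
    0 < gamma K := by
  classical
  by_contra h0
  obtain ⟨I, hI⟩ := K.exists_isNIndepSet_indepNum
  have hlt := indepNum_lt_card hdeg
  have hc : (Finset.univ \ I).card = 1 := by
    rw [Finset.card_sdiff_of_subset (Finset.subset_univ _), Finset.card_univ, hI.card_eq]
    unfold gamma at h0
    omega
  obtain ⟨r, hr⟩ := Finset.card_eq_one.1 hc
  have hmem : ∀ a, a ∉ I ↔ a = r := by
    intro a
    have := Finset.ext_iff.1 hr a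
    simpa using this
  have hir : ∀ a b, K.Adj a b → a = r ∨ b = r := by
    intro a b hab
    by_contra hcon
    push Not at hcon
    have ha : a ∈ I := by
      by_contra h
      exact hcon.1 ((hmem a).1 h)
    have hb : b ∈ I := by
      by_contra h
      exact hcon.2 ((hmem b).1 h)
    exact hI.isIndepSet ha hb hab.ne hab
  apply hstar r
  ext a b
  rw [SimpleGraph.starGraph, SimpleGraph.fromRel_adj]
  constructor
  · intro hab
    exact ⟨hab.ne, hir a b hab⟩
  · have key : ∀ c, c ≠ r → K.Adj c r := by
      intro c hc
      obtain ⟨d, hd⟩ := hdeg c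
      rcases hir c d hd with h | h
      · exact absurd h hc
      · exact h ▸ hd
    rintro ⟨hab, h | h⟩
    · subst h
      exact (key b hab.symm).symm
    · subst h
      exact key a hab

/-- Pairing each vertex of `A` with a private vertex of `C` gives connected, pairwise adjacent
pieces, which host the complement of a maximum independent set. The rest of `C` is adjacent to all
pieces and hosts the independent set by singletons. -/
lemma card_common_neighbors_lt {U : Type*} [Fintype U] {K : SimpleGraph U} [Fintype V]
    {G : SimpleGraph V} (h : ¬ IsMinor K G) (A C : Finset V)
    (hA : A.card = Fintype.card U - K.indepNum) (hC : ∀ a ∈ A, ∀ v ∈ C, G.Adj a v) :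
    C.card < A.card + K.indepNum := by
  classical
  by_contra hlt
  push Not at hlt
  obtain ⟨I, hI⟩ := K.exists_isNIndepSet_indepNum
  obtain ⟨C', hC', hcard⟩ := Finset.exists_subset_card_eq (le_trans (Nat.le_add_right _ _) hlt)
  have hCC : K.indepNum ≤ (C \ C').card := by
    rw [Finset.card_sdiff_of_subset hC']
    omega
  have eζ : A ≃ C' := Fintype.equivOfCardEq (by simp [hcard])
  have hinj : Fintype.card I ≤ Fintype.card ↥(C \ C') := by
    rw [Fintype.card_coe, Fintype.card_coe, hI.card_eq]
    exact hCC
  obtain ⟨f⟩ := Function.Embedding.nonempty_of_card_le hinj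
  have hAC : ∀ a ∈ A, a ∉ C := fun a ha hac => (hC a ha a hac).ne rfl
  have hle : Fintype.card {w // w ∉ I} ≤ Fintype.card A := by
    rw [Fintype.card_subtype_compl]
    simp [hI.card_eq, hA]
  obtain ⟨e⟩ := Function.Embedding.nonempty_of_card_le hle
  have hζ : ∀ a : A, (eζ a : V) ∈ C := fun a => hC' (eζ a).2
  refine h (IsMinor.glue (S := I) (fun a : A => ({a.1, (eζ a).1} : Set V)) ?_ ?_ ?_
    (↑(C \ C') : Set V) ?_ ?_ e e.injective ?_)
  · intro a
    exact SimpleGraph.induce_pair_connected_of_adj (hC a a.2 _ (hζ a))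
  · intro k l hkl
    rw [Set.disjoint_left]
    rintro x (rfl | rfl) (hx | hx)
    · exact hkl (Subtype.ext hx)
    · exact hAC k k.2 (hx ▸ hζ l)
    · exact hAC l l.2 (hx ▸ hζ k)
    · exact hkl (eζ.injective (Subtype.ext hx))
  · intro k l _
    exact ⟨k, Or.inl rfl, eζ l, Or.inr rfl, hC k k.2 _ (hζ l)⟩
  · intro k
    rw [Set.disjoint_left]
    rintro x (rfl | rfl) hx
    · exact hAC k k.2 (Finset.mem_sdiff.1 hx).1
    · exact (Finset.mem_sdiff.1 hx).2 (eζ k).2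
  · intro k r hr
    exact ⟨k, Or.inl rfl, hC k k.2 r (Finset.mem_sdiff.1 hr).1⟩
  · refine ⟨fun a => {⟨(f ⟨a.1, a.2⟩).1, (f ⟨a.1, a.2⟩).2⟩}, fun a => ?_, fun a b hab => ?_,
      fun a b hab => ?_⟩
    · exact connected_induce_singleton _ _
    · rw [Set.disjoint_singleton]
      intro heq
      apply hab
      have := f.injective (Subtype.ext (congrArg (fun x => x.1) heq))
      exact Subtype.ext (congrArg (fun x : I => x.1) this)
    · exact absurd hab (hI.isIndepSet a.2 b.2 (fun h => hab.ne (Subtype.ext h)))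

/-- A maximum independent set plus one vertex has α + 1 = |H| - γ elements and induces a subgraph of
a star. A connected `B` with α outside neighbours hosts it: `B` is the centre, the neighbours are
the leaves. -/
lemma no_star_minor {i : ι} (hi : gamma (H i) = gammaFam H)
    (hlt : (H i).indepNum < Fintype.card (W i)) {F : SimpleGraph V}
    (hF : MinorFree (Gamma H) F) (B : Set V) (hB : (F.induce B).Connected) (T : Finset V)
    (hTB : ∀ v ∈ T, v ∉ B) (hT : ∀ v ∈ T, ∃ p ∈ B, F.Adj p v) : T.card < (H i).indepNum := by
  classical
  by_contra hle
  push Not at hle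
  obtain ⟨I, hI⟩ := (H i).exists_isNIndepSet_indepNum
  obtain ⟨c, hc⟩ : ∃ c, c ∉ I := by
    by_contra hcon
    push Not at hcon
    have : I = Finset.univ := Finset.eq_univ_iff_forall.2 hcon
    rw [← hI.card_eq, this, Finset.card_univ] at hlt
    exact lt_irrefl _ hlt
  have hinj : Fintype.card I ≤ Fintype.card T := by simpa [hI.card_eq] using hle
  obtain ⟨f⟩ := Function.Embedding.nonempty_of_card_le hinj
  have hScard : (insert c I).card = Fintype.card (W i) - gammaFam H := by
    rw [Finset.card_insert_of_notMem hc, hI.card_eq, ← hi, gamma]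
    omega
  refine minorFree_Gamma_iff.1 hF i (insert c I) hScard ?_
  let Bm : W i → Set V := fun w => if hw : w ∈ I then {(f ⟨w, hw⟩).1} else B
  have hpos : ∀ a (ha : a ∈ I), Bm a = {(f ⟨a, ha⟩).1} := fun a ha => dif_pos ha
  have hneg : ∀ a (ha : a ∉ I), Bm a = B := fun a ha => dif_neg ha
  have hcase : ∀ a : ((insert c I : Finset (W i)) : Set (W i)), a.1 ∉ I → a.1 = c := by
    intro a ha
    have := a.2
    simp only [Finset.coe_insert, Set.mem_insert_iff, Finset.mem_coe] at this
    exact this.resolve_right ha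
  refine ⟨fun a => Bm a.1, ?_, ?_, ?_⟩
  · intro a
    beta_reduce
    by_cases ha : a.1 ∈ I
    · rw [hpos _ ha]
      exact connected_induce_singleton _ _
    · rw [hneg _ ha]
      exact hB
  · intro a b hab
    beta_reduce
    by_cases ha : a.1 ∈ I <;> by_cases hb : b.1 ∈ I
    · rw [hpos _ ha, hpos _ hb, Set.disjoint_singleton]
      intro heq
      have := f.injective (Subtype.ext heq)
      exact hab (Subtype.ext (congrArg (fun x : I => x.1) this))
    · rw [hpos _ ha, hneg _ hb, Set.disjoint_singleton_left]
      exact hTB _ (f _).2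
    · rw [hneg _ ha, hpos _ hb, Set.disjoint_singleton_right]
      exact hTB _ (f _).2
    · exact absurd (Subtype.ext ((hcase a ha).trans (hcase b hb).symm)) hab
  · intro a b hab
    have hab' : (H i).Adj a.1 b.1 := hab
    beta_reduce
    by_cases ha : a.1 ∈ I <;> by_cases hb : b.1 ∈ I
    · exact absurd hab' (hI.isIndepSet ha hb hab'.ne)
    · rw [hpos _ ha, hneg _ hb]
      obtain ⟨p, hp, h⟩ := hT _ (f ⟨a.1, ha⟩).2
      exact ⟨_, rfl, p, hp, h.symm⟩
    · rw [hneg _ ha, hpos _ hb]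
      obtain ⟨p, hp, h⟩ := hT _ (f ⟨b.1, hb⟩).2
      exact ⟨p, hp, _, rfl, h⟩
    · exact absurd (Subtype.ext ((hcase a ha).trans (hcase b hb).symm)) (fun h => hab'.ne (by rw [h]))

/-- Members of Γ have at least α + 1 ≥ 2 vertices and are connected, so each has an edge. -/
lemma minorFree_Gamma_bot [∀ i, Nonempty (W i)] (hdeg : ∀ i, ∀ a : W i, ∃ b, (H i).Adj a b)
    (hconn : ∀ p : GammaIndex H, (Gamma H p).Connected) :
    MinorFree (Gamma H) (⊥ : SimpleGraph V) := by
  rintro p ⟨B, -, -, hB3⟩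
  obtain ⟨i, S, hS⟩ := p
  have h1 := indepNum_lt_card (hdeg i)
  have h2 := indepNum_pos (H i)
  have h3 := gammaFam_le H i
  have h4 := hS.1
  have hcard : 1 < S.card := by
    unfold gamma at h3
    omega
  have : Nontrivial ((S : Finset (W i)) : Set (W i)) := by
    rw [Set.nontrivial_coe_sort]
    exact Finset.one_lt_card_iff_nontrivial.1 hcard
  obtain ⟨a⟩ := (hconn ⟨i, S, hS⟩).nonempty
  obtain ⟨b, hab⟩ := (hconn ⟨i, S, hS⟩).preconnected.exists_adj_of_nontrivial a
  obtain ⟨s, _, t, _, hst⟩ := hB3 a b hab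
  exact hst

end Family

/-! ### Sparsity of graphs without a complete minor -/

section Mader

variable {V : Type u}

open Classical in
/-- The number of neighbours of `v` in the finite set `A`. -/
noncomputable def degIn (G : SimpleGraph V) (A : Finset V) (v : V) : ℕ := (A.filter (G.Adj v)).card

/-- Twice the number of edges inside the finite set `A`. -/
noncomputable def degSum (G : SimpleGraph V) (A : Finset V) : ℕ := ∑ v ∈ A, degIn G A v

lemma degSum_erase [DecidableEq V] (G : SimpleGraph V) {A : Finset V} {y : V} (hy : y ∈ A) :
    degSum G (A.erase y) + 2 * degIn G A y = degSum G A := by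
  classical
  have h1 : ∀ v, degIn G A v = degIn G (A.erase y) v + if G.Adj v y then 1 else 0 := by
    intro v
    unfold degIn
    conv_lhs => rw [← Finset.insert_erase hy]
    rw [Finset.filter_insert]
    split_ifs with h
    · rw [Finset.card_insert_of_notMem (by simp)]
    · rfl
  have h2 : ∑ v ∈ A.erase y, (if G.Adj v y then 1 else 0) = degIn G A y := by
    rw [Finset.sum_ite, Finset.sum_const_zero, add_zero, Finset.sum_const, smul_eq_mul, mul_one]
    unfold degIn
    congr 1
    ext v
    simp only [Finset.mem_filter, Finset.mem_erase]
    exact ⟨fun h => ⟨h.1.2, h.2.symm⟩, fun h => ⟨⟨h.2.ne', h.1⟩, h.2.symm⟩⟩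
  have h3 : degSum G A = degIn G A y + ∑ v ∈ A.erase y, degIn G A v := by
    unfold degSum
    rw [Finset.add_sum_erase _ _ hy]
  rw [h3, Finset.sum_congr rfl fun v _ => h1 v, Finset.sum_add_distrib, h2]
  unfold degSum
  ring

/-- The average degree that forces a complete minor on `r` vertices. -/
def maderConst : ℕ → ℕ
  | 0 => 0
  | r + 1 => 2 * maderConst r + 1

/-- Mader's argument: contract a connected set `U`, as large as possible, without letting the
average degree drop below `maderConst (r + 1)`. By maximality the neighbourhood of `U` has minimum
degree at least `maderConst r`, so it contains a model on `r` vertices by induction, and `U` is the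
additional branch set. -/
lemma exists_complete_model (G : SimpleGraph V) (r : ℕ) : ∀ A : Finset V, A.Nonempty →
    maderConst r * A.card ≤ degSum G A →
    ∃ B : Fin r → Set V, (∀ i, B i ⊆ A) ∧ (∀ i, (G.induce (B i)).Connected) ∧
      (∀ i j, i ≠ j → Disjoint (B i) (B j)) ∧
      ∀ i j, i ≠ j → ∃ p ∈ B i, ∃ q ∈ B j, G.Adj p q := by
  classical
  induction r with
  | zero =>
    intro A _ _
    exact ⟨fun i => i.elim0, fun i => i.elim0, fun i => i.elim0, fun i => i.elim0,
      fun i => i.elim0⟩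
  | succ r ihr =>
    intro A
    induction A using Finset.strongInduction with
    | H A ihA =>
    intro hne hA
    set c := maderConst (r + 1) with hc
    have hcr : c = 2 * maderConst r + 1 := rfl
    let nb : Finset V → Finset V := fun U => (A \ U).filter fun y => ∃ x ∈ U, G.Adj x y
    -- The right side is twice the number of edges after `U` is contracted to a vertex, and `(A \
    -- U).card + 1` is the number of vertices then.
    let p : Finset V → Prop := fun U => U ⊆ A ∧ (G.induce (U : Set V)).Connected ∧
      c * ((A \ U).card + 1) ≤ degSum G (A \ U) + 2 * (nb U).card
    obtain ⟨v, hv⟩ := hne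
    have hpv : p {v} := by
      refine ⟨by simpa using hv, ?_, ?_⟩
      · rw [Finset.coe_singleton]
        exact connected_induce_singleton G v
      · have h1 : A \ {v} = A.erase v := Finset.sdiff_singleton_eq_erase v A
        have h2 : (nb {v}).card = degIn G A v := by
          simp only [nb, degIn]
          congr 1
          ext y
          simp only [Finset.mem_filter, Finset.mem_sdiff, Finset.mem_singleton, exists_eq_left]
          exact ⟨fun h => ⟨h.1.1, h.2⟩, fun h => ⟨⟨h.1, h.2.ne'⟩, h.2⟩⟩
        rw [h2, h1, degSum_erase G hv, Finset.card_erase_add_one hv]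
        exact hA
    obtain ⟨U, hU, hmax⟩ := Finset.exists_max_image (A.powerset.filter p) Finset.card
      ⟨{v}, Finset.mem_filter.2 ⟨Finset.mem_powerset.2 hpv.1, hpv⟩⟩
    obtain ⟨-, hUA, hUc, hUe⟩ := Finset.mem_filter.1 hU
    have hUne : U.Nonempty := by
      obtain ⟨x⟩ := hUc.nonempty
      exact ⟨x, x.2⟩
    by_cases hN : (nb U).Nonempty
    · have hdeg : ∀ y ∈ nb U, maderConst r ≤ degIn G (nb U) y := by
        intro y hy
        obtain ⟨hyA, x, hx, hxy⟩ := Finset.mem_filter.1 hy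
        have hyA' := Finset.mem_sdiff.1 hyA
        have hU' : ¬ p (insert y U) := by
          intro hp
          have := hmax (insert y U) (Finset.mem_filter.2 ⟨Finset.mem_powerset.2 hp.1, hp⟩)
          rw [Finset.card_insert_of_notMem hyA'.2] at this
          omega
        have hsd : A \ insert y U = (A \ U).erase y := by
          ext z
          simp only [Finset.mem_sdiff, Finset.mem_insert, Finset.mem_erase]
          tauto
        have h1 := degSum_erase G hyA
        -- Absorbing `y` into `U` destroys at most the edge to `y` and one edge for each common
        -- neighbour of `y` and the contracted vertex. Failure of `p` then reads 2(1 + degree) > 2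
        -- `maderConst r` + 1.
        have h2 : (nb U).card + degIn G (A \ U) y ≤
            (nb (insert y U)).card + 1 + degIn G (nb U) y := by
          have e1 : degIn G (A \ U) y =
              degIn G (nb U) y + (((A \ U).filter (G.Adj y)) \ nb U).card := by
            unfold degIn
            rw [← Finset.card_inter_add_card_sdiff ((A \ U).filter (G.Adj y)) (nb U)]
            congr 2
            ext z
            simp only [Finset.mem_inter, Finset.mem_filter, nb]
            tauto
          have e2 : ((nb U).erase y).card + (((A \ U).filter (G.Adj y)) \ nb U).card ≤
              (nb (insert y U)).card := by
            rw [← Finset.card_union_of_disjoint]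
            · apply Finset.card_le_card
              intro z hz
              rcases Finset.mem_union.1 hz with hz | hz
              · obtain ⟨hzy, hz⟩ := Finset.mem_erase.1 hz
                obtain ⟨hz1, x', hx', h'⟩ := Finset.mem_filter.1 hz
                refine Finset.mem_filter.2 ⟨?_, x', Finset.mem_insert_of_mem hx', h'⟩
                rw [hsd]
                exact Finset.mem_erase.2 ⟨hzy, hz1⟩
              · obtain ⟨hz1, -⟩ := Finset.mem_sdiff.1 hz
                obtain ⟨hz1, hz2⟩ := Finset.mem_filter.1 hz1
                refine Finset.mem_filter.2 ⟨?_, y, Finset.mem_insert_self _ _, hz2⟩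
                rw [hsd]
                exact Finset.mem_erase.2 ⟨hz2.ne', hz1⟩
            · rw [Finset.disjoint_left]
              intro z hz hz'
              exact (Finset.mem_sdiff.1 hz').2 (Finset.mem_of_mem_erase hz)
          have e3 := Finset.card_erase_add_one hy
          omega
        have h3 : c * ((A \ U).erase y).card + c = c * (A \ U).card := by
          rw [← Finset.card_erase_add_one hyA]
          ring
        have h4 : ¬ c * ((A \ insert y U).card + 1) ≤
            degSum G (A \ insert y U) + 2 * (nb (insert y U)).card := by
          intro hcon
          refine hU' ⟨?_, ?_, hcon⟩
          · exact Finset.insert_subset hyA'.1 hUA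
          · rw [Finset.coe_insert, Set.insert_eq, Set.union_comm]
            exact SimpleGraph.connected_induce_union hUc.preconnected
              (connected_induce_singleton G y).preconnected hx (Set.mem_singleton y) hxy
        rw [hsd] at h4
        have h5 : c * ((A \ U).card + 1) = c * (A \ U).card + c := by ring
        have h6 : c * (((A \ U).erase y).card + 1) = c * ((A \ U).erase y).card + c := by ring
        rw [h5] at hUe
        rw [h6] at h4
        omega
      obtain ⟨B, hB1, hB2, hB3, hB4⟩ := ihr (nb U) hN (by
        unfold degSum
        rw [mul_comm, ← smul_eq_mul]
        exact Finset.card_nsmul_le_sum _ _ _ hdeg)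
      have hnbU : ∀ z ∈ nb U, z ∉ U := fun z hz =>
        (Finset.mem_sdiff.1 (Finset.mem_filter.1 hz).1).2
      have hUB : ∀ i, ∃ p ∈ (U : Set V), ∃ q ∈ B i, G.Adj p q := by
        intro i
        obtain ⟨q⟩ := (hB2 i).nonempty
        obtain ⟨-, x, hx, hxq⟩ := Finset.mem_filter.1 (hB1 i q.2)
        exact ⟨x, hx, q, q.2, hxq⟩
      have hUd : ∀ i, Disjoint (U : Set V) (B i) := by
        intro i
        rw [Set.disjoint_left]
        intro z hz hz'
        exact hnbU z (hB1 i hz') hz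
      refine ⟨Fin.cons (U : Set V) B, ?_, ?_, ?_, ?_⟩
      · refine Fin.cases ?_ fun i => ?_
        · exact hUA
        · intro z hz
          exact (Finset.mem_sdiff.1 (Finset.mem_filter.1 (hB1 i hz)).1).1
      · exact Fin.cases hUc hB2
      · refine Fin.cases (Fin.cases (fun h => absurd rfl h) fun j _ => hUd j) fun i =>
          Fin.cases (fun _ => (hUd i).symm) fun j hij => hB3 i j (fun h => hij (by rw [h]))
      · refine Fin.cases (Fin.cases (fun h => absurd rfl h) fun j _ => hUB j) fun i =>
          Fin.cases (fun _ => ?_) fun j hij => hB4 i j (fun h => hij (by rw [h]))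
        obtain ⟨p, hp, q, hq, hpq⟩ := hUB i
        exact ⟨q, hq, p, hp, hpq.symm⟩
    -- With no neighbours outside, `U` can be discarded: the remaining set is still dense enough and
    -- smaller.
    · rw [Finset.not_nonempty_iff_eq_empty] at hN
      rw [hN, Finset.card_empty, mul_zero, add_zero] at hUe
      rcases (A \ U).eq_empty_or_nonempty with h | h
      · rw [h] at hUe
        simp only [Finset.card_empty, degSum, Finset.sum_empty] at hUe
        omega
      · obtain ⟨B, hB1, hB2⟩ := ihA (A \ U) (Finset.sdiff_ssubset hUA hUne) h
          (le_trans (Nat.mul_le_mul_left _ (Nat.le_succ _)) hUe)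
        exact ⟨B, fun i => (hB1 i).trans (Finset.coe_subset.2 Finset.sdiff_subset), hB2⟩

lemma exists_orientation_of_degenerate (G : SimpleGraph V) (D : ℕ)
    (h : ∀ A : Finset V, A.Nonempty → ∃ v ∈ A, degIn G A v ≤ D) (A : Finset V) :
    ∃ o : V → Finset V, (∀ v, (o v).card ≤ D) ∧
      ∀ v ∈ A, ∀ w ∈ A, G.Adj v w → w ∈ o v ∨ v ∈ o w := by
  classical
  induction A using Finset.strongInduction with
  | H A ih =>
  rcases A.eq_empty_or_nonempty with rfl | hne
  · exact ⟨fun _ => ∅, by simp, by simp⟩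
  obtain ⟨v, hv, hd⟩ := h A hne
  obtain ⟨o, ho1, ho2⟩ := ih (A.erase v) (Finset.erase_ssubset hv)
  refine ⟨Function.update o v (A.filter (G.Adj v)), ?_, ?_⟩
  · intro w
    by_cases hw : w = v
    · subst hw
      simpa [degIn] using hd
    · simpa [hw] using ho1 w
  · intro a ha b hb hab
    by_cases hav : a = v
    · subst hav
      left
      simp [hb, hab]
    by_cases hbv : b = v
    · subst hbv
      right
      simp [ha, hab.symm]
    rw [Function.update_of_ne hav, Function.update_of_ne hbv]
    exact ho2 a (Finset.mem_erase.2 ⟨hav, ha⟩) b (Finset.mem_erase.2 ⟨hbv, hb⟩) hab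

/-- Without a complete minor on `Fintype.card U` vertices every vertex set contains a vertex of
bounded degree inside it; orient edges away from such vertices, removed one by one. -/
lemma exists_orientation {U : Type*} [Fintype U] {K : SimpleGraph U} [Fintype V]
    {G : SimpleGraph V} (h : ¬ IsMinor K G) :
    ∃ o : V → Finset V, (∀ v, (o v).card ≤ maderConst (Fintype.card U)) ∧
      ∀ v w, G.Adj v w → w ∈ o v ∨ v ∈ o w := by
  have key : ∀ A : Finset V, A.Nonempty → ∃ v ∈ A, degIn G A v ≤ maderConst (Fintype.card U) := by
    intro A hA
    by_contra hcon
    push Not at hcon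
    obtain ⟨B, -, hB2, hB3, hB4⟩ := exists_complete_model G (Fintype.card U) A hA (by
      unfold degSum
      rw [mul_comm, ← smul_eq_mul]
      exact Finset.card_nsmul_le_sum _ _ _ fun v hv => (hcon v hv).le)
    have e := Fintype.equivFin U
    exact h ⟨fun a => B (e a), fun a => hB2 _, fun a b hab => hB3 _ _ (e.injective.ne hab),
      fun a b hab => hB4 _ _ (e.injective.ne hab.ne)⟩
  obtain ⟨o, h1, h2⟩ := exists_orientation_of_degenerate G _ key Finset.univ
  exact ⟨o, h1, fun v w => h2 v (Finset.mem_univ _) w (Finset.mem_univ _)⟩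

end Mader

/-! ### The spectral radius and Rayleigh quotients -/

section Spectral

variable {V : Type u} [Fintype V]

open Classical in
/-- The sum of `x` over the neighbours of `v`. -/
noncomputable def nbrSum (G : SimpleGraph V) (x : V → ℝ) (v : V) : ℝ :=
  ∑ w, if G.Adj v w then x w else 0

/-- The quadratic form of the adjacency matrix. -/
noncomputable def quad (G : SimpleGraph V) (x : V → ℝ) : ℝ := ∑ v, x v * nbrSum G x v

open scoped Pointwise in
-- With `l` the largest absolute value of an eigenvalue, `l - A` is positive semidefinite. This
-- gives the Rayleigh bound, and equality puts the vector in the kernel. Connectedness is not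
-- assumed, so the eigenvector is only nonnegative.
lemma exists_perron [Nonempty V] [DecidableEq V] (G : SimpleGraph V) :
    ∃ l : ℝ, 0 ≤ l ∧ rho G = ENNReal.ofReal l ∧
      (∃ x : V → ℝ, (∀ v, 0 ≤ x v) ∧ (∃ v, 0 < x v) ∧ ∀ v, nbrSum G x v = l * x v) ∧
      (∀ z : V → ℝ, quad G z ≤ l * ∑ v, z v ^ 2) ∧
      ∀ z : V → ℝ, quad G z = l * ∑ v, z v ^ 2 → ∀ v, nbrSum G z v = l * z v := by
  classical
  set A : Matrix V V ℝ := G.adjMatrix ℝ with hAdef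
  have hA : A.IsHermitian := by
    rw [Matrix.IsHermitian, Matrix.conjTranspose_eq_transpose_of_trivial]
    exact SimpleGraph.transpose_adjMatrix G
  obtain ⟨i₀, -, hi₀⟩ := Finset.exists_max_image (Finset.univ : Finset V)
    (fun i => |hA.eigenvalues i|) Finset.univ_nonempty
  set l := |hA.eigenvalues i₀| with hl
  have hspec : spectrum ℝ A = Set.range hA.eigenvalues := hA.spectrum_real_eq_range_eigenvalues
  have hrho : rho G = ENNReal.ofReal l := by
    have h1 : rho G = spectralRadius ℝ A := by
      unfold rho
      congr
    rw [h1, spectralRadius, hspec]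
    apply le_antisymm
    · refine iSup₂_le fun k hk => ?_
      obtain ⟨i, rfl⟩ := hk
      change ‖hA.eigenvalues i‖ₑ ≤ _
      rw [Real.enorm_eq_ofReal_abs]
      exact ENNReal.ofReal_le_ofReal (hi₀ i (Finset.mem_univ _))
    · refine le_iSup₂_of_le (hA.eigenvalues i₀) ⟨i₀, rfl⟩ ?_
      rw [hl, ← Real.enorm_eq_ofReal_abs]
      exact le_rfl
  have hB : (l • (1 : Matrix V V ℝ) - A).IsHermitian := by
    refine Matrix.IsHermitian.sub ?_ hA
    rw [Matrix.IsHermitian, Matrix.conjTranspose_eq_transpose_of_trivial]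
    simp
  have hpsd : (l • (1 : Matrix V V ℝ) - A).PosSemidef := by
    rw [hB.posSemidef_iff_eigenvalues_nonneg]
    intro i
    have h1 := hB.eigenvalues_mem_spectrum_real i
    have h2 : l • (1 : Matrix V V ℝ) = algebraMap ℝ _ l := by
      rw [Algebra.algebraMap_eq_smul_one]
    have h4 : spectrum ℝ (l • (1 : Matrix V V ℝ) - A) = ({l} : Set ℝ) - Set.range hA.eigenvalues := by
      rw [h2, ← spectrum.singleton_sub_eq, hspec]
    rw [h4] at h1
    obtain ⟨a, ha, b, ⟨j, rfl⟩, hab⟩ := Set.mem_sub.1 h1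
    rw [Set.mem_singleton_iff] at ha
    subst ha
    have := hi₀ j (Finset.mem_univ _)
    have h3 := le_abs_self (hA.eigenvalues j)
    simp only [Pi.zero_apply]
    linarith
  have hmul : ∀ z v, (A.mulVec z) v = nbrSum G z v := by
    intro z v
    simp only [Matrix.mulVec, dotProduct, nbrSum, hAdef, SimpleGraph.adjMatrix_apply, ite_mul,
      one_mul, zero_mul]
  have hBmul : ∀ z v, ((l • (1 : Matrix V V ℝ) - A).mulVec z) v = l * z v - nbrSum G z v := by
    intro z v
    rw [Matrix.sub_mulVec, Matrix.smul_mulVec, Matrix.one_mulVec, Pi.sub_apply, hmul]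
    simp
  have hBq : ∀ z : V → ℝ, star z ⬝ᵥ ((l • (1 : Matrix V V ℝ) - A).mulVec z) =
      l * ∑ v, z v ^ 2 - quad G z := by
    intro z
    simp only [dotProduct, hBmul, quad, star_trivial]
    rw [Finset.mul_sum, ← Finset.sum_sub_distrib]
    exact Finset.sum_congr rfl fun v _ => by ring
  have hquad : ∀ z : V → ℝ, quad G z ≤ l * ∑ v, z v ^ 2 := by
    intro z
    have := hpsd.dotProduct_mulVec_nonneg z
    rw [hBq] at this
    linarith
  have heq : ∀ z : V → ℝ, quad G z = l * ∑ v, z v ^ 2 → ∀ v, nbrSum G z v = l * z v := by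
    intro z hz v
    have h1 := (hpsd.dotProduct_mulVec_zero_iff z).1 (by rw [hBq, hz, sub_self])
    have h2 := congrFun h1 v
    rw [hBmul] at h2
    simp only [Pi.zero_apply] at h2
    linarith
  refine ⟨l, abs_nonneg _, hrho, ?_, hquad, heq⟩
  set y : V → ℝ := fun v => (hA.eigenvectorBasis i₀) v with hy
  have hy1 : ∀ v, nbrSum G y v = hA.eigenvalues i₀ * y v := by
    intro v
    rw [← hmul]
    exact congrFun (hA.mulVec_eigenvectorBasis i₀) v
  have hy0 : ∃ v, y v ≠ 0 := by
    by_contra hcon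
    push Not at hcon
    refine hA.eigenvectorBasis.orthonormal.ne_zero i₀ ?_
    ext v
    exact hcon v
  obtain ⟨v₀, hv₀⟩ := hy0
  -- The eigenvalue of `y` may be `-l`. Passing to absolute values keeps the norm and does not
  -- decrease the modulus of the quadratic form, so the Rayleigh bound becomes an equality.
  refine ⟨fun v => |y v|, fun v => abs_nonneg _, ⟨v₀, abs_pos.2 hv₀⟩, heq _ ?_⟩
  apply le_antisymm (hquad _)
  have h1 : l * ∑ v, |y v| ^ 2 = |quad G y| := by
    have : quad G y = hA.eigenvalues i₀ * ∑ v, |y v| ^ 2 := by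
      unfold quad
      rw [Finset.mul_sum]
      refine Finset.sum_congr rfl fun v _ => ?_
      rw [hy1, sq_abs]
      ring
    rw [this, abs_mul, abs_of_nonneg (a := ∑ v, |y v| ^ 2)
      (Finset.sum_nonneg fun v _ => sq_nonneg _)]
  rw [h1]
  unfold quad nbrSum
  refine (Finset.abs_sum_le_sum_abs _ _).trans (Finset.sum_le_sum fun v _ => ?_)
  rw [abs_mul]
  refine mul_le_mul_of_nonneg_left ?_ (abs_nonneg _)
  refine (Finset.abs_sum_le_sum_abs _ _).trans (Finset.sum_le_sum fun w _ => ?_)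
  split_ifs <;> simp

lemma rho_lt_of_quad [DecidableEq V] {G G' : SimpleGraph V} {l : ℝ} (hl : 0 ≤ l)
    (h : rho G = ENNReal.ofReal l) (z : V → ℝ) (hz : l * ∑ v, z v ^ 2 < quad G' z) :
    rho G < rho G' := by
  have hne : Nonempty V := by
    by_contra hcon
    rw [not_nonempty_iff] at hcon
    simp [quad] at hz
  obtain ⟨l', hl', h', -, hq, -⟩ := exists_perron G'
  rw [h, h']
  have h1 := hq z
  have h2 : 0 ≤ ∑ v, z v ^ 2 := Finset.sum_nonneg fun v _ => sq_nonneg _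
  have h3 : l < l' := by
    by_contra hcon
    push Not at hcon
    have := mul_le_mul_of_nonneg_right hcon h2
    linarith
  exact (ENNReal.ofReal_lt_ofReal_iff_of_nonneg hl).2 h3

end Spectral

/-! ### Vertices carrying the Perron vector -/

section Perron

variable {V : Type u} [Fintype V]

/-- Every edge of `G` is oriented by `o`, with out-degrees at most `D`. -/
structure IsOrientation (G : SimpleGraph V) (o : V → Finset V) (D : ℕ) : Prop where
  card_le : ∀ v, (o v).card ≤ D
  mem_or_mem : ∀ v w, G.Adj v w → w ∈ o v ∨ v ∈ o w

open Classical in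
-- Each edge is charged, in both directions, to an end that points along it; this turns edge sums
-- into sums with at most `D` terms per vertex.
lemma IsOrientation.sum_adj_le {G : SimpleGraph V} {o : V → Finset V} {D : ℕ}
    (ho : IsOrientation G o D) (f : V → V → ℝ) (hf : ∀ v w, 0 ≤ f v w) :
    ∑ v, ∑ w, (if G.Adj v w then f v w else 0) ≤
      ∑ v, ∑ w ∈ o v, (if G.Adj v w then f v w + f w v else 0) := by
  have h1 : ∀ v w, (if G.Adj v w then f v w else 0) ≤
      (if w ∈ o v then (if G.Adj v w then f v w else 0) else 0) +
      (if v ∈ o w then (if G.Adj v w then f v w else 0) else 0) := by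
    intro v w
    by_cases hvw : G.Adj v w
    · have := hf v w
      rcases ho.mem_or_mem v w hvw with h | h <;> simp only [hvw, h, if_true] <;>
        split_ifs <;> linarith
    · simp [hvw]
  calc _ ≤ ∑ v, ∑ w, ((if w ∈ o v then (if G.Adj v w then f v w else 0) else 0) +
      (if v ∈ o w then (if G.Adj v w then f v w else 0) else 0)) :=
        Finset.sum_le_sum fun v _ => Finset.sum_le_sum fun w _ => h1 v w
    _ = ∑ v, ∑ w, (if w ∈ o v then (if G.Adj v w then f v w else 0) else 0) +
      ∑ v, ∑ w, (if w ∈ o v then (if G.Adj v w then f w v else 0) else 0) := by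
        simp_rw [Finset.sum_add_distrib]
        congr 1
        rw [Finset.sum_comm]
        simp_rw [G.adj_comm]
    _ = _ := by
        rw [← Finset.sum_add_distrib]
        refine Finset.sum_congr rfl fun v _ => ?_
        rw [← Finset.sum_add_distrib, ← Finset.sum_subset (Finset.subset_univ (o v))
          (fun w _ hw => by simp [hw])]
        refine Finset.sum_congr rfl fun w hw => ?_
        simp only [hw, if_true]
        split_ifs <;> simp

open Classical in
/-- The neighbours of `v`. -/
noncomputable def nbrs (G : SimpleGraph V) (v : V) : Finset V := Finset.univ.filter (G.Adj v)

open Classical in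
lemma sum_adj_one (G : SimpleGraph V) (v : V) :
    ∑ w, (if G.Adj v w then (1 : ℝ) else 0) = degIn G Finset.univ v := by
  rw [Finset.sum_boole]
  rfl

open Classical in
lemma IsOrientation.sum_deg_le {G : SimpleGraph V} {o : V → Finset V} {D : ℕ}
    (ho : IsOrientation G o D) :
    ∑ v, (degIn G Finset.univ v : ℝ) ≤ 2 * D * Fintype.card V := by
  have h := ho.sum_adj_le (fun _ _ => 1) (fun _ _ => zero_le_one)
  simp_rw [sum_adj_one] at h
  refine h.trans ?_
  have h2 : ∀ v, ∑ w ∈ o v, (if G.Adj v w then (1 : ℝ) + 1 else 0) ≤ 2 * D := by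
    intro v
    calc _ ≤ ∑ w ∈ o v, (2 : ℝ) := Finset.sum_le_sum fun w _ => by split_ifs <;> norm_num
      _ = (o v).card * 2 := by simp
      _ ≤ _ := by
        have : ((o v).card : ℝ) ≤ D := by exact_mod_cast ho.card_le v
        linarith
  calc _ ≤ ∑ v : V, (2 * D : ℝ) := Finset.sum_le_sum fun v _ => h2 v
    _ = _ := by
      rw [Finset.sum_const, Finset.card_univ, nsmul_eq_mul]
      ring

/-- A nonnegative eigenvector `x` with largest entry `1`, in a sparse graph of order `n` without
complete bipartite subgraphs `K_{g+1,M}`; the numerical conditions hold if `η` is small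
compared with `κ` and `n` is large. -/
structure PerronData (G : SimpleGraph V) (x : V → ℝ) (l κ η : ℝ) (g M D a₀ : ℕ) : Prop where
  exists_orientation : ∃ o, IsOrientation G o D
  card_lt : ∀ A C : Finset V, A.card = g + 1 → (∀ a ∈ A, ∀ v ∈ C, G.Adj a v) → C.card < M
  nonneg : ∀ v, 0 ≤ x v
  le_one : ∀ v, x v ≤ 1
  exists_eq_one : ∃ u, x u = 1
  eig : ∀ v, nbrSum G x v = l * x v
  g_pos : 1 ≤ g
  D_pos : 1 ≤ D
  l_pos : 0 < l
  κ_pos : 0 < κ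
  κ_le : κ ≤ 1 / 2
  η_pos : 0 < η
  η_le : 128 * D * η ≤ 1
  η_le' : 64 * η ≤ κ ^ 2
  l_sq : g * Fintype.card V * (1 - κ) ≤ l ^ 2
  a₀_ge : 2 * D ≤ a₀ * η
  a₀_le : 2 * a₀ ≤ κ * l
  n_ge : (a₀ : ℝ) * (M * 2 ^ a₀) ≤ κ * Fintype.card V
  n_ge' : (a₀ : ℝ) ^ 2 * (M * 2 ^ a₀) ≤ Fintype.card V
  M_le : (M : ℝ) ≤ κ * Fintype.card V

namespace PerronData

variable {G : SimpleGraph V} {x : V → ℝ} {l κ η : ℝ} {g M D a₀ : ℕ}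

open Classical in
/-- The vertices of large degree. -/
noncomputable def high (G : SimpleGraph V) (η : ℝ) : Finset V :=
  Finset.univ.filter fun v => η * Fintype.card V ≤ degIn G Finset.univ v

open Classical in
/-- The sum of `x` over the neighbours of `v` in `A`. -/
noncomputable def sumIn (G : SimpleGraph V) (x : V → ℝ) (A : Finset V) (v : V) : ℝ :=
  ∑ w, if G.Adj v w ∧ w ∈ A then x w else 0

open Classical in
/-- The sum of `x` over the neighbours of `v` outside `A`. -/
noncomputable def sumOut (G : SimpleGraph V) (x : V → ℝ) (A : Finset V) (v : V) : ℝ :=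
  ∑ w, if G.Adj v w ∧ w ∉ A then x w else 0

lemma sumIn_add_sumOut (G : SimpleGraph V) (x : V → ℝ) (A : Finset V) (v : V) :
    sumIn G x A v + sumOut G x A v = nbrSum G x v := by
  classical
  unfold sumIn sumOut nbrSum
  rw [← Finset.sum_add_distrib]
  refine Finset.sum_congr rfl fun w _ => ?_
  by_cases h1 : G.Adj v w <;> by_cases h2 : w ∈ A <;> simp [h1, h2]

open Classical in
/-- The vertices with more than `g` neighbours in `A`. -/
noncomputable def bad (G : SimpleGraph V) (A : Finset V) (g : ℕ) : Finset V :=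
  Finset.univ.filter fun v => g + 1 ≤ degIn G A v

lemma card_pos (P : PerronData G x l κ η g M D a₀) : 0 < (Fintype.card V : ℝ) := by
  obtain ⟨u, -⟩ := P.exists_eq_one
  have : Nonempty V := ⟨u⟩
  exact_mod_cast Fintype.card_pos

lemma card_high_le (P : PerronData G x l κ η g M D a₀) : (high G η).card ≤ a₀ := by
  classical
  obtain ⟨o, ho⟩ := P.exists_orientation
  have h1 : ((high G η).card : ℝ) * (η * Fintype.card V) ≤ 2 * D * Fintype.card V := by
    refine le_trans ?_ ho.sum_deg_le
    rw [← nsmul_eq_mul, ← Finset.sum_const]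
    refine (Finset.sum_le_sum (g := fun v => (degIn G Finset.univ v : ℝ))
      fun v hv => (Finset.mem_filter.1 hv).2).trans ?_
    exact Finset.sum_le_sum_of_subset_of_nonneg (Finset.subset_univ _) fun _ _ _ => by positivity
  have hn := P.card_pos
  have h2 : ((high G η).card : ℝ) * η ≤ a₀ * η := by
    refine le_trans ?_ P.a₀_ge
    refine le_of_mul_le_mul_right ?_ hn
    linarith
  exact_mod_cast le_of_mul_le_mul_right h2 P.η_pos

/-- A bad vertex is a common neighbour of some `g + 1` high vertices. There are at most `2 ^ a₀`
choices, each with fewer than `M` common neighbours. -/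
lemma card_bad_le (P : PerronData G x l κ η g M D a₀) : (bad G (high G η) g).card ≤ M * 2 ^ a₀ := by
  classical
  set A := high G η
  have hsub : bad G A g ⊆ (A.powersetCard (g + 1)).biUnion
      fun S => Finset.univ.filter fun v => ∀ a ∈ S, G.Adj a v := by
    intro v hv
    obtain ⟨S, hS, hcard⟩ := Finset.exists_subset_card_eq (Finset.mem_filter.1 hv).2
    refine Finset.mem_biUnion.2 ⟨S, Finset.mem_powersetCard.2 ⟨fun a ha =>
      (Finset.mem_filter.1 (hS ha)).1, hcard⟩, Finset.mem_filter.2 ⟨Finset.mem_univ _, ?_⟩⟩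
    exact fun a ha => (Finset.mem_filter.1 (hS ha)).2.symm
  refine (Finset.card_le_card hsub).trans (Finset.card_biUnion_le.trans ?_)
  calc _ ≤ ∑ S ∈ A.powersetCard (g + 1), M := Finset.sum_le_sum fun S hS =>
        (P.card_lt S _ (Finset.mem_powersetCard.1 hS).2
          fun a ha v hv => by simpa using (Finset.mem_filter.1 hv).2 a ha).le
    _ = (A.powersetCard (g + 1)).card * M := by simp
    _ ≤ 2 ^ a₀ * M := by
        refine Nat.mul_le_mul_right _ ?_
        calc _ ≤ A.powerset.card := Finset.card_le_card fun S hS =>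
              Finset.mem_powerset.2 (Finset.mem_powersetCard.1 hS).1
          _ = 2 ^ A.card := Finset.card_powerset A
          _ ≤ _ := Nat.pow_le_pow_right (by norm_num) P.card_high_le
    _ = _ := mul_comm _ _

lemma sumIn_le_degIn (P : PerronData G x l κ η g M D a₀) (A : Finset V) (v : V) : sumIn G x A v ≤ degIn G A v := by
  classical
  unfold sumIn degIn
  rw [← Finset.sum_filter]
  calc _ ≤ ∑ w ∈ Finset.univ.filter fun w => G.Adj v w ∧ w ∈ A, (1 : ℝ) :=
        Finset.sum_le_sum fun w _ => P.le_one w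
    _ = ((Finset.univ.filter fun w => G.Adj v w ∧ w ∈ A).card : ℝ) := by simp
    _ ≤ _ := by
      norm_cast
      refine Finset.card_le_card fun w hw => ?_
      simp only [Finset.mem_filter, Finset.mem_univ, true_and] at hw ⊢
      exact hw.symm

lemma sumIn_nonneg (P : PerronData G x l κ η g M D a₀) (A : Finset V) (v : V) : 0 ≤ sumIn G x A v :=
  Finset.sum_nonneg fun w _ => by
    have := P.nonneg w
    split_ifs <;> simp [this]

lemma sumIn_le (P : PerronData G x l κ η g M D a₀) (v : V) : sumIn G x (high G η) v ≤ a₀ := by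
  classical
  refine (P.sumIn_le_degIn _ v).trans ?_
  have h1 : degIn G (high G η) v ≤ (high G η).card := Finset.card_filter_le _ _
  exact_mod_cast h1.trans P.card_high_le

lemma sumIn_le_g (P : PerronData G x l κ η g M D a₀) {v : V} (hv : v ∉ bad G (high G η) g) : sumIn G x (high G η) v ≤ g := by
  classical
  refine (P.sumIn_le_degIn _ v).trans ?_
  have h1 : ¬ g + 1 ≤ degIn G (high G η) v := fun h =>
    hv (Finset.mem_filter.2 ⟨Finset.mem_univ _, h⟩)
  have : degIn G (high G η) v ≤ g := by omega
  exact_mod_cast this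

lemma bad_sum_le (P : PerronData G x l κ η g M D a₀) (b : ℝ) (hb : 0 ≤ b) :
    ∑ _v ∈ bad G (high G η) g, b ≤ b * (M * 2 ^ a₀) := by
  rw [Finset.sum_const, nsmul_eq_mul, mul_comm]
  refine mul_le_mul_of_nonneg_left ?_ hb
  exact_mod_cast P.card_bad_le

/-- If `f` is at most `s` outside the bad vertices and at most `b` everywhere, its sum is
essentially at most `s` times the number of summands. -/
lemma sum_le_of_bad (P : PerronData G x l κ η g M D a₀) (f : V → ℝ) (s b : ℝ) (hs : 0 ≤ s) (hb : 0 ≤ b)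
    (h1 : ∀ v ∉ bad G (high G η) g, f v ≤ s) (h2 : ∀ v, f v ≤ b) (Y : Finset V) :
    ∑ v ∈ Y, f v ≤ s * Y.card + b * (M * 2 ^ a₀) := by
  classical
  have h3 : ∀ v, f v ≤ s + if v ∈ bad G (high G η) g then b else 0 := by
    intro v
    split_ifs with h
    · linarith [h2 v]
    · linarith [h1 v h]
  calc _ ≤ ∑ v ∈ Y, (s + if v ∈ bad G (high G η) g then b else 0) :=
        Finset.sum_le_sum fun v _ => h3 v
    _ = s * Y.card + ∑ v ∈ Y, (if v ∈ bad G (high G η) g then b else 0) := by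
        rw [Finset.sum_add_distrib, Finset.sum_const, nsmul_eq_mul, mul_comm]
    _ ≤ s * Y.card + ∑ v, (if v ∈ bad G (high G η) g then b else 0) := by
        gcongr
        exact Finset.subset_univ _
    _ ≤ _ := by
        rw [← Finset.sum_filter, Finset.filter_mem_eq_inter, Finset.univ_inter]
        linarith [P.bad_sum_le b hb]

lemma half_le (P : PerronData G x l κ η g M D a₀) : (Fintype.card V : ℝ) * g / 2 ≤ l ^ 2 := by
  refine le_trans ?_ P.l_sq
  have h1 := P.κ_le
  have h2 : (0 : ℝ) ≤ g * Fintype.card V := by positivity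
  nlinarith

lemma sumIn_sq_le (P : PerronData G x l κ η g M D a₀) : ∑ v, sumIn G x (high G η) v ^ 2 ≤ 2 * (g : ℝ) ^ 2 * Fintype.card V := by
  have h1 := P.sum_le_of_bad (fun v => sumIn G x (high G η) v ^ 2) ((g : ℝ) ^ 2) ((a₀ : ℝ) ^ 2)
    (by positivity) (by positivity)
    (fun v hv => pow_le_pow_left₀ (P.sumIn_nonneg _ v) (P.sumIn_le_g hv) 2)
    (fun v => pow_le_pow_left₀ (P.sumIn_nonneg _ v) (P.sumIn_le v) 2) Finset.univ
  rw [Finset.card_univ] at h1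
  have h2 := P.n_ge'
  have h3 : (1 : ℝ) ≤ (g : ℝ) ^ 2 := by
    have : (1 : ℝ) ≤ g := by exact_mod_cast P.g_pos
    nlinarith
  nlinarith [P.card_pos]

open Classical in
-- Edges between low-degree vertices carry little of the quadratic form. In the orientation use 2ab
-- ≤ sa² + b²/s with s = l/(8D): tails contribute by the out-degree bound `D`, heads by the degree
-- bound ηn, and each side is at most l/8 times the square sum.
lemma sumOut_quad_le (P : PerronData G x l κ η g M D a₀) : ∑ v, (if v ∈ high G η then 0 else x v * sumOut G x (high G η) v) ≤
    l / 4 * ∑ v, (if v ∈ high G η then 0 else x v ^ 2) := by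
  classical
  obtain ⟨o, ho⟩ := P.exists_orientation
  set A := high G η
  set f : V → V → ℝ := fun v w => if v ∉ A ∧ w ∉ A then x v * x w else 0 with hf
  have hf0 : ∀ v w, 0 ≤ f v w := by
    intro v w
    simp only [hf]
    split_ifs
    · exact mul_nonneg (P.nonneg v) (P.nonneg w)
    · exact le_rfl
  have hlhs : ∑ v, (if v ∈ A then 0 else x v * sumOut G x A v) =
      ∑ v, ∑ w, (if G.Adj v w then f v w else 0) := by
    refine Finset.sum_congr rfl fun v _ => ?_
    by_cases hv : v ∈ A
    · simp [hf, hv]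
    · simp only [hv, if_false, sumOut, Finset.mul_sum, hf]
      refine Finset.sum_congr rfl fun w _ => ?_
      by_cases h1 : G.Adj v w <;> by_cases h2 : w ∈ A <;> simp [h1, h2]
  rw [hlhs]
  refine (ho.sum_adj_le f hf0).trans ?_
  have hD : (0 : ℝ) < D := by exact_mod_cast P.D_pos
  have hl := P.l_pos
  set s : ℝ := l / (8 * D) with hs
  have hs0 : 0 < s := by positivity
  have hterm : ∀ v w, (if G.Adj v w then f v w + f w v else 0) ≤
      (if v ∈ A then 0 else s * x v ^ 2) +
        (if G.Adj v w then (if w ∈ A then 0 else x w ^ 2 / s) else 0) := by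
    intro v w
    have e1 : 0 ≤ x v ^ 2 := sq_nonneg _
    have e2 : 0 ≤ x w ^ 2 / s := by positivity
    have e3 : 0 ≤ s * x v ^ 2 := by positivity
    by_cases h1 : G.Adj v w
    · by_cases hv : v ∈ A
      · simp only [hf, h1, hv]
        simp only [not_true, false_and, and_false, if_true, if_false]
        split_ifs <;> linarith
      · by_cases hw : w ∈ A
        · simp only [hf, h1, hv, hw]
          simp only [not_true, false_and, and_false, if_true, if_false]
          linarith
        · simp only [hf, h1, hv, hw]
          simp only [not_false_iff, and_self, if_true, if_false]
          have h : 0 ≤ (s * x v - x w) ^ 2 / s := by positivity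
          have h' : (s * x v - x w) ^ 2 / s = s * x v ^ 2 + x w ^ 2 / s - 2 * (x v * x w) := by
            field_simp
            ring
          linarith
    · simp only [h1, if_false]
      split_ifs <;> linarith
  set q := ∑ v, (if v ∈ A then 0 else x v ^ 2) with hq
  have hq0 : 0 ≤ q := Finset.sum_nonneg fun v _ => by split_ifs <;> positivity
  have hA1 : ∑ v, ∑ w ∈ o v, (if v ∈ A then 0 else s * x v ^ 2) ≤ s * D * q := by
    rw [hq, Finset.mul_sum]
    refine Finset.sum_le_sum fun v _ => ?_
    rw [Finset.sum_const, nsmul_eq_mul]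
    split_ifs
    · simp
    · have : ((o v).card : ℝ) ≤ D := by exact_mod_cast ho.card_le v
      have e3 : 0 ≤ s * x v ^ 2 := by positivity
      nlinarith
  have hA2 : ∑ v, ∑ w ∈ o v, (if G.Adj v w then (if w ∈ A then 0 else x w ^ 2 / s) else 0) ≤
      η * Fintype.card V / s * q := by
    calc _ ≤ ∑ v, ∑ w, (if G.Adj v w then (if w ∈ A then 0 else x w ^ 2 / s) else 0) := by
          refine Finset.sum_le_sum fun v _ => Finset.sum_le_sum_of_subset_of_nonneg
            (Finset.subset_univ _) fun w _ _ => ?_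
          split_ifs <;> positivity
      _ = ∑ w, (if w ∈ A then 0 else x w ^ 2 / s) * degIn G Finset.univ w := by
          rw [Finset.sum_comm]
          refine Finset.sum_congr rfl fun w _ => ?_
          rw [← sum_adj_one, Finset.mul_sum]
          refine Finset.sum_congr rfl fun v _ => ?_
          rw [G.adj_comm]
          split_ifs <;> simp
      _ ≤ _ := by
          rw [hq, Finset.mul_sum]
          refine Finset.sum_le_sum fun w _ => ?_
          by_cases hw : w ∈ A
          · simp [hw]
          · simp only [hw, if_false]
            have h1 : (degIn G Finset.univ w : ℝ) ≤ η * Fintype.card V := by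
              by_contra hcon
              exact hw (Finset.mem_filter.2 ⟨Finset.mem_univ _, (not_le.1 hcon).le⟩)
            have h2 : 0 ≤ x w ^ 2 / s := by positivity
            calc _ ≤ x w ^ 2 / s * (η * Fintype.card V) := mul_le_mul_of_nonneg_left h1 h2
              _ = _ := by ring
  have h8 : s * D = l / 8 := by
    rw [hs]
    field_simp
  have h9 : η * Fintype.card V / s ≤ l / 8 := by
    rw [div_le_iff₀ hs0, hs]
    have e : l / 8 * (l / (8 * D)) = l ^ 2 / (64 * D) := by
      field_simp
      norm_num
    rw [e, le_div_iff₀ (by positivity)]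
    have e1 := P.η_le
    have e2 := P.half_le
    have e3 : (1 : ℝ) ≤ g := by exact_mod_cast P.g_pos
    nlinarith [P.card_pos]
  calc _ ≤ ∑ v, ∑ w ∈ o v, ((if v ∈ A then 0 else s * x v ^ 2) +
        (if G.Adj v w then (if w ∈ A then 0 else x w ^ 2 / s) else 0)) :=
        Finset.sum_le_sum fun v _ => Finset.sum_le_sum fun w _ => hterm v w
    _ ≤ s * D * q + η * Fintype.card V / s * q := by
        simp_rw [Finset.sum_add_distrib]
        exact add_le_add hA1 hA2
    _ ≤ _ := by
        rw [h8]
        nlinarith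

open Classical in
-- Multiply the eigenvalue equation by `x v` and sum over low vertices. The outer part absorbs l/4
-- of the square sum, the inner part another l/4 at the price of the bound in `sumIn_sq_le` divided
-- by l.
lemma sum_sq_le (P : PerronData G x l κ η g M D a₀) : ∑ v, (if v ∈ high G η then 0 else x v ^ 2) ≤ 8 * g := by
  classical
  set A := high G η
  set q := ∑ v, (if v ∈ A then 0 else x v ^ 2) with hq
  have hl := P.l_pos
  have h1 : l * q = ∑ v, (if v ∈ A then 0 else x v * sumIn G x A v) +
      ∑ v, (if v ∈ A then 0 else x v * sumOut G x A v) := by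
    rw [hq, Finset.mul_sum, ← Finset.sum_add_distrib]
    refine Finset.sum_congr rfl fun v _ => ?_
    split_ifs
    · simp
    · rw [← mul_add, sumIn_add_sumOut, P.eig]
      ring
  have h2 : ∑ v, (if v ∈ A then 0 else x v * sumIn G x A v) ≤
      l / 4 * q + 1 / l * ∑ v, sumIn G x A v ^ 2 := by
    rw [hq, Finset.mul_sum, Finset.mul_sum, ← Finset.sum_add_distrib]
    refine Finset.sum_le_sum fun v _ => ?_
    split_ifs
    · have : 0 ≤ 1 / l * sumIn G x A v ^ 2 := by positivity
      linarith
    · have h : 0 ≤ (l * x v / 2 - sumIn G x A v) ^ 2 / l := by positivity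
      have h' : (l * x v / 2 - sumIn G x A v) ^ 2 / l =
          l / 4 * x v ^ 2 + 1 / l * sumIn G x A v ^ 2 - x v * sumIn G x A v := by
        field_simp
        ring
      linarith
  have h3 := P.sumOut_quad_le
  have h4 := P.sumIn_sq_le
  have h5 : l * q / 2 ≤ 1 / l * (2 * (g : ℝ) ^ 2 * Fintype.card V) := by
    have : 1 / l * ∑ v, sumIn G x A v ^ 2 ≤ 1 / l * (2 * (g : ℝ) ^ 2 * Fintype.card V) :=
      mul_le_mul_of_nonneg_left h4 (by positivity)
    linarith
  have h6 : l ^ 2 * q ≤ 4 * (g : ℝ) ^ 2 * Fintype.card V := by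
    have := mul_le_mul_of_nonneg_left h5 hl.le
    have e : l * (1 / l * (2 * (g : ℝ) ^ 2 * Fintype.card V)) =
      2 * (g : ℝ) ^ 2 * Fintype.card V := by field_simp
    rw [e] at this
    nlinarith
  have h7 : 4 * (g : ℝ) ^ 2 * Fintype.card V ≤ l ^ 2 * (8 * g) := by
    have := P.half_le
    have hg : (0 : ℝ) ≤ g := by positivity
    nlinarith
  exact le_of_mul_le_mul_left (h6.trans h7) (by positivity)

/-- Few high vertices contribute at most `a₀`, which is at most κl/2; the low neighbours contribute
at most κl/2 by Cauchy–Schwarz, from the degree bound ηn and `sum_sq_le`. -/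
lemma le_κ (P : PerronData G x l κ η g M D a₀) {b : V} (hb : b ∉ high G η) : x b ≤ κ := by
  classical
  set A := high G η
  have hl := P.l_pos
  have h1 : l * x b = sumIn G x A b + sumOut G x A b := by
    rw [sumIn_add_sumOut, P.eig]
  have h2 := P.sumIn_le b
  have h3 := P.a₀_le
  have hdeg : (degIn G Finset.univ b : ℝ) ≤ η * Fintype.card V := by
    by_contra hcon
    exact hb (Finset.mem_filter.2 ⟨Finset.mem_univ _, (not_le.1 hcon).le⟩)
  have h4 : sumOut G x A b ^ 2 ≤ (κ * l / 2) ^ 2 := by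
    have e1 : sumOut G x A b = ∑ w, (if G.Adj b w then (1 : ℝ) else 0) *
        (if w ∈ A then 0 else x w) := by
      refine Finset.sum_congr rfl fun w _ => ?_
      by_cases h1 : G.Adj b w <;> by_cases h2 : w ∈ A <;> simp [h1, h2]
    have e2 := Finset.sum_mul_sq_le_sq_mul_sq Finset.univ
      (fun w => if G.Adj b w then (1 : ℝ) else 0) (fun w => if w ∈ A then 0 else x w)
    have e3 : ∑ w, (if G.Adj b w then (1 : ℝ) else 0) ^ 2 = degIn G Finset.univ b := by
      rw [← sum_adj_one]
      exact Finset.sum_congr rfl fun w _ => by split_ifs <;> simp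
    have e4 : ∑ w, (if w ∈ A then 0 else x w) ^ 2 = ∑ w, (if w ∈ A then 0 else x w ^ 2) :=
      Finset.sum_congr rfl fun w _ => by split_ifs <;> simp
    rw [e3, e4] at e2
    rw [e1]
    have e5 := P.sum_sq_le
    have e6 := P.η_le'
    have e7 := P.half_le
    have e8 := P.card_pos
    have e9 : (1 : ℝ) ≤ g := by exact_mod_cast P.g_pos
    calc _ ≤ (degIn G Finset.univ b : ℝ) * ∑ w, (if w ∈ A then 0 else x w ^ 2) := e2
      _ ≤ (η * Fintype.card V) * (8 * g) := by
          refine mul_le_mul hdeg e5 ?_ (by have := P.η_pos; positivity)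
          exact Finset.sum_nonneg fun v _ => by split_ifs <;> positivity
      _ = (64 * η) * (Fintype.card V * g) / 8 := by ring
      _ ≤ κ ^ 2 * (Fintype.card V * g) / 8 := by gcongr
      _ ≤ κ ^ 2 * (2 * l ^ 2) / 8 := by
          have : κ ^ 2 * (Fintype.card V * g) ≤ κ ^ 2 * (2 * l ^ 2) :=
            mul_le_mul_of_nonneg_left (by linarith) (sq_nonneg _)
          linarith
      _ = _ := by ring
  have h5 : sumOut G x A b ≤ κ * l / 2 := by
    have := P.κ_pos
    exact le_of_sq_le_sq h4 (by positivity) 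
  have h6 : l * x b ≤ l * κ := by nlinarith
  exact le_of_mul_le_mul_left h6 hl

/-- The eigenvalue equation is applied twice. Steps into high vertices cost at most κl², and second
steps into low vertices at most κ times the degree sum, so only second steps into high vertices
matter. -/
lemma l_sq_mul_le (P : PerronData G x l κ η g M D a₀) (v : V) : l ^ 2 * (x v - κ) ≤
    (∑ y ∈ nbrs G v, sumIn G x (high G η) y) + 2 * D * κ * Fintype.card V := by
  classical
  set A := high G η
  obtain ⟨o, ho⟩ := P.exists_orientation
  have hl := P.l_pos
  have h1 : l ^ 2 * x v = ∑ y ∈ nbrs G v, l * x y := by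
    rw [pow_two, mul_assoc, ← P.eig v, nbrSum, Finset.mul_sum, nbrs, Finset.sum_filter]
    exact Finset.sum_congr rfl fun y _ => by split_ifs <;> simp
  have h2 : ∀ y, l * x y ≤ (if y ∈ A then l else 0) + sumIn G x A y +
      κ * degIn G Finset.univ y := by
    intro y
    have e1 := P.sumIn_nonneg A y
    have e2 : 0 ≤ κ * (degIn G Finset.univ y : ℝ) := by have := P.κ_pos; positivity
    split_ifs with hy
    · have := mul_le_mul_of_nonneg_left (P.le_one y) hl.le
      linarith
    · have e3 : sumOut G x A y ≤ κ * degIn G Finset.univ y := by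
        rw [← sum_adj_one, Finset.mul_sum, sumOut]
        refine Finset.sum_le_sum fun w _ => ?_
        have := P.κ_pos
        by_cases h1 : G.Adj y w <;> by_cases h2 : w ∈ A <;> simp [h1, h2, this.le]
        exact P.le_κ h2
      rw [← P.eig, ← sumIn_add_sumOut G x A]
      linarith
  have h3 : ∑ y ∈ nbrs G v, (if y ∈ A then l else 0) ≤ κ * l ^ 2 := by
    calc _ ≤ ∑ y, (if y ∈ A then l else 0) :=
          Finset.sum_le_sum_of_subset_of_nonneg (Finset.subset_univ _) fun y _ _ => by
            split_ifs <;> simp [hl.le]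
      _ = A.card * l := by
          rw [← Finset.sum_filter, Finset.filter_mem_eq_inter, Finset.univ_inter]
          simp
      _ ≤ a₀ * l := by
          have : (A.card : ℝ) ≤ a₀ := by exact_mod_cast P.card_high_le
          gcongr
      _ ≤ _ := by
          have := P.a₀_le
          have h : (0 : ℝ) ≤ a₀ := by positivity
          nlinarith
  have h4 : ∑ y ∈ nbrs G v, κ * (degIn G Finset.univ y : ℝ) ≤ 2 * D * κ * Fintype.card V := by
    have e := P.κ_pos
    calc _ ≤ ∑ y, κ * (degIn G Finset.univ y : ℝ) :=
          Finset.sum_le_sum_of_subset_of_nonneg (Finset.subset_univ _) fun y _ _ => by positivity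
      _ ≤ _ := by
          rw [← Finset.mul_sum]
          have := mul_le_mul_of_nonneg_left ho.sum_deg_le e.le
          linarith
  have h5 : l ^ 2 * x v ≤ ∑ y ∈ nbrs G v, ((if y ∈ A then l else 0) + sumIn G x A y +
      κ * degIn G Finset.univ y) := by
    rw [h1]
    exact Finset.sum_le_sum fun y _ => h2 y
  rw [Finset.sum_add_distrib, Finset.sum_add_distrib] at h5
  linarith

/-- All but few neighbours contribute at most `g` in `l_sq_mul_le`, while l² is close to at least
gn: a large entry forces a proportionally large degree. -/
lemma degree_ge (P : PerronData G x l κ η g M D a₀) (v : V) :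
    Fintype.card V * (x v - (2 * D + 3) * κ) ≤ (nbrs G v).card := by
  have hn := P.card_pos
  have hκ := P.κ_pos
  have hD : (0 : ℝ) ≤ D := by positivity
  have hg : (1 : ℝ) ≤ g := by exact_mod_cast P.g_pos
  have hd : (0 : ℝ) ≤ (nbrs G v).card := by positivity
  have hx1 := P.le_one v
  by_cases hx : x v ≤ κ
  · have : x v - (2 * D + 3) * κ ≤ 0 := by nlinarith
    nlinarith
  push Not at hx
  have h1 := P.l_sq_mul_le v
  have h2 := P.sum_le_of_bad (fun y => sumIn G x (high G η) y) g a₀ (by positivity)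
    (by positivity) (fun y hy => P.sumIn_le_g hy) P.sumIn_le (nbrs G v)
  have h3 := P.n_ge
  have h4 : g * Fintype.card V * (1 - κ) * (x v - κ) ≤ l ^ 2 * (x v - κ) :=
    mul_le_mul_of_nonneg_right P.l_sq (by linarith)
  have h5 : (g : ℝ) * (Fintype.card V * ((1 - κ) * (x v - κ))) ≤
      g * ((nbrs G v).card + (2 * D + 1) * κ * Fintype.card V) := by
    have : (2 * D + 1) * κ * Fintype.card V ≤ g * ((2 * D + 1) * κ * Fintype.card V) := by
      have : 0 ≤ (2 * D + 1) * κ * Fintype.card V := by positivity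
      nlinarith
    nlinarith
  have h6 := le_of_mul_le_mul_left h5 (by linarith)
  have h7 : x v - 2 * κ ≤ (1 - κ) * (x v - κ) := by nlinarith
  have h8 : Fintype.card V * (x v - 2 * κ) ≤ Fintype.card V * ((1 - κ) * (x v - κ)) :=
    mul_le_mul_of_nonneg_left h7 hn.le
  nlinarith

/-- Averaging in `l_sq_mul_le` at a vertex with entry 1: if every good vertex had a smaller inner
sum, l² would be too small. -/
lemma exists_large_sumIn (P : PerronData G x l κ η g M D a₀)
    (hK : (2 * g + 3 * D + 2) * κ ≤ 1 / 2) :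
    ∃ y ∉ bad G (high G η) g, g - (2 * g + 3 * D + 2) * κ ≤ sumIn G x (high G η) y := by
  by_contra hcon
  push Not at hcon
  obtain ⟨u, hu⟩ := P.exists_eq_one
  have hn := P.card_pos
  have hκ := P.κ_pos
  have hD : (0 : ℝ) ≤ D := by positivity
  have hg : (1 : ℝ) ≤ g := by exact_mod_cast P.g_pos
  have hs : 0 ≤ g - (2 * g + 3 * D + 2) * κ := by linarith
  have h1 := P.l_sq_mul_le u
  have h2 := P.sum_le_of_bad (fun y => sumIn G x (high G η) y) (g - (2 * g + 3 * D + 2) * κ) a₀ hs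
    (by positivity) (fun y hy => (hcon y hy).le) P.sumIn_le (nbrs G u)
  have h3 := P.n_ge
  have h4 : ((nbrs G u).card : ℝ) ≤ Fintype.card V := by
    exact_mod_cast Finset.card_le_univ _
  have h5 : (g - (2 * g + 3 * D + 2) * κ) * (nbrs G u).card ≤
      (g - (2 * g + 3 * D + 2) * κ) * Fintype.card V := mul_le_mul_of_nonneg_left h4 hs
  have h6 : g * Fintype.card V * (1 - κ) * (1 - κ) ≤ l ^ 2 * (1 - κ) :=
    mul_le_mul_of_nonneg_right P.l_sq (by linarith [P.κ_le])
  rw [hu] at h1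
  have h7 : (Fintype.card V : ℝ) * (g * ((1 - κ) * (1 - κ))) ≤
      Fintype.card V * (g - (2 * g + 3 * D + 2) * κ + κ + 2 * D * κ) := by nlinarith
  have h8 := le_of_mul_le_mul_left h7 hn
  have h9 : (g : ℝ) * (1 - 2 * κ) ≤ g * ((1 - κ) * (1 - κ)) :=
    mul_le_mul_of_nonneg_left (by nlinarith) (by linarith)
  nlinarith

open Classical in
/-- The common neighbours of the vertices in `L`. -/
noncomputable def commonNbrs (G : SimpleGraph V) (L : Finset V) : Finset V :=
  Finset.univ.filter fun v => ∀ a ∈ L, G.Adj a v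

/-- A good vertex has at most `g` high neighbours, with entries at most 1. If their sum is nearly
`g`, there are exactly `g` of them and all entries are nearly 1. By `degree_ge` each is adjacent to
nearly everything, so they have many common neighbours. -/
lemma exists_core (P : PerronData G x l κ η g M D a₀)
    (hK : (2 * g + 3 * D + 2) * κ * (4 * (g + 1)) ≤ 1) :
    ∃ L : Finset V, L.card = g ∧ (∀ a ∈ L, 1 / 2 ≤ x a) ∧
      (∀ v ∉ L, x v ≤ (2 * g + 3 * D + 2) * κ * (2 * g + 2)) ∧
      (Fintype.card V : ℝ) / 2 ≤ (commonNbrs G L).card := by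
  classical
  have hn := P.card_pos
  have hκ := P.κ_pos
  have hD : (0 : ℝ) ≤ D := by positivity
  have hg : (1 : ℝ) ≤ g := by exact_mod_cast P.g_pos
  set θ : ℝ := (2 * g + 3 * D + 2) * κ with hθ
  have hθ0 : 0 ≤ θ := by positivity
  have hθ2 : θ ≤ 1 / 2 := by nlinarith
  obtain ⟨y, hy, hyθ⟩ := P.exists_large_sumIn hθ2
  set A := high G η
  set L := A.filter (G.Adj y) with hL
  have hsum : sumIn G x A y = ∑ a ∈ L, x a := by
    rw [hL, sumIn, ← Finset.sum_filter]
    refine Finset.sum_congr ?_ fun _ _ => rfl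
    ext w
    simp [and_comm]
  have hcard_le : L.card ≤ g := by
    by_contra h
    exact hy (Finset.mem_filter.2 ⟨Finset.mem_univ _, by
      change g + 1 ≤ L.card
      omega⟩)
  have hcard : L.card = g := by
    have h1 : ∑ a ∈ L, x a ≤ L.card := by
      calc _ ≤ ∑ a ∈ L, (1 : ℝ) := Finset.sum_le_sum fun a _ => P.le_one a
        _ = _ := by simp
    have h2 : (g : ℝ) < L.card + 1 := by linarith
    have h3 : g < L.card + 1 := by exact_mod_cast h2
    omega
  have hxL : ∀ a ∈ L, 1 - θ ≤ x a := by
    intro a ha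
    have h1 : ∑ b ∈ L.erase a, x b ≤ g - 1 := by
      calc _ ≤ ∑ b ∈ L.erase a, (1 : ℝ) := Finset.sum_le_sum fun a _ => P.le_one a
        _ = ((L.erase a).card : ℝ) := by simp
        _ = _ := by
          have := Finset.card_erase_add_one ha
          rw [hcard] at this
          rw [← this]
          push_cast
          ring
    have h2 := Finset.add_sum_erase L x ha
    linarith
  set C := commonNbrs G L
  have hdeg : ∀ v, Fintype.card V * (x v - θ) ≤ (nbrs G v).card := by
    intro v
    refine le_trans ?_ (P.degree_ge v)
    refine mul_le_mul_of_nonneg_left ?_ hn.le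
    have : (2 * D + 3) * κ ≤ θ := by
      rw [hθ]
      refine mul_le_mul_of_nonneg_right ?_ hκ.le
      have : (1 : ℝ) ≤ D := by exact_mod_cast P.D_pos
      linarith
    linarith
  have hC : (Fintype.card V : ℝ) - C.card ≤ g * (2 * θ * Fintype.card V) := by
    have h1 : Finset.univ \ C ⊆ L.biUnion fun a => Finset.univ \ nbrs G a := by
      intro v hv
      simp only [C, commonNbrs, Finset.mem_sdiff, Finset.mem_univ, true_and, Finset.mem_filter,
        not_forall] at hv
      obtain ⟨a, ha, hav⟩ := hv
      refine Finset.mem_biUnion.2 ⟨a, ha, ?_⟩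
      simpa [nbrs] using hav
    have h2 : (Finset.univ \ C).card ≤ ∑ a ∈ L, (Finset.univ \ nbrs G a).card :=
      (Finset.card_le_card h1).trans Finset.card_biUnion_le
    have h3 : ∀ S : Finset V, ((Finset.univ \ S).card : ℝ) = Fintype.card V - S.card := by
      intro S
      rw [Finset.cast_card_sdiff (Finset.subset_univ _), Finset.card_univ]
    have h4 : ((Finset.univ \ C).card : ℝ) ≤ ∑ a ∈ L, ((Finset.univ \ nbrs G a).card : ℝ) := by
      exact_mod_cast h2
    rw [h3] at h4
    refine h4.trans ?_
    calc _ ≤ ∑ a ∈ L, (2 * θ * Fintype.card V) := Finset.sum_le_sum fun a ha => by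
          rw [h3]
          have e1 := hdeg a
          have e2 := hxL a ha
          nlinarith
      _ = _ := by rw [Finset.sum_const, hcard, nsmul_eq_mul]
  refine ⟨L, hcard, fun a ha => by linarith [hxL a ha], fun v hv => ?_, ?_⟩
  -- Together with `L`, the vertex `v` would form `g + 1` vertices with too many common neighbours;
  -- hence the degree of `v` is small and so is its entry.
  · have h1 : (nbrs G v ∩ C).card < M := by
      refine P.card_lt (insert v L) _ (by rw [Finset.card_insert_of_notMem hv, hcard]) ?_
      intro a ha w hw
      obtain ⟨hw1, hw2⟩ := Finset.mem_inter.1 hw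
      rcases Finset.mem_insert.1 ha with rfl | ha
      · exact (Finset.mem_filter.1 hw1).2
      · exact (Finset.mem_filter.1 hw2).2 a ha
    have h2 : (nbrs G v).card ≤ (nbrs G v ∩ C).card + (Finset.univ \ C).card := by
      rw [← Finset.card_inter_add_card_sdiff (nbrs G v) C]
      gcongr
      exact Finset.subset_univ _
    have h3 : ((nbrs G v).card : ℝ) ≤ M + (Finset.univ \ C).card := by
      exact_mod_cast h2.trans (Nat.add_le_add_right h1.le _)
    rw [Finset.cast_card_sdiff (Finset.subset_univ _), Finset.card_univ] at h3
    have h4 := P.M_le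
    have h5 := hdeg v
    have h6 : κ ≤ θ := by
      rw [hθ]
      nlinarith
    have h7 : (Fintype.card V : ℝ) * x v ≤ Fintype.card V * (θ * (2 * g + 2)) := by
      nlinarith
    exact le_of_mul_le_mul_left h7 hn
  · have : g * (2 * θ * Fintype.card V) ≤ Fintype.card V / 2 := by nlinarith
    linarith

end PerronData

end Perron

set_option maxHeartbeats 1000000 in
lemma exists_core_of_large (g M D : ℕ) (hg : 1 ≤ g) (hD : 1 ≤ D) {ε : ℝ} (hε : 0 < ε) :
    ∃ N : ℕ, ∀ (V : Type u) [Fintype V] (G : SimpleGraph V) (x : V → ℝ) (l : ℝ),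
      N ≤ Fintype.card V → (∃ o, IsOrientation G o D) →
      (∀ A C : Finset V, A.card = g + 1 → (∀ a ∈ A, ∀ v ∈ C, G.Adj a v) → C.card < M) →
      (∀ v, 0 ≤ x v) → (∃ v, 0 < x v) → (∀ v, nbrSum G x v = l * x v) → 0 ≤ l →
      (g : ℝ) * (Fintype.card V - g) ≤ l ^ 2 →
      ∃ L : Finset V, L.card = g ∧ ∃ c > 0, (∀ a ∈ L, c ≤ x a) ∧ (∀ v ∉ L, x v ≤ ε * c) ∧
        (Fintype.card V : ℝ) / 2 ≤ (PerronData.commonNbrs G L).card := by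
  have hg' : (1 : ℝ) ≤ g := by exact_mod_cast hg
  have hD' : (1 : ℝ) ≤ D := by exact_mod_cast hD
  set K : ℝ := 2 * g + 3 * D + 2 with hK
  have hK7 : 7 ≤ K := by linarith
  set κ : ℝ := min ε 1 / (8 * K * (g + 1)) with hκ
  have hmin : 0 < min ε 1 := lt_min hε one_pos
  have hκ0 : 0 < κ := by positivity
  have hκK : K * κ * (8 * (g + 1)) = min ε 1 := by
    rw [hκ]
    field_simp
  have hκK0 : 0 < K * κ := by positivity
  have hm1 : min ε 1 ≤ 1 := min_le_right _ _
  have hmε : min ε 1 ≤ ε := min_le_left _ _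
  have hKκ : K * κ ≤ 1 / 8 := by
    have := mul_le_mul_of_nonneg_left (by linarith : (8 : ℝ) ≤ 8 * (g + 1)) hκK0.le
    linarith
  have hκ1 : κ ≤ 1 / 2 := by
    have := mul_le_mul_of_nonneg_right hK7 hκ0.le
    linarith
  set η : ℝ := κ ^ 2 / (128 * D) with hη
  have hη0 : 0 < η := by positivity
  have hηD : 128 * D * η = κ ^ 2 := by
    rw [hη]
    field_simp
  set a₀ : ℕ := ⌈2 * D / η⌉₊ with ha₀
  have ha₀' : 2 * D / η ≤ a₀ := Nat.le_ceil _
  -- Each summand secures one numerical condition of `PerronData`; κ, η and `a₀` are already fixed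
  -- independently of the graph.
  set B : ℝ := g / κ + 2 * (2 * a₀ / κ) ^ 2 + a₀ * (M * 2 ^ a₀) / κ + a₀ ^ 2 * (M * 2 ^ a₀) +
    M / κ with hB
  refine ⟨⌈B⌉₊ + 1, ?_⟩
  intro V _ G x l hN ho hM hx0 hxpos heig hl0 hl
  have hn : B ≤ Fintype.card V := by
    refine (Nat.le_ceil B).trans ?_
    exact_mod_cast (Nat.le_succ _).trans hN
  have hn1 : (1 : ℝ) ≤ Fintype.card V := by
    exact_mod_cast (Nat.le_add_left 1 _).trans hN
  have t1 : 0 ≤ g / κ := by positivity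
  have t2 : 0 ≤ 2 * (2 * a₀ / κ) ^ 2 := by positivity
  have t3 : 0 ≤ a₀ * (M * 2 ^ a₀) / κ := by positivity
  have t4 : (0 : ℝ) ≤ a₀ ^ 2 * (M * 2 ^ a₀) := by positivity
  have t5 : 0 ≤ M / κ := by positivity
  obtain ⟨v₀, hv₀⟩ := hxpos
  obtain ⟨u, -, hu⟩ := Finset.exists_max_image Finset.univ x ⟨v₀, Finset.mem_univ v₀⟩
  have hxu : 0 < x u := hv₀.trans_le (hu v₀ (Finset.mem_univ _))
  have hl1 : g * Fintype.card V * (1 - κ) ≤ l ^ 2 := by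
    refine le_trans ?_ hl
    have : (g : ℝ) ≤ Fintype.card V * κ := by
      rw [← div_le_iff₀ hκ0]
      linarith
    rw [mul_assoc]
    exact mul_le_mul_of_nonneg_left (by linarith) (by linarith)
  have hl2 : (Fintype.card V : ℝ) / 2 ≤ l ^ 2 := by
    refine le_trans ?_ hl1
    have : (Fintype.card V : ℝ) * (1 / 2) ≤ (g * Fintype.card V) * (1 - κ) :=
      by
      refine mul_le_mul ?_ (by linarith) (by norm_num) (by positivity)
      have := mul_le_mul_of_nonneg_right hg' (by linarith : (0 : ℝ) ≤ Fintype.card V)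
      linarith
    linarith
  have hlpos : 0 < l := by
    rcases hl0.eq_or_lt with h | h
    · rw [← h] at hl2
      norm_num at hl2
      linarith
    · exact h
  have P : PerronData G (fun v => x v / x u) l κ η g M D a₀ :=
    { exists_orientation := ho
      card_lt := hM
      nonneg := fun v => div_nonneg (hx0 v) hxu.le
      le_one := fun v => (div_le_one hxu).2 (hu v (Finset.mem_univ _))
      exists_eq_one := ⟨u, div_self hxu.ne'⟩
      eig := by
        intro v
        rw [← mul_div_assoc, ← heig, nbrSum, nbrSum, Finset.sum_div]
        exact Finset.sum_congr rfl fun w _ => by split_ifs <;> simp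
      g_pos := hg
      D_pos := hD
      l_pos := hlpos
      κ_pos := hκ0
      κ_le := hκ1
      η_pos := hη0
      η_le := by
        rw [hηD]
        exact pow_le_one₀ hκ0.le (by linarith)
      η_le' := by
        rw [← hηD]
        have := mul_le_mul_of_nonneg_right hD' hη0.le
        linarith
      l_sq := hl1
      a₀_ge := (div_le_iff₀ hη0).1 ha₀'
      a₀_le := by
        have h1 : (2 * a₀ / κ) ^ 2 ≤ l ^ 2 := by linarith
        have h2 := le_of_sq_le_sq h1 hl0
        rw [div_le_iff₀ hκ0] at h2
        linarith
      n_ge := by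
        have : a₀ * (M * 2 ^ a₀) / κ ≤ Fintype.card V := by linarith
        rw [div_le_iff₀ hκ0] at this
        linarith
      n_ge' := by linarith
      M_le := by
        have : M / κ ≤ Fintype.card V := by linarith
        rw [div_le_iff₀ hκ0] at this
        linarith }
  obtain ⟨L, hL1, hL2, hL3, hL4⟩ := P.exists_core (by rw [← hK]; linarith)
  refine ⟨L, hL1, x u / 2, by positivity, fun a ha => ?_, fun v hv => ?_, hL4⟩
  · have := hL2 a ha
    rw [le_div_iff₀ hxu] at this
    linarith
  · have := hL3 v hv
    rw [div_le_iff₀ hxu, ← hK] at this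
    have h2 : K * κ * (2 * g + 2) ≤ ε / 2 := by linarith
    have := mul_le_mul_of_nonneg_right h2 hxu.le
    linarith

/-! ### The dominating clique -/

section Dominating

variable {V : Type u} [Fintype V]

open Classical in
lemma quad_eq (G : SimpleGraph V) (x : V → ℝ) :
    quad G x = ∑ v, ∑ w, if G.Adj v w then x v * x w else 0 := by
  unfold quad nbrSum
  refine Finset.sum_congr rfl fun v _ => ?_
  rw [Finset.mul_sum]
  exact Finset.sum_congr rfl fun w _ => by split_ifs <;> simp

/-- The graph `G` restricted to a vertex set, as a graph on all vertices. -/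
def restrict (G : SimpleGraph V) (R : Finset V) : SimpleGraph V where
  Adj a b := G.Adj a b ∧ a ∈ R ∧ b ∈ R
  symm := ⟨fun _ _ h => ⟨h.1.symm, h.2.2, h.2.1⟩⟩
  loopless := ⟨fun _ h => h.1.ne rfl⟩

open Classical in
-- Joining `L` to everything gains at least c times the entry of every vertex outside `L` and `R₁`,
-- in both orders, since each such vertex misses some vertex of `L`. All deleted edges have both
-- ends outside `L`, where entries are at most εc.
lemma quad_join_restrict_sub_ge {G : SimpleGraph V} {o : V → Finset V} {D M : ℕ}
    (ho : IsOrientation G o D) {L Z R₁ : Finset V} (hLR : Disjoint L R₁) (hZ : Z ⊆ R₁)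
    (hR₂ : ∀ b, b ∉ L → b ∉ R₁ → ∃ a ∈ L, ¬ G.Adj a b)
    (hM : ∀ v ∉ L, (R₁.filter (G.Adj v)).card ≤ M)
    {x : V → ℝ} (hx : ∀ v, 0 ≤ x v) {c ε : ℝ} (hc : 0 < c) (hε : 0 ≤ ε) (hL : ∀ a ∈ L, c ≤ x a)
    (hxε : ∀ v ∉ L, x v ≤ ε * c) :
    2 * c * (∑ b, if b ∉ L ∧ b ∉ R₁ then x b else 0) +
      (if ∃ a ∈ L, ∃ a' ∈ L, a ≠ a' ∧ ¬ G.Adj a a' then c ^ 2 else 0) -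
      (2 * M + 2 * D) * ε * c * (∑ b, if b ∉ L ∧ b ∉ R₁ then x b else 0) -
      2 * Z.card * M * (ε * c) ^ 2 ≤ quad (join L (restrict G (R₁ \ Z))) x - quad G x := by
  set G₂ := join L (restrict G (R₁ \ Z)) with hG₂
  -- Gains: `g₁` for new edges from `L` to outside vertices, `g₂` for new edges inside `L`. Losses:
  -- `f` for edges among outside vertices, `l₁` for edges from these to `R₁`, `l₂` for edges of `R₁`
  -- at `Z`.
  set g₁ : V → V → ℝ := fun v w =>
    if v ∈ L ∧ (w ∉ L ∧ w ∉ R₁) ∧ ¬ G.Adj v w then x v * x w else 0 with hg₁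
  set g₂ : V → V → ℝ := fun v w =>
    if v ∈ L ∧ w ∈ L ∧ v ≠ w ∧ ¬ G.Adj v w then x v * x w else 0 with hg₂
  set f : V → V → ℝ := fun v w =>
    if (v ∉ L ∧ v ∉ R₁) ∧ (w ∉ L ∧ w ∉ R₁) then x v * x w else 0 with hf
  set l₁ : V → V → ℝ := fun v w =>
    if (v ∉ L ∧ v ∉ R₁) ∧ w ∈ R₁ ∧ G.Adj v w then x v * x w else 0 with hl₁
  set l₂ : V → V → ℝ := fun v w => if v ∈ Z ∧ w ∈ R₁ ∧ G.Adj v w then x v * x w else 0 with hl₂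
  set s : ℝ := ∑ b, if b ∉ L ∧ b ∉ R₁ then x b else 0 with hs
  have hxx : ∀ v w, 0 ≤ x v * x w := fun v w => mul_nonneg (hx v) (hx w)
  have hL0 : ∀ v ∈ L, v ∉ R₁ := fun v hv => Finset.disjoint_left.1 hLR hv
  have hpt : ∀ v w, g₁ v w + g₁ w v + g₂ v w - (if G.Adj v w then f v w else 0) - l₁ v w - l₁ w v -
      l₂ v w - l₂ w v ≤
      (if G₂.Adj v w then x v * x w else 0) - (if G.Adj v w then x v * x w else 0) := by
    intro v w
    have h0 := hxx v w
    have hcomm : x w * x v = x v * x w := mul_comm _ _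
    by_cases hvL : v ∈ L
    · have hvR := hL0 v hvL
      have hvZ : v ∉ Z := fun h => hvR (hZ h)
      have hadj : G₂.Adj v w ↔ v ≠ w := by simp [hG₂, join, hvL]
      simp only [hg₁, hg₂, hf, hl₁, hl₂, hvL, hvR, hvZ, hadj, true_and, false_and, not_true,
        and_false, if_false, ite_self]
      by_cases hvw : v = w
      · subst hvw
        simp [hvL]
      by_cases ha : G.Adj v w
      · simp [ha, hvw]
      by_cases hwL : w ∈ L
      · simp [ha, hvw, hwL]
      · by_cases hwR : w ∈ R₁ <;> simp [ha, hvw, hwL, hwR, h0]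
    by_cases hwL : w ∈ L
    · have hwR := hL0 w hwL
      have hwZ : w ∉ Z := fun h => hwR (hZ h)
      have hadj : G₂.Adj v w ↔ v ≠ w := by simp [hG₂, join, hwL]
      have hvw : v ≠ w := fun h => hvL (h ▸ hwL)
      simp only [hg₁, hg₂, hf, hl₁, hl₂, hvL, hwL, hwR, hwZ, hadj, true_and, false_and, not_true,
        and_false, if_false, ite_self, hcomm]
      by_cases ha : G.Adj v w
      · simp [ha, hvw, ha.symm]
      have ha' : ¬ G.Adj w v := fun h => ha h.symm
      by_cases hvR : v ∈ R₁ <;> simp [ha, hvw, ha', hvR, h0]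
    · have hadj : G₂.Adj v w ↔ G.Adj v w ∧ (v ∈ R₁ ∧ v ∉ Z) ∧ (w ∈ R₁ ∧ w ∉ Z) := by
        simp only [hG₂, join, hvL, hwL, restrict, false_or, Finset.mem_sdiff]
        exact ⟨fun h => h.2, fun h => ⟨h.1.ne, h⟩⟩
      simp only [hg₁, hg₂, hf, hl₁, hl₂, hvL, hwL, hadj, true_and, false_and, not_false_iff,
        if_false, hcomm, G.adj_comm w v]
      by_cases ha : G.Adj v w
      · by_cases hvR : v ∈ R₁ <;> by_cases hwR : w ∈ R₁ <;> by_cases hvZ : v ∈ Z <;>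
          by_cases hwZ : w ∈ Z <;> simp only [ha, hvR, hwR, hvZ, hwZ, not_true, not_false_iff,
            and_true, and_false, if_true, if_false] <;> linarith
      · simp [ha]
  have hsum : ∑ v, ∑ w, (g₁ v w + g₁ w v + g₂ v w - (if G.Adj v w then f v w else 0) - l₁ v w -
      l₁ w v - l₂ v w - l₂ w v) ≤ quad G₂ x - quad G x := by
    rw [quad_eq, quad_eq, ← Finset.sum_sub_distrib]
    refine Finset.sum_le_sum fun v _ => ?_
    rw [← Finset.sum_sub_distrib]
    exact Finset.sum_le_sum fun w _ => hpt v w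
  have hswap : ∀ h : V → V → ℝ, ∑ v, ∑ w, h w v = ∑ v, ∑ w, h v w := fun h => Finset.sum_comm
  simp only [Finset.sum_sub_distrib, Finset.sum_add_distrib] at hsum
  rw [hswap g₁, hswap l₁, hswap l₂] at hsum
  have hεc : 0 ≤ ε * c := mul_nonneg hε hc.le
  have hg₁' : c * s ≤ ∑ v, ∑ w, g₁ v w := by
    rw [Finset.sum_comm, hs, Finset.mul_sum]
    refine Finset.sum_le_sum fun b _ => ?_
    have h0 : ∀ v ∈ Finset.univ, 0 ≤ g₁ v b := fun v _ => by
      simp only [hg₁]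
      split_ifs
      exacts [hxx _ _, le_rfl]
    split_ifs with hb
    · obtain ⟨a, ha, hab⟩ := hR₂ b hb.1 hb.2
      refine le_trans ?_ (Finset.single_le_sum h0 (Finset.mem_univ a))
      simp only [hg₁, ha, hb, hab, not_false_iff, and_self, if_true]
      exact mul_le_mul_of_nonneg_right (hL a ha) (hx b)
    · rw [mul_zero]
      exact Finset.sum_nonneg h0
  have hg₂' : (if ∃ a ∈ L, ∃ a' ∈ L, a ≠ a' ∧ ¬ G.Adj a a' then c ^ 2 else 0) ≤
      ∑ v, ∑ w, g₂ v w := by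
    have h0 : ∀ v w, 0 ≤ g₂ v w := fun v w => by
      simp only [hg₂]
      split_ifs
      exacts [hxx _ _, le_rfl]
    split_ifs with h
    · obtain ⟨a, ha, a', ha', hne, hadj⟩ := h
      have h1 : g₂ a a' = x a * x a' := by
        simp only [hg₂]
        rw [if_pos ⟨ha, ha', hne, hadj⟩]
      have h2 : c ^ 2 ≤ x a * x a' := by
        rw [pow_two]
        exact mul_le_mul (hL a ha) (hL a' ha') hc.le (hx a)
      rw [← h1] at h2
      refine h2.trans ((Finset.single_le_sum (fun w _ => h0 a w) (Finset.mem_univ a')).trans ?_)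
      exact Finset.single_le_sum (f := fun v => ∑ w, g₂ v w)
        (fun v _ => Finset.sum_nonneg fun w _ => h0 v w) (Finset.mem_univ a)
    · exact Finset.sum_nonneg fun v _ => Finset.sum_nonneg fun w _ => h0 v w
  have hf' : ∑ v, ∑ w, (if G.Adj v w then f v w else 0) ≤ 2 * D * ε * c * s := by
    have h0 : ∀ v w, 0 ≤ f v w := fun v w => by
      simp only [hf]
      split_ifs
      exacts [hxx _ _, le_rfl]
    refine (ho.sum_adj_le f h0).trans ?_
    rw [hs, Finset.mul_sum]
    refine Finset.sum_le_sum fun v _ => ?_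
    by_cases hv : v ∉ L ∧ v ∉ R₁
    · have h1 : ∀ w ∈ o v, (if G.Adj v w then f v w + f w v else 0) ≤ 2 * (ε * c) * x v := by
        intro w _
        have h2 : 0 ≤ 2 * (ε * c) * x v := mul_nonneg (by linarith) (hx v)
        by_cases ha : G.Adj v w
        · by_cases hw : w ∉ L ∧ w ∉ R₁
          · simp only [hf, ha, hv, hw, not_false_iff, and_self, if_true]
            have := mul_le_mul_of_nonneg_left (hxε w hw.1) (hx v)
            linarith
          · simp only [hf, ha, hw, and_false, false_and, if_true, if_false]
            linarith
        · simp only [ha, if_false]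
          exact h2
      refine (Finset.sum_le_sum h1).trans ?_
      rw [Finset.sum_const, nsmul_eq_mul, if_pos hv]
      have h3 : ((o v).card : ℝ) ≤ D := by exact_mod_cast ho.card_le v
      have h2 : 0 ≤ 2 * (ε * c) * x v := mul_nonneg (by linarith) (hx v)
      calc _ ≤ D * (2 * (ε * c) * x v) := mul_le_mul_of_nonneg_right h3 h2
        _ = _ := by ring
    · rw [if_neg hv, mul_zero]
      refine Finset.sum_nonpos fun w _ => ?_
      simp [hf, hv]
  have hnb : ∀ v ∉ L, ∑ w, (if w ∈ R₁ ∧ G.Adj v w then x v * x w else 0) ≤ M * (ε * c) * x v := by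
    intro v hv
    rw [← Finset.sum_filter]
    calc _ ≤ ∑ w ∈ Finset.univ.filter fun w => w ∈ R₁ ∧ G.Adj v w, (ε * c) * x v := by
          refine Finset.sum_le_sum fun w hw => ?_
          have hwR := (Finset.mem_filter.1 hw).2.1
          have hwL : w ∉ L := fun h => hL0 w h hwR
          have := mul_le_mul_of_nonneg_left (hxε w hwL) (hx v)
          linarith
      _ = ((R₁.filter (G.Adj v)).card : ℝ) * ((ε * c) * x v) := by
          rw [Finset.sum_const, nsmul_eq_mul]
          congr 3
          ext w
          simp
      _ ≤ M * ((ε * c) * x v) := by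
          refine mul_le_mul_of_nonneg_right ?_ (mul_nonneg hεc (hx v))
          exact_mod_cast hM v hv
      _ = _ := by ring
  have hl₁' : ∑ v, ∑ w, l₁ v w ≤ M * ε * c * s := by
    rw [hs, Finset.mul_sum]
    refine Finset.sum_le_sum fun v _ => ?_
    by_cases hv : v ∉ L ∧ v ∉ R₁
    · rw [if_pos hv]
      simp only [hl₁, hv, not_false_iff, and_self, true_and]
      refine (hnb v hv.1).trans (le_of_eq (by ring))
    · rw [if_neg hv, mul_zero]
      refine Finset.sum_nonpos fun w _ => ?_
      simp [hl₁, hv]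
  have hl₂' : ∑ v, ∑ w, l₂ v w ≤ Z.card * M * (ε * c) ^ 2 := by
    calc _ = ∑ v ∈ Z, ∑ w, (if w ∈ R₁ ∧ G.Adj v w then x v * x w else 0) := by
          rw [← Finset.sum_subset (Finset.subset_univ Z)]
          · refine Finset.sum_congr rfl fun v hv => ?_
            simp only [hl₂, hv, true_and]
          · intro v _ hv
            simp [hl₂, hv]
      _ ≤ ∑ v ∈ Z, (M * (ε * c) ^ 2 : ℝ) := by
          refine Finset.sum_le_sum fun v hv => ?_
          have hvL : v ∉ L := fun h => hL0 v h (hZ hv)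
          refine (hnb v hvL).trans ?_
          calc _ ≤ M * (ε * c) * (ε * c) :=
                mul_le_mul_of_nonneg_left (hxε v hvL) (mul_nonneg (Nat.cast_nonneg M) hεc)
            _ = _ := by ring
      _ = _ := by
          rw [Finset.sum_const, nsmul_eq_mul]
          ring
  linarith

end Dominating

/-! ### Extremality forces a dominating clique -/

section Dominating

variable {ι : Type u} {W : ι → Type v} [∀ i, Fintype (W i)] {H : ∀ i, SimpleGraph (W i)}

/-- The vertices of `L` supply the missing branch sets. If `L` is not a clique, each is first paired
with a private vertex of `Z`; since `L` is completely joined to `Z`, the pairs are pairwise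
adjacent. -/
lemma minorFree_Gamma_induce {V : Type w} [Fintype V] {G : SimpleGraph V} (hG : MinorFree H G)
    {L R₁ Z : Finset V} (hL : L.card = gammaFam H) (hLR : Disjoint L R₁) (hZ : Z ⊆ R₁)
    (hR₁ : ∀ a ∈ L, ∀ v ∈ R₁, G.Adj a v)
    (h : (∀ a ∈ L, ∀ a' ∈ L, a ≠ a' → G.Adj a a') ∨ Z.card = L.card) {R : Set V}
    (hR : ∀ v ∈ R, v ∈ R₁ ∧ v ∉ Z) :
    MinorFree (Gamma H) (G.induce R) := by
  classical
  rw [minorFree_Gamma_iff]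
  intro i S hS hm
  have hle : Fintype.card {w // w ∉ S} ≤ Fintype.card L := by
    rw [Fintype.card_subtype_compl]
    simp only [Fintype.card_coe, hL, hS]
    omega
  obtain ⟨e⟩ := Function.Embedding.nonempty_of_card_le hle
  have hL0 : ∀ v ∈ L, v ∉ R₁ := fun v hv => Finset.disjoint_left.1 hLR hv
  rcases h with h | h
  · refine hG i (hm.glue (fun a : L => ({a.1} : Set V)) (fun a => connected_induce_singleton _ _)
      ?_ ?_ _ ?_ ?_ e e.injective)
    · intro a b hab
      rw [Set.disjoint_singleton]
      exact fun heq => hab (Subtype.ext heq)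
    · exact fun a b hab => ⟨a, rfl, b, rfl, h a a.2 b b.2 fun heq => hab (Subtype.ext heq)⟩
    · intro a
      rw [Set.disjoint_singleton_left]
      exact fun ha => hL0 a a.2 (hR _ ha).1
    · exact fun a r hr => ⟨a, rfl, hR₁ a a.2 r (hR r hr).1⟩
  · have eζ : L ≃ Z := Fintype.equivOfCardEq (by simp [h])
    have hζ : ∀ a : L, (eζ a : V) ∈ R₁ := fun a => hZ (eζ a).2
    refine hG i (hm.glue (fun a : L => ({a.1, (eζ a).1} : Set V)) ?_ ?_ ?_ _ ?_ ?_ e e.injective)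
    · intro a
      exact SimpleGraph.induce_pair_connected_of_adj (hR₁ a a.2 _ (hζ a))
    · intro k l hkl
      rw [Set.disjoint_left]
      rintro x (rfl | rfl) (hx | hx)
      · exact hkl (Subtype.ext hx)
      · exact hL0 k k.2 (hx ▸ hζ l)
      · exact hL0 l l.2 (hx ▸ hζ k)
      · exact hkl (eζ.injective (Subtype.ext hx))
    · exact fun k l _ => ⟨k, Or.inl rfl, eζ l, Or.inr rfl, hR₁ k k.2 _ (hζ l)⟩
    · intro k
      rw [Set.disjoint_left]
      rintro x (rfl | rfl) hx
      · exact hL0 k k.2 (hR _ hx).1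
      · exact (hR _ hx).2 (eζ k).2
    · exact fun k r hr => ⟨k, Or.inl rfl, hR₁ k k.2 r (hR r hr).1⟩

lemma PerronData.mem_commonNbrs {V : Type w} [Fintype V] {G : SimpleGraph V} {L : Finset V}
    {v : V} : v ∈ PerronData.commonNbrs G L ↔ ∀ a ∈ L, G.Adj a v := by
  simp [PerronData.commonNbrs]

lemma minorFree_restrict [∀ i, Nonempty (W i)] (hdeg : ∀ i, ∀ a : W i, ∃ b, (H i).Adj a b)
    (hconn : ∀ p : GammaIndex H, (Gamma H p).Connected) {V : Type w} [Fintype V]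
    {G : SimpleGraph V} {R : Finset V} (h : MinorFree (Gamma H) (G.induce (R : Set V))) :
    MinorFree (Gamma H) (restrict G R) := by
  refine minorFree_of_disjoint_union hconn (X := (R : Set V)) ?_ ?_ ?_
  · exact fun p _ q hq hpq => hq hpq.2.2
  · exact h.comap id Function.injective_id fun p q hpq => hpq.1
  · exact (minorFree_Gamma_bot (V := V) hdeg hconn).comap Subtype.val Subtype.val_injective
      fun p q hpq => p.2 hpq.2.1

/-- The join contains the complete bipartite graph between `L` and the rest; test vectors constant
on the two sides suffice. -/
lemma le_sq_of_minorFree {V : Type w} [Fintype V] [DecidableEq V] {g : ℕ} (hg : 1 ≤ g)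
    (hgn : g < Fintype.card V) {L : Finset V} (hL : L.card = g) {l : ℝ} (hl : 0 ≤ l)
    {F : SimpleGraph V} (h : rho (join L F) ≤ ENNReal.ofReal l) :
    (g : ℝ) * (Fintype.card V - g) ≤ l ^ 2 := by
  classical
  have key : ∀ a b : ℝ, 0 ≤ a → 0 ≤ b → 2 * (g : ℝ) * (Fintype.card V - g) * (a * b) ≤
      l * (g * a ^ 2 + (Fintype.card V - g) * b ^ 2) := by
    intro a b ha hb
    have hne : Nonempty V := Fintype.card_pos_iff.1 (by omega)
    obtain ⟨l', hl', h', -, hq, -⟩ := exists_perron (join L F)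
    rw [h'] at h
    have hll : l' ≤ l := (ENNReal.ofReal_le_ofReal_iff hl).1 h
    set z : V → ℝ := fun v => if v ∈ L then a else b with hz
    have hcard : ∀ s : ℝ, ∑ v, (if v ∈ L then (1 : ℝ) else 0) = g := by
      intro _
      rw [Finset.sum_boole, Finset.filter_mem_eq_inter, Finset.univ_inter, hL]
    have hcard' : ∑ v : V, (if v ∈ L then (0 : ℝ) else 1) = Fintype.card V - g := by
      have : ∀ v : V, (if v ∈ L then (0 : ℝ) else 1) = 1 - if v ∈ L then (1 : ℝ) else 0 := by
        intro v
        split_ifs <;> norm_num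
      simp_rw [this]
      rw [Finset.sum_sub_distrib, hcard 0]
      simp
    have hsq : ∑ v, z v ^ 2 = g * a ^ 2 + (Fintype.card V - g) * b ^ 2 := by
      rw [← hcard', ← hcard 0, Finset.sum_mul, Finset.sum_mul, ← Finset.sum_add_distrib]
      refine Finset.sum_congr rfl fun v _ => ?_
      by_cases hv : v ∈ L <;> simp [hz, hv]
    have hqd : 2 * (g : ℝ) * (Fintype.card V - g) * (a * b) ≤ quad (join L F) z := by
      have e1 : 2 * (g : ℝ) * (Fintype.card V - g) * (a * b) =
          ∑ v, ∑ w, (((if v ∈ L then (1 : ℝ) else 0) * (if w ∈ L then (0 : ℝ) else 1) +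
            (if w ∈ L then (1 : ℝ) else 0) * (if v ∈ L then (0 : ℝ) else 1)) * (a * b)) := by
        simp_rw [← Finset.sum_mul, Finset.sum_add_distrib, ← Finset.mul_sum, ← Finset.sum_mul,
          ← Finset.mul_sum, hcard 0, hcard']
        ring
      rw [e1, quad_eq]
      refine Finset.sum_le_sum fun v _ => Finset.sum_le_sum fun w _ => ?_
      have hab := mul_nonneg ha hb
      by_cases hv : v ∈ L <;> by_cases hw : w ∈ L
      · simp only [hv, hw, hz, if_true]
        split_ifs <;> nlinarith
      · have : v ≠ w := fun h => hw (h ▸ hv)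
        simp [hv, hw, hz, join, this]
      · have : v ≠ w := fun h => hv (h ▸ hw)
        simp [hv, hw, hz, join, this, mul_comm]
      · simp only [hv, hw, hz, if_false]
        split_ifs <;> nlinarith
    have := hq z
    rw [hsq] at this
    refine hqd.trans (this.trans (mul_le_mul_of_nonneg_right hll ?_))
    rw [← hsq]
    exact Finset.sum_nonneg fun v _ => sq_nonneg _
  have hg' : (1 : ℝ) ≤ g := by exact_mod_cast hg
  have hm : (0 : ℝ) < Fintype.card V - g := by
    have : (g : ℝ) < Fintype.card V := by exact_mod_cast hgn
    linarith
  have hlpos : 0 < l := by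
    rcases hl.eq_or_lt with h0 | h0
    · have := key 1 1 zero_le_one zero_le_one
      rw [← h0] at this
      have h2 : 0 < (g : ℝ) * (Fintype.card V - g) := by positivity
      nlinarith
    · exact h0
  -- The ratio l : g is that of the eigenvector of the bipartite graph if l² = g(n-g), so the test
  -- loses nothing.
  have h1 := key l g hl (by linarith)
  have h2 : (l * g) * ((g : ℝ) * (Fintype.card V - g)) ≤ (l * g) * l ^ 2 := by nlinarith
  exact le_of_mul_le_mul_left h2 (by positivity)

open Classical in
-- Extremality enters only through `hquad`: the competitors have Rayleigh quotients at most `l`. By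
-- `quad_join_restrict_sub_ge` a missing edge in `L`, or positive weight outside `L` and `R₁`, would
-- violate this.
lemma adj_of_core {V : Type w} [Fintype V] {G : SimpleGraph V} {o : V → Finset V} {D M g : ℕ}
    (hg : 1 ≤ g) (ho : IsOrientation G o D) {L R₁ : Finset V} (hLc : L.card = g)
    (hR₁c : g ≤ R₁.card) (hLR : Disjoint L R₁)
    (hR₁ : ∀ a ∈ L, ∀ v ∈ R₁, G.Adj a v) (hR₂ : ∀ b, b ∉ L → b ∉ R₁ → ∃ a ∈ L, ¬ G.Adj a b)
    (hMR : ∀ v ∉ L, (R₁.filter (G.Adj v)).card ≤ M) {x : V → ℝ} (hx0 : ∀ v, 0 ≤ x v)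
    {c ε l : ℝ} (hc : 0 < c) (hε0 : 0 < ε) (hεe : (M + D + 1) * (g + 1) * ε = 1 / 4)
    (hLx : ∀ a ∈ L, c ≤ x a) (hxε : ∀ v ∉ L, x v ≤ ε * c) (heig : ∀ v, nbrSum G x v = l * x v)
    (hquad : ∀ Z ⊆ R₁, ((∀ a ∈ L, ∀ a' ∈ L, a ≠ a' → G.Adj a a') ∨ Z.card = L.card) →
      ∀ R : Finset V, (∀ v ∈ R, v ∈ R₁ ∧ v ∉ Z) → ∃ l₂ ≤ l,
        (∀ z : V → ℝ, quad (join L (restrict G R)) z ≤ l₂ * ∑ v, z v ^ 2) ∧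
        ∀ z : V → ℝ, quad (join L (restrict G R)) z = l₂ * ∑ v, z v ^ 2 →
          ∀ v, nbrSum (join L (restrict G R)) z v = l₂ * z v) :
    ∀ a ∈ L, ∀ v, a ≠ v → G.Adj a v := by
  -- A set `Z` is sacrificed only when `L` is not a clique; its cost of at most c²/2 is then
  -- outweighed by the gain c² from a missing edge.
  obtain ⟨Z, hZ, hZc, hZL⟩ : ∃ Z ⊆ R₁, Z.card ≤ g ∧
      ((∀ a ∈ L, ∀ a' ∈ L, a ≠ a' → G.Adj a a') ∨ Z.card = L.card) ∧
      ((∀ a ∈ L, ∀ a' ∈ L, a ≠ a' → G.Adj a a') → Z = ∅) := by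
    by_cases h : ∀ a ∈ L, ∀ a' ∈ L, a ≠ a' → G.Adj a a'
    · exact ⟨∅, by simp, by simp, Or.inl h, fun _ => rfl⟩
    · obtain ⟨Z, hZ, hZc⟩ := Finset.exists_subset_card_eq hR₁c
      exact ⟨Z, hZ, hZc.le, Or.inr (by rw [hZc, hLc]), fun h' => absurd h' h⟩
  obtain ⟨hZL, hZe⟩ := hZL
  obtain ⟨l₂, hl₂l, hquad₂, hquad_eq₂⟩ := hquad Z hZ hZL (R₁ \ Z)
    fun v hv => Finset.mem_sdiff.1 hv
  have hsq : 0 ≤ ∑ v, x v ^ 2 := Finset.sum_nonneg fun v _ => sq_nonneg _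
  have hqG : quad G x = l * ∑ v, x v ^ 2 := by
    unfold quad
    rw [Finset.mul_sum]
    refine Finset.sum_congr rfl fun v _ => ?_
    rw [heig]
    ring
  have hq2 : quad (join L (restrict G (R₁ \ Z))) x ≤ l * ∑ v, x v ^ 2 :=
    (hquad₂ x).trans (mul_le_mul_of_nonneg_right hl₂l hsq)
  have hdiff := quad_join_restrict_sub_ge ho hLR hZ hR₂ hMR hx0 hc hε0.le hLx hxε
  set s : ℝ := ∑ b, if b ∉ L ∧ b ∉ R₁ then x b else 0 with hs
  have hterm : ∀ b, 0 ≤ if b ∉ L ∧ b ∉ R₁ then x b else 0 := by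
    intro b
    split_ifs
    exacts [hx0 b, le_rfl]
  have hs0 : 0 ≤ s := Finset.sum_nonneg fun b _ => hterm b
  have hε1 : (2 * M + 2 * D) * ε ≤ 1 := by
    have h1 : (0 : ℝ) ≤ (M + D + 1) * g * ε := by positivity
    nlinarith
  have hloss : (2 * M + 2 * D) * ε * c * s ≤ c * s := by
    have := mul_le_mul_of_nonneg_right hε1 (mul_nonneg hc.le hs0)
    linarith
  have hclique : ∀ a ∈ L, ∀ a' ∈ L, a ≠ a' → G.Adj a a' := by
    by_contra hcon
    have hex : ∃ a ∈ L, ∃ a' ∈ L, a ≠ a' ∧ ¬ G.Adj a a' := by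
      push Not at hcon
      exact hcon
    rw [if_pos hex] at hdiff
    have hZ' : (Z.card : ℝ) ≤ g := by exact_mod_cast hZc
    have h1 : 2 * (Z.card : ℝ) * M * (ε * c) ^ 2 ≤ c ^ 2 / 2 := by
      have e0 : ε ≤ 1 := by
        have h1 : (0 : ℝ) ≤ ((M + D + 1) * g + M + D) * ε := by positivity
        nlinarith
      have e1 : (g : ℝ) * M * ε ≤ 1 / 4 := by
        have h1 : (0 : ℝ) ≤ (g * D + g + M + D + 1) * ε := by positivity
        nlinarith
      have e2 : (Z.card : ℝ) * M * ε ≤ 1 / 4 := by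
        refine le_trans ?_ e1
        gcongr
      have e3 : (Z.card : ℝ) * M * ε * ε ≤ 1 / 4 := by
        have : 0 ≤ (Z.card : ℝ) * M * ε := by positivity
        nlinarith
      have := mul_le_mul_of_nonneg_right e3 (sq_nonneg c)
      linarith
    have h2 : 0 < c ^ 2 := by positivity
    have h3 : 0 ≤ c * s := mul_nonneg hc.le hs0
    linarith
  have hZ0 := hZe hclique
  have hs_zero : s = 0 := by
    have h0 : (0 : ℝ) ≤ if ∃ a ∈ L, ∃ a' ∈ L, a ≠ a' ∧ ¬ G.Adj a a' then c ^ 2 else 0 := by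
      split_ifs
      exacts [sq_nonneg c, le_rfl]
    rw [hZ0] at hdiff
    simp only [Finset.card_empty, Nat.cast_zero, mul_zero, zero_mul, sub_zero] at hdiff
    rw [hZ0] at hq2
    have h1 : c * s ≤ 0 := by linarith
    have h2 : 0 ≤ c * s := mul_nonneg hc.le hs0
    have h3 : c * s = 0 := le_antisymm h1 h2
    exact (mul_eq_zero.1 h3).resolve_left hc.ne'
  have hq2' : quad (join L (restrict G (R₁ \ Z))) x = l₂ * ∑ v, x v ^ 2 := by
    apply le_antisymm (hquad₂ x)
    have h0 : (0 : ℝ) ≤ if ∃ a ∈ L, ∃ a' ∈ L, a ≠ a' ∧ ¬ G.Adj a a' then c ^ 2 else 0 := by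
      split_ifs
      exacts [sq_nonneg c, le_rfl]
    have h1 := mul_le_mul_of_nonneg_right hl₂l hsq
    have h2 : (Z.card : ℝ) = 0 := by simp [hZ0]
    rw [hs_zero, h2] at hdiff
    simp only [mul_zero, zero_mul, sub_zero, zero_add] at hdiff
    linarith
  -- An uncovered vertex has entry 0, so the inequality alone does not exclude it. But `x` is now
  -- also an eigenvector of the competitor, where that vertex is adjacent to `L` and has a positive
  -- neighbour sum.
  have hcover : ∀ b, b ∈ L ∨ b ∈ R₁ := by
    intro b
    by_contra hcon
    push Not at hcon
    have hxb : x b = 0 := by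
      have h1 := Finset.single_le_sum (fun b _ => hterm b) (Finset.mem_univ b)
      rw [← hs, hs_zero, if_pos hcon] at h1
      exact le_antisymm h1 (hx0 b)
    have h2 := hquad_eq₂ x hq2' b
    rw [hxb, mul_zero] at h2
    obtain ⟨a, ha⟩ := Finset.card_pos.1 (by omega : 0 < L.card)
    have hab : a ≠ b := fun h => hcon.1 (h ▸ ha)
    have h3 : x a ≤ nbrSum (join L (restrict G (R₁ \ Z))) x b := by
      have h4 := Finset.single_le_sum (s := Finset.univ)
        (f := fun w => if (join L (restrict G (R₁ \ Z))).Adj b w then x w else 0)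
        (fun w _ => by
          split_ifs
          exacts [hx0 w, le_rfl]) (Finset.mem_univ a)
      have h5 : (join L (restrict G (R₁ \ Z))).Adj b a := ⟨hab.symm, Or.inr (Or.inl ha)⟩
      simp only [h5, if_true] at h4
      exact h4
    have := hLx a ha
    linarith
  intro a ha v hav
  rcases hcover v with hv | hv
  · exact hclique a ha v hv hav
  · exact hR₁ a ha v hv

lemma exists_dominating_clique [Nonempty ι] [∀ i, Nonempty (W i)]
    (hdeg : ∀ i, ∀ a : W i, ∃ b, (H i).Adj a b)
    (hstar : ∀ i, ∀ r : W i, H i ≠ SimpleGraph.starGraph r)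
    (hconn : ∀ p : GammaIndex H, (Gamma H p).Connected) :
    ∃ N : ℕ, ∀ n : ℕ, N ≤ n → ∀ G ∈ SPEX n H, ∃ L : Finset (Fin n), L.card = gammaFam H ∧
      ∀ a ∈ L, ∀ v, a ≠ v → G.Adj a v := by
  classical
  obtain ⟨i, hi⟩ := exists_gammaFam_eq H
  set g := gammaFam H with hgdef
  have hg : 1 ≤ g := by
    rw [← hi]
    exact gamma_pos (hdeg i) (hstar i)
  have hlt := indepNum_lt_card (hdeg i)
  set M : ℕ := g + 1 + (H i).indepNum with hM
  set D : ℕ := maderConst (Fintype.card (W i)) + 1 with hD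
  set ε : ℝ := 1 / (4 * (M + D + 1) * (g + 1)) with hε
  have hε0 : 0 < ε := by positivity
  have hεe : (M + D + 1) * (g + 1) * ε = 1 / 4 := by
    rw [hε]
    field_simp
  obtain ⟨N, hN⟩ := exists_core_of_large.{0} g M D hg (Nat.le_add_left 1 _) hε0
  refine ⟨N + 2 * g + 1, fun n hn G hG => ?_⟩
  have hne : Nonempty (Fin n) := ⟨⟨0, by omega⟩⟩
  obtain ⟨l, hl0, hrho, ⟨x, hx0, hxpos, heig⟩, hquad, hquad_eq⟩ := exists_perron G
  have ho : ∃ o, IsOrientation G o D := by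
    obtain ⟨o, h1, h2⟩ := exists_orientation (hG.1 i)
    exact ⟨o, fun v => (h1 v).trans (Nat.le_succ _), h2⟩
  have hcn : ∀ A C : Finset (Fin n), A.card = g + 1 → (∀ a ∈ A, ∀ v ∈ C, G.Adj a v) →
      C.card < M := by
    intro A C hA hC
    have := card_common_neighbors_lt (hG.1 i) A C (by
      rw [hA, ← hi, gamma]
      omega) hC
    rwa [hA] at this
  have hl : (g : ℝ) * (Fintype.card (Fin n) - g) ≤ l ^ 2 := by
    obtain ⟨L₀, -, hL₀⟩ := Finset.exists_subset_card_eq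
      (s := (Finset.univ : Finset (Fin n))) (n := g) (by simp; omega)
    refine le_sq_of_minorFree hg (by simp; omega) hL₀ hl0 (F := ⊥) ?_
    rw [← hrho]
    exact hG.2 _ (minorFree_join (minorFree_Gamma_bot hdeg hconn) hL₀)
  obtain ⟨L, hLc, c, hc, hLx, hxε, hcom⟩ :=
    hN (Fin n) G x l (by simp; omega) ho hcn hx0 hxpos heig hl0 hl
  set R₁ := PerronData.commonNbrs G L with hR₁def
  have hR₁ : ∀ a ∈ L, ∀ v ∈ R₁, G.Adj a v := by
    intro a ha v hv
    exact PerronData.mem_commonNbrs.1 hv a ha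
  have hLR : Disjoint L R₁ := by
    rw [Finset.disjoint_left]
    exact fun a ha ha' => (hR₁ a ha a ha').ne rfl
  have hR₁c : g ≤ R₁.card := by
    have h1 : (g : ℝ) ≤ (Fintype.card (Fin n) : ℝ) / 2 := by
      rw [Fintype.card_fin, le_div_iff₀ two_pos]
      have : g * 2 ≤ n := by omega
      exact_mod_cast this
    exact_mod_cast h1.trans hcom
  have hR₂ : ∀ b, b ∉ L → b ∉ R₁ → ∃ a ∈ L, ¬ G.Adj a b := by
    intro b _ hb
    by_contra hcon
    push Not at hcon
    exact hb (PerronData.mem_commonNbrs.2 hcon)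
  have hMR : ∀ v ∉ L, (@Finset.filter _ (G.Adj v) (fun _ => Classical.propDecidable _) R₁).card ≤ M := by
    intro v hv
    refine (hcn (insert v L) _ (by rw [Finset.card_insert_of_notMem hv, hLc]) ?_).le
    intro a ha w hw
    obtain ⟨hw1, hw2⟩ := Finset.mem_filter.1 hw
    rcases Finset.mem_insert.1 ha with rfl | ha
    · exact hw2
    · exact hR₁ a ha w hw1
  obtain ⟨o, ho⟩ := ho
  refine ⟨L, hLc, adj_of_core hg ho hLc hR₁c hLR hR₁ hR₂ hMR hx0 hc hε0 hεe hLx hxε heig ?_⟩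
  intro Z hZ hZL R hR
  have hfree : MinorFree H (join L (restrict G R)) :=
    minorFree_join (minorFree_restrict hdeg hconn
      (minorFree_Gamma_induce hG.1 hLc hLR hZ hR₁ hZL hR)) hLc
  obtain ⟨l₂, hl₂, hrho₂, -, hquad₂, hquad_eq₂⟩ := exists_perron (join L (restrict G R))
  have hl₂l : l₂ ≤ l := by
    have := hG.2 _ hfree
    rw [hrho, hrho₂] at this
    exact (ENNReal.ofReal_le_ofReal_iff hl0).1 this
  exact ⟨l₂, hl₂l, hquad₂, hquad_eq₂⟩

end Dominating

/-! ### Local modifications below a dominating clique -/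

section Swap

variable {V : Type u} [Fintype V]

/-- No edge of `F` has an end in `L`. -/
def Avoids (F : SimpleGraph V) (L : Finset V) : Prop := ∀ a ∈ L, ∀ b, ¬ F.Adj a b

lemma nbrSum_join_of_notMem {F : SimpleGraph V} {L : Finset V} (hF : Avoids F L) {x : V → ℝ}
    (hx : ∀ a ∈ L, x a = 1) {v : V} (hv : v ∉ L) :
    nbrSum (join L F) x v = L.card + nbrSum F x v := by
  classical
  have h1 : (L.card : ℝ) = ∑ w, if w ∈ L then 1 else 0 := by
    rw [Finset.sum_boole, Finset.filter_mem_eq_inter, Finset.univ_inter]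
  rw [h1, nbrSum, nbrSum, ← Finset.sum_add_distrib]
  refine Finset.sum_congr rfl fun w _ => ?_
  by_cases hw : w ∈ L
  · have h2 : v ≠ w := fun h => hv (h ▸ hw)
    have h3 : ¬ F.Adj v w := fun h => hF w hw v h.symm
    simp [join, hw, h2, h3, hx w hw]
  · by_cases h : F.Adj v w
    · simp [join, hw, h, h.ne]
    · simp [join, hw, h, hv]

open Classical in
lemma quad_join_sub {F F₂ : SimpleGraph V} {L X : Finset V} (hF : Avoids F L) (hF₂ : Avoids F₂ L)
    (hX : Disjoint X L) {x z : V → ℝ} (hx : ∀ a ∈ L, x a = 1) (hz : ∀ v ∉ X, z v = x v) :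
    quad (join L F₂) z - quad (join L F) x =
      2 * L.card * (∑ v ∈ X, (z v - x v)) + (quad F₂ z - quad F x) := by
  have hXL : ∀ v ∈ L, v ∉ X := fun v hv hvX => Finset.disjoint_left.1 hX hvX hv
  have hzL : ∀ a ∈ L, z a = 1 := fun a ha => (hz a (hXL a ha)).trans (hx a ha)
  have key : ∀ (F : SimpleGraph V) (y : V → ℝ), Avoids F L → (∀ a ∈ L, y a = 1) →
      quad (join L F) y = (∑ v, ∑ w, if v ≠ w ∧ (v ∈ L ∧ w ∈ L) then (1 : ℝ) else 0) +
        2 * L.card * (∑ v, if v ∈ L then 0 else y v) + quad F y := by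
    intro F y hF hy
    have h1 : (L.card : ℝ) = ∑ w, if w ∈ L then 1 else 0 := by
      rw [Finset.sum_boole, Finset.filter_mem_eq_inter, Finset.univ_inter]
    have h2 : 2 * (L.card : ℝ) * (∑ v, if v ∈ L then 0 else y v) =
        ∑ v, ∑ w, ((if v ∈ L then (if w ∈ L then 0 else y w) else 0) +
          (if w ∈ L then (if v ∈ L then 0 else y v) else 0)) := by
      simp_rw [Finset.sum_add_distrib]
      rw [Finset.sum_comm (f := fun v w => if w ∈ L then (if v ∈ L then 0 else y v) else 0), h1,
        ← two_mul, mul_assoc, Finset.sum_mul_sum]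
      congr 1
      refine Finset.sum_congr rfl fun v _ => Finset.sum_congr rfl fun w _ => ?_
      split_ifs <;> simp
    rw [h2, quad_eq, quad_eq, ← Finset.sum_add_distrib, ← Finset.sum_add_distrib]
    refine Finset.sum_congr rfl fun v _ => ?_
    rw [← Finset.sum_add_distrib, ← Finset.sum_add_distrib]
    refine Finset.sum_congr rfl fun w _ => ?_
    by_cases hv : v ∈ L <;> by_cases hw : w ∈ L
    · have h3 : ¬ F.Adj v w := hF v hv w
      simp [join, hv, hw, h3, hy v hv, hy w hw]
    · have h2 : v ≠ w := fun h => hw (h ▸ hv)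
      have h3 : ¬ F.Adj v w := hF v hv w
      simp [join, hv, hw, h3, h2, hy v hv]
    · have h2 : v ≠ w := fun h => hv (h ▸ hw)
      have h3 : ¬ F.Adj v w := fun h => hF w hw v h.symm
      simp [join, hv, hw, h3, h2, hy w hw]
    · by_cases h : F.Adj v w
      · simp [join, hv, hw, h, h.ne]
      · simp [join, hv, hw, h]
  rw [key F₂ z hF₂ hzL, key F x hF hx]
  have h3 : ∑ v ∈ X, (z v - x v) =
      (∑ v, if v ∈ L then 0 else z v) - (∑ v, if v ∈ L then 0 else x v) := by
    rw [← Finset.sum_sub_distrib, ← Finset.sum_subset (Finset.subset_univ X)]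
    · refine Finset.sum_congr rfl fun v hv => ?_
      rw [if_neg (Finset.disjoint_left.1 hX hv), if_neg (Finset.disjoint_left.1 hX hv)]
    · intro v _ hv
      rw [hz v hv, sub_self]
  rw [h3]
  ring

open Classical in
lemma nbrSum_split (F : SimpleGraph V) (x : V → ℝ) (X : Finset V) (v : V) :
    nbrSum F x v = (∑ w ∈ X, if F.Adj v w then x w else 0) +
      ∑ w ∈ Xᶜ, if F.Adj v w then x w else 0 :=
  (Finset.sum_add_sum_compl X _).symm

open Classical in
lemma quad_sub_of_agree {F F₂ : SimpleGraph V} {X : Finset V}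
    (hag : ∀ a b, a ∉ X → b ∉ X → (F₂.Adj a b ↔ F.Adj a b))
    (hcr : ∀ a b, a ∈ X → b ∉ X → ¬ F₂.Adj a b) {x z : V → ℝ} {c : ℝ}
    (hz : ∀ v ∉ X, z v = x v) (hzc : ∀ v ∈ X, z v = c) :
    quad F₂ z - quad F x = c ^ 2 * (∑ v ∈ X, ∑ w ∈ X, if F₂.Adj v w then (1 : ℝ) else 0) -
      (∑ v ∈ X, x v * nbrSum F x v) -
      ∑ v ∈ X, x v * ∑ w ∈ Xᶜ, if F.Adj v w then x w else 0 := by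
  have h1 : quad F₂ z = c ^ 2 * (∑ v ∈ X, ∑ w ∈ X, if F₂.Adj v w then (1 : ℝ) else 0) +
      ∑ v ∈ Xᶜ, ∑ w ∈ Xᶜ, if F.Adj v w then x v * x w else 0 := by
    unfold quad
    rw [← Finset.sum_add_sum_compl X, Finset.mul_sum]
    congr 1
    · refine Finset.sum_congr rfl fun v hv => ?_
      rw [nbrSum_split F₂ z X v, hzc v hv]
      have : ∑ w ∈ Xᶜ, (if F₂.Adj v w then z w else 0) = 0 :=
        Finset.sum_eq_zero fun w hw => if_neg (hcr v w hv (Finset.mem_compl.1 hw))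
      rw [this, add_zero, pow_two, mul_assoc, Finset.mul_sum (a := c) (s := X)
        (f := fun w => if F₂.Adj v w then (1 : ℝ) else 0)]
      congr 1
      refine Finset.sum_congr rfl fun w hw => ?_
      rw [hzc w hw]
      split_ifs <;> simp
    · refine Finset.sum_congr rfl fun v hv => ?_
      have hv' := Finset.mem_compl.1 hv
      rw [nbrSum_split F₂ z X v, hz v hv']
      have : ∑ w ∈ X, (if F₂.Adj v w then z w else 0) = 0 :=
        Finset.sum_eq_zero fun w hw => if_neg fun h => hcr w v hw hv' h.symm
      rw [this, zero_add, Finset.mul_sum]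
      refine Finset.sum_congr rfl fun w hw => ?_
      have hw' := Finset.mem_compl.1 hw
      rw [hz w hw']
      simp only [hag v w hv' hw']
      split_ifs <;> simp
  have h2 : quad F x = (∑ v ∈ X, x v * nbrSum F x v) +
      ((∑ v ∈ X, x v * ∑ w ∈ Xᶜ, if F.Adj v w then x w else 0) +
      ∑ v ∈ Xᶜ, ∑ w ∈ Xᶜ, if F.Adj v w then x v * x w else 0) := by
    unfold quad
    rw [← Finset.sum_add_sum_compl X]
    congr 1
    have h3 : ∑ v ∈ X, x v * (∑ w ∈ Xᶜ, if F.Adj v w then x w else 0) =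
        ∑ v ∈ Xᶜ, ∑ w ∈ X, if F.Adj v w then x v * x w else 0 := by
      simp_rw [Finset.mul_sum]
      rw [Finset.sum_comm]
      refine Finset.sum_congr rfl fun v _ => Finset.sum_congr rfl fun w _ => ?_
      rw [F.adj_comm]
      split_ifs <;> simp [mul_comm]
    rw [h3, ← Finset.sum_add_distrib]
    refine Finset.sum_congr rfl fun v _ => ?_
    rw [nbrSum_split F x X v, mul_add, Finset.mul_sum, Finset.mul_sum]
    congr 1 <;> refine Finset.sum_congr rfl fun w _ => ?_ <;> split_ifs <;> simp
  rw [h1, h2]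
  ring

open Classical in
/-- The number of edges of `F` between `X` and its complement. -/
noncomputable def boundary (F : SimpleGraph V) (X : Finset V) : ℝ :=
  ∑ v ∈ X, ∑ w ∈ Xᶜ, if F.Adj v w then (1 : ℝ) else 0

open Classical in
-- To leading order the gain is c² times the increase of the degree sum, at least 2c². Since c
-- solves (l - 2)c = g, entries on `X` occur in the error only with weight deg - 2 or along the
-- boundary, so `X` may be arbitrarily large.
lemma quad_lt_of_swap {F F₂ : SimpleGraph V} {L X : Finset V} (hF : Avoids F L)
    (hF₂ : Avoids F₂ L) (hX : Disjoint X L)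
    (hag : ∀ a b, a ∉ X → b ∉ X → (F₂.Adj a b ↔ F.Adj a b))
    (hcr : ∀ a b, a ∈ X → b ∉ X → ¬ F₂.Adj a b) {x : V → ℝ} {l c δ B : ℝ}
    (hx0 : ∀ v, 0 ≤ x v)
    (hxL : ∀ a ∈ L, x a = 1) (heig : ∀ v, nbrSum (join L F) x v = l * x v)
    (hc : (l - 2) * c = L.card) (hc0 : 0 < c) (hδ : 0 ≤ δ) (hxc : ∀ v ∉ L, |x v - c| ≤ δ)
    (hxx : ∀ v ∉ L, ∀ w ∉ L, x v - x w ≤ δ)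
    (hB : ∑ v ∈ X, |(degIn F Finset.univ v : ℝ) - 2| ≤ B) (hbd : boundary F X ≤ B)
    (hBδ : 4 * (B + 1) * δ ≤ c)
    (hE : quad F (fun _ => 1) + 2 ≤ quad F₂ (fun _ => 1)) :
    l * ∑ v, (if v ∈ X then c else x v) ^ 2 <
      quad (join L F₂) (fun v => if v ∈ X then c else x v) := by
  set z : V → ℝ := fun v => if v ∈ X then c else x v with hzdef
  have hz : ∀ v ∉ X, z v = x v := fun v hv => if_neg hv
  have hzc : ∀ v ∈ X, z v = c := fun v hv => if_pos hv
  have hXL : ∀ v ∈ X, v ∉ L := fun v hv => Finset.disjoint_left.1 hX hv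
  have e1 := quad_join_sub hF hF₂ hX hxL hz
  have e2 := quad_sub_of_agree hag hcr hz hzc
  have e3 := quad_sub_of_agree hag hcr (x := fun _ => 1) (z := fun _ => 1) (c := 1)
    (fun _ _ => rfl) (fun _ _ => rfl)
  set g : ℝ := (L.card : ℝ) with hg
  set E₂ : ℝ := ∑ v ∈ X, ∑ w ∈ X, if F₂.Adj v w then (1 : ℝ) else 0 with hE₂
  set S : ℝ := ∑ v ∈ X, x v with hS
  set O : ℝ := ∑ v ∈ X, x v * ∑ w ∈ Xᶜ, if F.Adj v w then x w else 0 with hO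
  set T : ℝ := ∑ v ∈ X, nbrSum F x v with hT
  have hvX : ∀ v ∈ X, l * x v = g + nbrSum F x v := fun v hv => by
    rw [← heig, nbrSum_join_of_notMem hF hxL (hXL v hv)]
  have hquadG : quad (join L F) x = l * ∑ v, x v ^ 2 := by
    unfold quad
    rw [Finset.mul_sum]
    exact Finset.sum_congr rfl fun v _ => by
      rw [heig]
      ring
  have hsq : l * ∑ v, z v ^ 2 - l * ∑ v, x v ^ 2 =
      l * c ^ 2 * X.card - (g * S + ∑ v ∈ X, x v * nbrSum F x v) := by
    rw [← mul_sub, ← Finset.sum_sub_distrib, ← Finset.sum_subset (Finset.subset_univ X)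
      (fun v _ hv => by rw [hz v hv, sub_self]), Finset.sum_sub_distrib, mul_sub,
      Finset.sum_congr rfl fun v hv => by rw [hzc v hv]]
    rw [Finset.sum_const, nsmul_eq_mul, hS, Finset.mul_sum, Finset.mul_sum (a := g),
      ← Finset.sum_add_distrib]
    congr 1
    · ring
    · refine Finset.sum_congr rfl fun v hv => ?_
      have := hvX v hv
      calc l * x v ^ 2 = x v * (l * x v) := by ring
        _ = _ := by
          rw [this]
          ring
  have hzx : ∑ v ∈ X, (z v - x v) = c * X.card - S := by
    rw [Finset.sum_sub_distrib, Finset.sum_congr rfl fun v hv => hzc v hv, Finset.sum_const,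
      nsmul_eq_mul, mul_comm]
  have hlS : l * S = g * X.card + T := by
    rw [hS, Finset.mul_sum, Finset.sum_congr rfl fun v hv => hvX v hv, Finset.sum_add_distrib,
      Finset.sum_const, nsmul_eq_mul, mul_comm]
  -- The equations for c and for the entries on `X` eliminate `g` and `l`; what remains compares the
  -- edges of `F₂` in `X` with those of `F` meeting `X`, all centred at degree 2.
  have hD : quad (join L F₂) z - l * ∑ v, z v ^ 2 =
      c ^ 2 * (E₂ - 2 * X.card) - c * (T - 2 * S) - O := by
    have e4 : g * S = c * (g * X.card + T - 2 * S) := by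
      linear_combination (-S) * hc + c * hlS
    have e5 : g * c = c ^ 2 * (l - 2) := by
      rw [← hc]
      ring
    rw [hzx] at e1
    have e6 : g * c * X.card = c ^ 2 * (l - 2) * X.card := by rw [e5]
    linear_combination e1 + e2 + hquadG - hsq - e4 + e6
  have hdegX : ∀ v, (degIn F Finset.univ v : ℝ) = (∑ w ∈ X, if F.Adj v w then (1 : ℝ) else 0) +
      ∑ w ∈ Xᶜ, if F.Adj v w then (1 : ℝ) else 0 := by
    intro v
    rw [← sum_adj_one, Finset.sum_add_sum_compl]
  have hT' : T - 2 * S ≤ (∑ v ∈ X, ((degIn F Finset.univ v : ℝ) - 2) * x v) +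
      boundary F X * δ := by
    have t1 : T = (∑ v ∈ X, (∑ w ∈ X, if F.Adj v w then (1 : ℝ) else 0) * x v) +
        ∑ v ∈ X, ∑ w ∈ Xᶜ, if F.Adj v w then x w else 0 := by
      rw [hT, Finset.sum_congr rfl fun v _ => nbrSum_split F x X v, Finset.sum_add_distrib]
      congr 1
      rw [Finset.sum_comm]
      refine Finset.sum_congr rfl fun w _ => ?_
      rw [Finset.sum_mul]
      refine Finset.sum_congr rfl fun v _ => ?_
      rw [F.adj_comm]
      split_ifs <;> simp
    have t2 : ∑ v ∈ X, ∑ w ∈ Xᶜ, (if F.Adj v w then x w else 0) ≤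
        (∑ v ∈ X, (∑ w ∈ Xᶜ, if F.Adj v w then (1 : ℝ) else 0) * x v) + boundary F X * δ := by
      rw [boundary, Finset.sum_mul, ← Finset.sum_add_distrib]
      refine Finset.sum_le_sum fun v hv => ?_
      rw [Finset.sum_mul, Finset.sum_mul, ← Finset.sum_add_distrib]
      refine Finset.sum_le_sum fun w _ => ?_
      split_ifs with h
      · have hw : w ∉ L := fun hw => hF w hw v h.symm
        have := hxx w hw v (hXL v hv)
        linarith
      · simp
    have t3 : ∑ v ∈ X, ((degIn F Finset.univ v : ℝ) - 2) * x v =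
        (∑ v ∈ X, (∑ w ∈ X, if F.Adj v w then (1 : ℝ) else 0) * x v) +
        (∑ v ∈ X, (∑ w ∈ Xᶜ, if F.Adj v w then (1 : ℝ) else 0) * x v) - 2 * S := by
      rw [hS, Finset.mul_sum, ← Finset.sum_add_distrib, ← Finset.sum_sub_distrib]
      refine Finset.sum_congr rfl fun v _ => ?_
      rw [hdegX]
      ring
    linarith
  have hdx : ∑ v ∈ X, ((degIn F Finset.univ v : ℝ) - 2) * x v ≤
      c * ∑ v ∈ X, ((degIn F Finset.univ v : ℝ) - 2) + B * δ := by
    have t1 : ∑ v ∈ X, ((degIn F Finset.univ v : ℝ) - 2) * x v ≤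
        ∑ v ∈ X, (c * ((degIn F Finset.univ v : ℝ) - 2) +
          |(degIn F Finset.univ v : ℝ) - 2| * δ) := by
      refine Finset.sum_le_sum fun v hv => ?_
      have t2 : ((degIn F Finset.univ v : ℝ) - 2) * (x v - c) ≤
          |(degIn F Finset.univ v : ℝ) - 2| * δ :=
        (le_abs_self _).trans (by
          rw [abs_mul]
          exact mul_le_mul_of_nonneg_left (hxc v (hXL v hv)) (abs_nonneg _))
      linarith
    refine t1.trans ?_
    rw [Finset.sum_add_distrib, ← Finset.mul_sum, ← Finset.sum_mul]
    have := mul_le_mul_of_nonneg_right hB hδ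
    linarith
  have hOle : O ≤ boundary F X * (c + δ) ^ 2 := by
    rw [hO, boundary, Finset.sum_mul]
    refine Finset.sum_le_sum fun v hv => ?_
    rw [Finset.mul_sum, Finset.sum_mul]
    refine Finset.sum_le_sum fun w _ => ?_
    split_ifs with h
    · have hw : w ∉ L := fun hw => hF w hw v h.symm
      have h1 := (abs_le.1 (hxc v (hXL v hv))).2
      have h2 := (abs_le.1 (hxc w hw)).2
      rw [one_mul, pow_two]
      exact mul_le_mul (by linarith) (by linarith) (hx0 w) (by linarith)
    · simp
  have hbd0 : 0 ≤ boundary F X := Finset.sum_nonneg fun v _ => Finset.sum_nonneg fun w _ => by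
    split_ifs <;> norm_num
  have hE' : ∑ v ∈ X, ((degIn F Finset.univ v : ℝ) - 2) + boundary F X + 2 ≤ E₂ - 2 * X.card := by
    have t1 : ∑ v ∈ X, ((degIn F Finset.univ v : ℝ) - 2) =
        (∑ v ∈ X, (degIn F Finset.univ v : ℝ)) - 2 * X.card := by
      rw [Finset.sum_sub_distrib, Finset.sum_const, nsmul_eq_mul]
      ring
    have t2 : ∑ v ∈ X, (1 : ℝ) * nbrSum F (fun _ => 1) v =
        ∑ v ∈ X, (degIn F Finset.univ v : ℝ) :=
      Finset.sum_congr rfl fun v _ => by rw [one_mul, nbrSum, sum_adj_one]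
    have t3 : ∑ v ∈ X, (1 : ℝ) * (∑ w ∈ Xᶜ, if F.Adj v w then (1 : ℝ) else 0) = boundary F X := by
      simp only [one_mul]
      rfl
    rw [t2, t3] at e3
    linarith
  set b := boundary F X
  set dX := ∑ v ∈ X, ((degIn F Finset.univ v : ℝ) - 2)
  have hB0 : 0 ≤ B := hbd0.trans hbd
  have f1 : c * (T - 2 * S) ≤ c * (c * dX + B * δ + B * δ) :=
    mul_le_mul_of_nonneg_left (by nlinarith) hc0.le
  have f2 : c ^ 2 * (dX + b + 2) ≤ c ^ 2 * (E₂ - 2 * X.card) :=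
    mul_le_mul_of_nonneg_left hE' (sq_nonneg c)
  have f3 : O ≤ b * c ^ 2 + B * (2 * c * δ + δ ^ 2) := by
    have : b * (2 * c * δ + δ ^ 2) ≤ B * (2 * c * δ + δ ^ 2) :=
      mul_le_mul_of_nonneg_right hbd (by positivity)
    linarith
  have f4 : 0 < 2 * c ^ 2 - 4 * B * c * δ - B * δ ^ 2 := by
    have k1 : c * (4 * (B + 1) * δ) ≤ c * c := mul_le_mul_of_nonneg_left hBδ hc0.le
    have k2 : 0 ≤ B * δ := mul_nonneg hB0 hδ
    have k3 : B * δ ≤ c := by linarith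
    have k4 : δ ≤ c / 4 := by linarith
    have k5 : (B * δ) * δ ≤ c * (c / 4) := mul_le_mul k3 k4 hδ hc0.le
    have k6 : 0 ≤ c * δ := mul_nonneg hc0.le hδ
    have k7 : 0 < c * c := mul_pos hc0 hc0
    linarith
  linarith

/-- Every vertex of `L` has the same entry, the total divided by `l + 1`, which is scaled to 1. Off
`L`, the neighbour sum in `F` lies between 0 and t times the largest entry there. -/
lemma exists_join_eigenvector [Nonempty V] [DecidableEq V] {F : SimpleGraph V} {L : Finset V}
    (hF : Avoids F L) {t : ℕ} (hdeg : ∀ v, degIn F Finset.univ v ≤ t) {l : ℝ}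
    (hl : rho (join L F) = ENNReal.ofReal l) (htl : t < l) :
    ∃ x : V → ℝ, (∀ v, 0 ≤ x v) ∧ (∀ a ∈ L, x a = 1) ∧
      (∀ v, nbrSum (join L F) x v = l * x v) ∧
      ∀ v ∉ L, L.card / l ≤ x v ∧ x v ≤ L.card / (l - t) := by
  classical
  have hl0 : 0 < l := (Nat.cast_nonneg t).trans_lt htl
  obtain ⟨l', hl', hrho, ⟨y, hy0, ⟨v₀, hv₀⟩, heig⟩, -, -⟩ := exists_perron (join L F)
  have hll : l' = l := by
    rw [hl] at hrho
    have := congrArg ENNReal.toReal hrho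
    rw [ENNReal.toReal_ofReal hl0.le, ENNReal.toReal_ofReal hl'] at this
    exact this.symm
  subst hll
  set p : ℝ := (∑ v, y v) / (l' + 1) with hp
  have hS : 0 < ∑ v, y v := Finset.sum_pos' (fun v _ => hy0 v) ⟨v₀, Finset.mem_univ _, hv₀⟩
  have hp0 : 0 < p := by positivity
  have hyL : ∀ a ∈ L, y a = p := by
    intro a ha
    have h1 : nbrSum (join L F) y a = (∑ v, y v) - y a := by
      rw [nbrSum, ← Finset.add_sum_erase _ _ (Finset.mem_univ a),
        ← Finset.add_sum_erase _ y (Finset.mem_univ a)]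
      have h2 : ∑ w ∈ Finset.univ.erase a, (if (join L F).Adj a w then y w else 0) =
          ∑ w ∈ Finset.univ.erase a, y w := by
        refine Finset.sum_congr rfl fun w hw => ?_
        have : a ≠ w := (Finset.ne_of_mem_erase hw).symm
        simp [join, this, ha]
      rw [h2]
      simp
    rw [heig] at h1
    rw [hp, eq_div_iff (by positivity)]
    linarith
  have hxL : ∀ a ∈ L, y a / p = 1 := fun a ha => by rw [hyL a ha, div_self hp0.ne']
  have hxeig : ∀ v, nbrSum (join L F) (fun v => y v / p) v = l' * (y v / p) := by
    intro v
    rw [← mul_div_assoc, ← heig, nbrSum, nbrSum, Finset.sum_div]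
    exact Finset.sum_congr rfl fun w _ => by split_ifs <;> simp
  have hx0 : ∀ v, 0 ≤ y v / p := fun v => div_nonneg (hy0 v) hp0.le
  refine ⟨fun v => y v / p, hx0, hxL, hxeig, fun v hv => ?_⟩
  have hv' : ∀ v ∉ L, l' * (y v / p) = L.card + nbrSum F (fun v => y v / p) v := fun v hv => by
    rw [← hxeig, nbrSum_join_of_notMem hF hxL hv]
  constructor
  · rw [div_le_iff₀ hl0, mul_comm, hv' v hv]
    have : 0 ≤ nbrSum F (fun v => y v / p) v := Finset.sum_nonneg fun w _ => by
      split_ifs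
      exacts [hx0 w, le_rfl]
    linarith
  · obtain ⟨m, hm, hmax⟩ := Finset.exists_max_image Lᶜ (fun v => y v / p)
      ⟨v, Finset.mem_compl.2 hv⟩
    refine (hmax v (Finset.mem_compl.2 hv)).trans ?_
    rw [le_div_iff₀ (by linarith)]
    have h1 : nbrSum F (fun v => y v / p) m ≤ t * (y m / p) := by
      calc _ ≤ ∑ w, (if F.Adj m w then (1 : ℝ) else 0) * (y m / p) := by
            refine Finset.sum_le_sum fun w _ => ?_
            split_ifs with h
            · rw [one_mul]
              exact hmax w (Finset.mem_compl.2 fun hw => hF w hw m h.symm)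
            · simp
        _ = degIn F Finset.univ m * (y m / p) := by rw [← Finset.sum_mul, sum_adj_one]
        _ ≤ _ := by
            refine mul_le_mul_of_nonneg_right ?_ (hx0 m)
            exact_mod_cast hdeg m
    have h2 := hv' m (Finset.mem_compl.1 hm)
    linarith

lemma exists_rho_join_lt (g t B : ℕ) (hg : 1 ≤ g) (ht : 2 ≤ t) :
    ∃ N : ℕ, ∀ (V : Type u) [Fintype V] [DecidableEq V] (F F₂ : SimpleGraph V) (L X : Finset V),
      N ≤ Fintype.card V → L.card = g → Avoids F L → Avoids F₂ L → Disjoint X L →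
      (∀ v, degIn F Finset.univ v ≤ t) →
      (∀ a b, a ∉ X → b ∉ X → (F₂.Adj a b ↔ F.Adj a b)) →
      (∀ a b, a ∈ X → b ∉ X → ¬ F₂.Adj a b) →
      ∑ v ∈ X, |(degIn F Finset.univ v : ℝ) - 2| ≤ B → boundary F X ≤ B →
      quad F (fun _ => 1) + 2 ≤ quad F₂ (fun _ => 1) → rho (join L F) < rho (join L F₂) := by
  classical
  -- Once l ≥ K, the width g/(l-t) - g/l = (g/l) · t/(l-t) of the range of entries is at most g/l
  -- divided by 4(B + 1). As t ≥ 2, the test value g/(l-2) lies in this range.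
  set K : ℕ := t + 4 * t * (B + 1) with hK
  refine ⟨g + K ^ 2 + 1, ?_⟩
  intro V _ _ F F₂ L X hn hL hF hF₂ hX hdeg hag hcr hB hbd hE
  have hne : Nonempty V := Fintype.card_pos_iff.1 (by omega)
  obtain ⟨l, hl0, hrho, -⟩ := exists_perron (join L F)
  have hl2 := le_sq_of_minorFree hg (by omega) hL hl0 hrho.le
  have hg' : (1 : ℝ) ≤ g := by exact_mod_cast hg
  have hB0 : (0 : ℝ) ≤ B := by positivity
  have ht' : (2 : ℝ) ≤ t := by exact_mod_cast ht
  have hlK : (K : ℝ) ≤ l := by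
    refine le_of_sq_le_sq (le_trans ?_ hl2) hl0
    have h1 : ((g + K ^ 2 + 1 : ℕ) : ℝ) ≤ Fintype.card V := by exact_mod_cast hn
    push_cast at h1
    have h2 : (0 : ℝ) ≤ Fintype.card V - g := by nlinarith [sq_nonneg (K : ℝ)]
    nlinarith
  have hlK' : t + 4 * t * (B + 1) ≤ l := by
    rw [hK] at hlK
    push_cast at hlK
    exact hlK
  have h4t : 0 < 4 * t * ((B : ℝ) + 1) := by positivity
  have htl : t < l := by linarith
  have hl2' : 0 < l - 2 := by linarith
  obtain ⟨x, hx0, hxL, heig, hb⟩ :=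
    exists_join_eigenvector hF hdeg hrho htl
  rw [hL] at hb
  set δ : ℝ := g / (l - t) - g / l with hδ
  have hlpos : 0 < l := by linarith
  have hlt : 0 < l - t := by linarith
  have hc1 : g / l ≤ g / (l - 2) := div_le_div_of_nonneg_left (by linarith) hl2' (by linarith)
  have hc2 : g / (l - 2) ≤ g / (l - t) := div_le_div_of_nonneg_left (by linarith) hlt (by linarith)
  have hδc : 4 * ((B : ℝ) + 1) * δ ≤ g / l := by
    have e : δ = g / l * (t / (l - t)) := by
      rw [hδ]
      field_simp
      ring
    have e2 : 4 * ((B : ℝ) + 1) * (t / (l - t)) ≤ 1 := by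
      rw [← mul_div_assoc, div_le_one hlt]
      linarith
    have e3 : 0 ≤ g / l := by positivity
    rw [e]
    calc _ = g / l * (4 * ((B : ℝ) + 1) * (t / (l - t))) := by ring
      _ ≤ g / l * 1 := mul_le_mul_of_nonneg_left e2 e3
      _ = _ := mul_one _
  refine rho_lt_of_quad hl0 hrho (fun v => if v ∈ X then g / (l - 2) else x v) ?_
  have := quad_lt_of_swap (c := g / (l - 2)) (δ := δ) (B := B) hF hF₂ hX hag hcr hx0 hxL heig
    (by rw [hL]; field_simp) (by positivity) (by linarith)
    (fun v hv => by
      have := hb v hv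
      rw [abs_le]
      constructor <;> linarith)
    (fun v hv w hw => by
      have := hb v hv
      have := hb w hw
      linarith) hB hbd (by linarith) hE
  convert this using 1
  · congr!
  · congr!

end Swap

/-! ### Degree sums -/

section DegreeSums

variable {V : Type u} {V' : Type v}

lemma degIn_map {F : SimpleGraph V} {F' : SimpleGraph V'} (f : V ↪ V')
    (hf : ∀ a b, F'.Adj (f a) (f b) ↔ F.Adj a b) (A : Finset V) (v : V) :
    degIn F' (A.map f) (f v) = degIn F A v := by
  classical
  unfold degIn
  rw [Finset.filter_map, Finset.card_map]
  congr 1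
  ext w
  simp [hf]

lemma degSum_map {F : SimpleGraph V} {F' : SimpleGraph V'} (f : V ↪ V')
    (hf : ∀ a b, F'.Adj (f a) (f b) ↔ F.Adj a b) (A : Finset V) :
    degSum F' (A.map f) = degSum F A := by
  unfold degSum
  rw [Finset.sum_map]
  exact Finset.sum_congr rfl fun v _ => degIn_map f hf A v

lemma degSum_univ_induce (F : SimpleGraph V) (X : Finset V) :
    degSum (F.induce (X : Set V)) Finset.univ = degSum F X := by
  classical
  have h := degSum_map (F := F.induce (X : Set V)) (F' := F)
    (Function.Embedding.subtype (· ∈ (X : Set V))) (fun _ _ => Iff.rfl) Finset.univ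
  rw [← h]
  congr 1
  ext v
  simp

lemma sum_degIn_comm (F : SimpleGraph V) (X Y : Finset V) :
    ∑ v ∈ X, degIn F Y v = ∑ v ∈ Y, degIn F X v := by
  classical
  unfold degIn
  simp_rw [Finset.card_filter]
  rw [Finset.sum_comm]
  exact Finset.sum_congr rfl fun v _ => Finset.sum_congr rfl fun w _ => by rw [F.adj_comm]

lemma degIn_mono {F : SimpleGraph V} {X Y : Finset V} (h : X ⊆ Y) (v : V) :
    degIn F X v ≤ degIn F Y v := by
  classical
  exact Finset.card_le_card (Finset.filter_subset_filter _ h)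

variable [Fintype V]

lemma degSum_univ (F : SimpleGraph V) : degSum F Finset.univ = 2 * F.edgeSet.ncard := by
  classical
  rw [Set.ncard_eq_toFinset_card', ← SimpleGraph.edgeFinset,
    ← SimpleGraph.sum_degrees_eq_twice_card_edges]
  unfold degSum
  refine Finset.sum_congr rfl fun v _ => ?_
  rw [← SimpleGraph.card_neighborFinset_eq_degree]
  unfold degIn
  congr 1
  ext w
  simp

lemma degIn_add_degIn_compl [DecidableEq V] (F : SimpleGraph V) (X : Finset V) (v : V) :
    degIn F X v + degIn F Xᶜ v = degIn F Finset.univ v := by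
  classical
  unfold degIn
  rw [← Finset.card_union_of_disjoint, ← Finset.filter_union, Finset.union_compl]
  exact Finset.disjoint_filter_filter disjoint_compl_right

lemma degSum_add_compl [DecidableEq V] (F : SimpleGraph V) (X : Finset V) :
    degSum F Finset.univ = (∑ v ∈ X, degIn F Finset.univ v) + (∑ v ∈ X, degIn F Xᶜ v) +
      degSum F Xᶜ := by
  unfold degSum
  rw [← Finset.sum_add_sum_compl X (degIn F Finset.univ), add_assoc, sum_degIn_comm F X Xᶜ,
    ← Finset.sum_add_distrib]
  congr 1
  refine Finset.sum_congr rfl fun v _ => ?_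
  exact (degIn_add_degIn_compl F X v).symm

lemma boundary_eq [DecidableEq V] (F : SimpleGraph V) (X : Finset V) :
    boundary F X = ((∑ v ∈ X, degIn F Xᶜ v : ℕ) : ℝ) := by
  classical
  unfold boundary degIn
  push_cast
  refine Finset.sum_congr rfl fun v _ => ?_
  rw [Finset.sum_boole]
  congr!

end DegreeSums

/-! ### Classes of sparse graphs closed under disjoint unions -/

/-- A class of graphs that is closed under taking subgraphs and disjoint unions, and whose members
have no star with `t` leaves as a minor. -/
structure IsSparseClass (Q : ∀ V : Type, SimpleGraph V → Prop) (t : ℕ) : Prop where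
  comap : ∀ {V V' : Type} {F : SimpleGraph V} {F' : SimpleGraph V'} (g : V → V'),
    Function.Injective g → (∀ a b, F.Adj a b → F'.Adj (g a) (g b)) → Q V' F' → Q V F
  union : ∀ {V : Type} {F : SimpleGraph V} (X : Set V), (∀ p ∈ X, ∀ q ∉ X, ¬ F.Adj p q) →
    Q _ (F.induce X) → Q _ (F.induce Xᶜ) → Q V F
  star : ∀ {V : Type} {F : SimpleGraph V}, Q V F → ∀ B : Set V, (F.induce B).Connected →
    ∀ T : Finset V, (∀ v ∈ T, v ∉ B) → (∀ v ∈ T, ∃ p ∈ B, F.Adj p v) → T.card < t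

/-- Some graph on `n` vertices in the class has at least `e / 2` edges. -/
def Has (Q : ∀ V : Type, SimpleGraph V → Prop) (n e : ℕ) : Prop :=
  ∃ U : SimpleGraph (Fin n), Q _ U ∧ e ≤ degSum U Finset.univ

/-- The graph `F` can be changed into a graph of the class with more edges by a change that
involves only a bounded part of `F`. -/
def Improvable (Q : ∀ V : Type, SimpleGraph V → Prop) (B : ℕ) {V : Type} [Fintype V]
    (F : SimpleGraph V) : Prop :=
  ∃ (X : Finset V) (F₂ : SimpleGraph V), Q V F₂ ∧
    (∀ a b, a ∉ X → b ∉ X → (F₂.Adj a b ↔ F.Adj a b)) ∧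
    (∀ a b, a ∈ X → b ∉ X → ¬ F₂.Adj a b) ∧
    ∑ v ∈ X, |(degIn F Finset.univ v : ℝ) - 2| ≤ B ∧ boundary F X ≤ B ∧
    degSum F Finset.univ < degSum F₂ Finset.univ

section SparseClass

variable {Q : ∀ V : Type, SimpleGraph V → Prop} {t : ℕ} {V : Type}

lemma IsSparseClass.has_of_fintype (hQ : IsSparseClass Q t) [Fintype V] {F : SimpleGraph V}
    (hF : Q V F) {n : ℕ} (hn : Fintype.card V = n) : Has Q n (degSum F Finset.univ) := by
  classical
  let e : V ≃ Fin n := Fintype.equivFinOfCardEq hn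
  refine ⟨F.comap e.symm, hQ.comap e.symm e.symm.injective (fun _ _ h => h) hF, ?_⟩
  have h := degSum_map (F := F.comap e.symm) (F' := F) e.symm.toEmbedding (fun _ _ => Iff.rfl)
    Finset.univ
  rw [Finset.map_univ_equiv] at h
  exact h.le

lemma IsSparseClass.has_of_finset (hQ : IsSparseClass Q t) {F : SimpleGraph V}
    (hF : Q V F) (X : Finset V) : Has Q X.card (degSum F X) := by
  classical
  rw [← degSum_univ_induce]
  exact hQ.has_of_fintype (hQ.comap _ Subtype.val_injective (fun _ _ h => h) hF) (by simp)

lemma Has.mono {n e e' : ℕ} (h : Has Q n e) (he : e' ≤ e) : Has Q n e' :=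
  let ⟨U, hU, hU'⟩ := h
  ⟨U, hU, he.trans hU'⟩

/-- Replace the subgraph of `F` on `X` by a given graph. -/
lemma IsSparseClass.exists_replace (hQ : IsSparseClass Q t) [Fintype V] [DecidableEq V]
    {F : SimpleGraph V} (hF : Q V F) {X : Finset V} {e : ℕ} (h : Has Q X.card e) :
    ∃ F₂ : SimpleGraph V, Q V F₂ ∧ (∀ a b, a ∉ X → b ∉ X → (F₂.Adj a b ↔ F.Adj a b)) ∧
      (∀ a b, a ∈ X → b ∉ X → ¬ F₂.Adj a b) ∧
      e + degSum F Xᶜ ≤ degSum F₂ Finset.univ := by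
  classical
  obtain ⟨U, hU, he⟩ := h
  let f : X ≃ Fin X.card := X.equivFin
  obtain ⟨F₂, hF₂⟩ : ∃ F₂ : SimpleGraph V, ∀ a b, F₂.Adj a b ↔
      (∃ (ha : a ∈ X) (hb : b ∈ X), U.Adj (f ⟨a, ha⟩) (f ⟨b, hb⟩)) ∨
        (a ∉ X ∧ b ∉ X ∧ F.Adj a b) := by
    refine ⟨⟨fun a b => (∃ (ha : a ∈ X) (hb : b ∈ X), U.Adj (f ⟨a, ha⟩) (f ⟨b, hb⟩)) ∨
      (a ∉ X ∧ b ∉ X ∧ F.Adj a b), ⟨?_⟩, ⟨?_⟩⟩, fun _ _ => Iff.rfl⟩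
    · rintro a b (⟨ha, hb, h⟩ | ⟨ha, hb, h⟩)
      · exact Or.inl ⟨hb, ha, h.symm⟩
      · exact Or.inr ⟨hb, ha, h.symm⟩
    · rintro a (⟨ha, hb, h⟩ | ⟨ha, hb, h⟩)
      · exact U.loopless.irrefl _ h
      · exact F.loopless.irrefl _ h
  have h1 : ∀ a b, a ∉ X → b ∉ X → (F₂.Adj a b ↔ F.Adj a b) := by
    intro a b ha hb
    simp [hF₂, ha, hb]
  have h2 : ∀ a b, a ∈ X → b ∉ X → ¬ F₂.Adj a b := by
    intro a b ha hb
    simp [hF₂, ha, hb]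
  refine ⟨F₂, ?_, h1, h2, ?_⟩
  · refine hQ.union (X : Set V) (fun p hp q hq => h2 p q hp hq) ?_ ?_
    · refine hQ.comap (fun p => f ⟨p.1, p.2⟩) (fun p q hpq => ?_) (fun p q hpq => ?_) hU
      · exact Subtype.ext (congrArg Subtype.val (f.injective hpq))
      · rcases (hF₂ _ _).1 hpq with ⟨_, _, h⟩ | ⟨h, _⟩
        · exact h
        · exact absurd p.2 h
    · refine hQ.comap Subtype.val Subtype.val_injective (fun p q hpq => ?_) hF
      exact (h1 p q p.2 q.2).1 hpq
  · have h3 : ∑ v ∈ X, degIn F₂ Xᶜ v = 0 := by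
      refine Finset.sum_eq_zero fun v hv => ?_
      unfold degIn
      rw [Finset.card_eq_zero, Finset.filter_eq_empty_iff]
      intro w hw
      exact h2 v w hv (Finset.mem_compl.1 hw)
    have h4 : degSum F₂ Xᶜ = degSum F Xᶜ := by
      unfold degSum
      refine Finset.sum_congr rfl fun v hv => ?_
      unfold degIn
      congr 1
      refine Finset.filter_congr fun w hw => ?_
      exact h1 v w (Finset.mem_compl.1 hv) (Finset.mem_compl.1 hw)
    have h5 : degSum F₂ X = degSum U Finset.univ := by
      let g : Fin X.card ↪ V := f.symm.toEmbedding.trans (Function.Embedding.subtype _)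
      have := degSum_map (F := U) (F' := F₂) g (by
        intro a b
        simp [g, hF₂]) Finset.univ
      rw [← this]
      congr 1
      ext v
      simp only [Finset.mem_map, Finset.mem_univ, true_and, g]
      constructor
      · intro hv
        exact ⟨f ⟨v, hv⟩, by simp⟩
      · rintro ⟨a, rfl⟩
        exact (f.symm a).2
    have h6 : ∑ v ∈ X, degIn F₂ Finset.univ v = degSum F₂ X + ∑ v ∈ X, degIn F₂ Xᶜ v := by
      unfold degSum
      rw [← Finset.sum_add_distrib]
      exact Finset.sum_congr rfl fun v _ => (degIn_add_degIn_compl _ _ _).symm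
    have h7 := degSum_add_compl F₂ X
    omega

lemma IsSparseClass.improvable (hQ : IsSparseClass Q t) [Fintype V] [DecidableEq V]
    {F : SimpleGraph V} (hF : Q V F) {X : Finset V} {e B : ℕ} (h : Has Q X.card e)
    (he : (∑ v ∈ X, degIn F Finset.univ v) + (∑ v ∈ X, degIn F Xᶜ v) < e)
    (hB : ∑ v ∈ X, |(degIn F Finset.univ v : ℝ) - 2| ≤ B)
    (hbd : ∑ v ∈ X, degIn F Xᶜ v ≤ B) : Improvable Q B F := by
  obtain ⟨F₂, h1, h2, h3, h4⟩ := hQ.exists_replace hF h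
  refine ⟨X, F₂, h1, h2, h3, hB, ?_, ?_⟩
  · rw [boundary_eq]
    exact_mod_cast hbd
  · have := degSum_add_compl F X
    omega

lemma Improvable.mono [Fintype V] {F : SimpleGraph V} {B B' : ℕ} (h : Improvable Q B F)
    (hB : B ≤ B') : Improvable Q B' F := by
  obtain ⟨X, F₂, h1, h2, h3, h4, h5, h6⟩ := h
  have : (B : ℝ) ≤ B' := by exact_mod_cast hB
  exact ⟨X, F₂, h1, h2, h3, h4.trans this, h5.trans this, h6⟩

lemma IsSparseClass.has_add (hQ : IsSparseClass Q t) {n m e f : ℕ} (h : Has Q n e)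
    (h' : Has Q m f) : Has Q (n + m) (e + f) := by
  classical
  obtain ⟨U, hU, he⟩ := h
  obtain ⟨U', hU', hf⟩ := h'
  have hsum : Q _ (U ⊕g U') := by
    refine hQ.union (Set.range Sum.inl) ?_ ?_ ?_
    · rintro _ ⟨p, rfl⟩ (q | q) hq
      · exact absurd ⟨q, rfl⟩ hq
      · simp
    · refine hQ.comap (fun p => p.2.choose) (fun p q hpq => ?_) (fun p q hpq => ?_) hU
      · have h1 := p.2.choose_spec
        have h2 := q.2.choose_spec
        simp only at hpq
        rw [hpq, h2] at h1
        exact Subtype.ext h1.symm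
      · have h1 := p.2.choose_spec
        have h2 := q.2.choose_spec
        have h3 : (U ⊕g U').Adj p.1 q.1 := hpq
        rw [← h1, ← h2] at h3
        simpa using h3
    · have key : ∀ p : ((Set.range Sum.inl)ᶜ : Set (Fin n ⊕ Fin m)), ∃ q, Sum.inr q = p.1 := by
        rintro ⟨p | p, hp⟩
        · exact absurd ⟨p, rfl⟩ hp
        · exact ⟨p, rfl⟩
      choose g hg using key
      refine hQ.comap g (fun p q hpq => ?_) (fun p q hpq => ?_) hU'
      · exact Subtype.ext (by rw [← hg p, ← hg q, hpq])
      · have h3 : (U ⊕g U').Adj p.1 q.1 := hpq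
        rw [← hg p, ← hg q] at h3
        simpa using h3
  refine (hQ.has_of_fintype hsum (by simp)).mono ?_
  refine (add_le_add he hf).trans (le_of_eq ?_)
  rw [← degSum_map (F' := U ⊕g U') Function.Embedding.inl (by simp) (F := U),
    ← degSum_map (F' := U ⊕g U') Function.Embedding.inr (by simp) (F := U')]
  unfold degSum
  rw [Fintype.sum_sum_type]
  simp only [Finset.sum_map]
  congr 1
  · refine Finset.sum_congr rfl fun v _ => ?_
    unfold degIn
    congr 1
    ext w
    rcases w with w | w <;> simp
  · refine Finset.sum_congr rfl fun v _ => ?_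
    unfold degIn
    congr 1
    ext w
    rcases w with w | w <;> simp

lemma IsSparseClass.degIn_lt (hQ : IsSparseClass Q t) [Fintype V] {F : SimpleGraph V} (hF : Q V F)
    (v : V) : degIn F Finset.univ v < t := by
  classical
  refine hQ.star hF {v} (connected_induce_singleton F v) _ (fun w hw hwv => ?_) (fun w hw => ?_)
  · rw [Set.mem_singleton_iff] at hwv
    subst hwv
    simp at hw
  · exact ⟨v, rfl, by simpa using hw⟩

end SparseClass

/-! ### Geodesics -/

section Geodesic

variable {V : Type u}

/-- The vertices `p 0, …, p d` form a shortest path of `G`. -/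
structure IsGeodesic (G : SimpleGraph V) (p : ℕ → V) (d : ℕ) : Prop where
  adj : ∀ i < d, G.Adj (p i) (p (i + 1))
  le : ∀ i j, i ≤ j → j ≤ d → ∀ q : G.Walk (p i) (p j), j ≤ i + q.length

lemma exists_isGeodesic {G : SimpleGraph V} {u v : V} (h : G.Reachable u v) :
    ∃ p : ℕ → V, p 0 = u ∧ p (G.dist u v) = v ∧ IsGeodesic G p (G.dist u v) := by
  obtain ⟨w, hw⟩ := h.exists_walk_length_eq_dist
  refine ⟨w.getVert, w.getVert_zero, by rw [← hw, w.getVert_length], ?_, ?_⟩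
  · intro i hi
    exact w.adj_getVert_succ (hw ▸ hi)
  · intro i j hij hj q
    have h1 := SimpleGraph.dist_le (((w.take i).append q).append (w.drop j))
    rw [SimpleGraph.Walk.length_append, SimpleGraph.Walk.length_append,
      SimpleGraph.Walk.take_length, SimpleGraph.Walk.drop_length] at h1
    omega

namespace IsGeodesic

variable {G : SimpleGraph V} {p : ℕ → V} {d : ℕ}

lemma inj (h : IsGeodesic G p d) {i j : ℕ} (hi : i ≤ d) (hj : j ≤ d) (hij : p i = p j) :
    i = j := by
  rcases le_total i j with h1 | h1
  · have := h.le i j h1 hj (SimpleGraph.Walk.nil.copy rfl hij)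
    simp at this
    omega
  · have := h.le j i h1 hi (SimpleGraph.Walk.nil.copy rfl hij.symm)
    simp at this
    omega

lemma le_of_adj (h : IsGeodesic G p d) {i j : ℕ} (hj : j ≤ d) (hij : i ≤ j)
    (hadj : G.Adj (p i) (p j)) : j ≤ i + 1 := by
  simpa using h.le i j hij hj hadj.toWalk

lemma le_of_common (h : IsGeodesic G p d) {i j : ℕ} (hj : j ≤ d) (hij : i ≤ j) {y : V}
    (h1 : G.Adj (p i) y) (h2 : G.Adj (p j) y) : j ≤ i + 2 := by
  simpa using h.le i j hij hj (SimpleGraph.Walk.cons h1 h2.symm.toWalk)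

end IsGeodesic

lemma connected_induce_of_chain {G : SimpleGraph V} {p : ℕ → V} {d : ℕ}
    (h : ∀ i < d, G.Adj (p i) (p (i + 1))) : (G.induce (p '' Set.Iic d)).Connected := by
  rw [SimpleGraph.connected_iff_exists_forall_reachable]
  have h0 : p 0 ∈ p '' Set.Iic d := ⟨0, Nat.zero_le d, rfl⟩
  refine ⟨⟨p 0, h0⟩, ?_⟩
  rintro ⟨_, i, hi, rfl⟩
  have key : ∀ i (hi : i ≤ d), (G.induce (p '' Set.Iic d)).Reachable ⟨p 0, h0⟩
      ⟨p i, i, hi, rfl⟩ := by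
    intro i
    induction i with
    | zero => intro _; exact SimpleGraph.Reachable.refl _
    | succ i ih =>
      intro hi
      refine (ih (by omega)).trans (SimpleGraph.Adj.reachable ?_)
      exact h i (by omega)
  exact key i hi

/-- Degrees are at most t - 1, and 1 + (t - 1)tᵏ ≤ tᵏ⁺¹. -/
lemma exists_card_ball_le {G : SimpleGraph V} [Fintype V] {t : ℕ}
    (ht : ∀ v, degIn G Finset.univ v < t) (k : ℕ) (u : V) :
    ∃ S : Finset V, S.card ≤ t ^ k ∧ ∀ (v : V) (q : G.Walk u v), q.length ≤ k → v ∈ S := by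
  classical
  have ht1 : 1 ≤ t := Nat.one_le_iff_ne_zero.2 fun h => by simpa [h] using ht u
  induction k generalizing u with
  | zero =>
    refine ⟨{u}, by simp, ?_⟩
    intro v q hq
    cases q with
    | nil => simp
    | cons _ _ => simp at hq
  | succ k ih =>
    choose S hS hS' using ih
    refine ⟨insert u ((Finset.univ.filter (G.Adj u)).biUnion S), ?_, ?_⟩
    · refine (Finset.card_insert_le _ _).trans ?_
      have h1 : ((Finset.univ.filter (G.Adj u)).biUnion S).card ≤ (t - 1) * t ^ k := by
        refine Finset.card_biUnion_le.trans ?_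
        refine (Finset.sum_le_card_nsmul _ _ _ fun v _ => hS v).trans ?_
        rw [smul_eq_mul]
        refine Nat.mul_le_mul_right _ ?_
        have := ht u
        unfold degIn at this
        convert Nat.le_sub_one_of_lt this
      have h2 : 1 ≤ t ^ k := Nat.one_le_pow _ _ ht1
      have h3 : t ^ (k + 1) = (t - 1) * t ^ k + t ^ k := by
        obtain ⟨s, rfl⟩ : ∃ s, t = s + 1 := ⟨t - 1, by omega⟩
        rw [Nat.add_sub_cancel]
        ring
      omega
    · intro v q hq
      cases q with
      | nil => simp
      | cons hadj q =>
        rw [SimpleGraph.Walk.length_cons] at hq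
        exact Finset.mem_insert_of_mem (Finset.mem_biUnion.2
          ⟨_, by simpa using hadj, hS' _ _ q (by omega)⟩)

lemma exists_long_geodesic {G : SimpleGraph V} [Fintype V] {t : ℕ}
    (ht : ∀ v, degIn G Finset.univ v < t) {k : ℕ} {u : V} {S : Finset V}
    (hS : ∀ v ∈ S, G.Reachable u v) (hcard : t ^ k < S.card) :
    ∃ (p : ℕ → V) (d : ℕ), k < d ∧ IsGeodesic G p d := by
  obtain ⟨A, hA, hA'⟩ := exists_card_ball_le ht k u
  have : ∃ v ∈ S, v ∉ A := by
    by_contra! hcon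
    exact absurd (Finset.card_le_card hcon) (by omega)
  obtain ⟨v, hv, hvA⟩ := this
  obtain ⟨p, -, -, hp⟩ := exists_isGeodesic (hS v hv)
  refine ⟨p, _, ?_, hp⟩
  by_contra! hcon
  obtain ⟨w, hw⟩ := (hS v hv).exists_walk_length_eq_dist
  exact hvA (hA' v w (by omega))

end Geodesic

/-! ### Long geodesics in a sparse class -/

section SparseGeodesic

variable {Q : ∀ V : Type, SimpleGraph V → Prop} {t : ℕ} {V : Type}

lemma IsSparseClass.pathGraph_of_geodesic (hQ : IsSparseClass Q t) {F : SimpleGraph V}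
    (hF : Q V F) {p : ℕ → V} {d : ℕ} (hp : IsGeodesic F p d) {n : ℕ} (hn : n ≤ d + 1) :
    Q _ (SimpleGraph.pathGraph n) := by
  refine hQ.comap (fun i : Fin n => p i) (fun i j hij => ?_) (fun i j hij => ?_) hF
  · exact Fin.ext (hp.inj (by omega) (by omega) hij)
  · rw [SimpleGraph.pathGraph_adj] at hij
    rcases hij with h | h
    · show F.Adj (p i) (p j)
      rw [← h]
      exact hp.adj _ (by omega)
    · show F.Adj (p i) (p j)
      rw [← h]
      exact (hp.adj _ (by omega)).symm

/-- A long shortest path contains a long run of vertices of degree two. -/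
lemma IsSparseClass.exists_run (hQ : IsSparseClass Q t) [Fintype V] {F : SimpleGraph V}
    (hF : Q V F) {p : ℕ → V} {d K : ℕ} (hp : IsGeodesic F p d) (hd : t * (K + 3) + 1 ≤ d) :
    ∃ a, 1 ≤ a ∧ a + K < d ∧ ∀ i < K, degIn F Finset.univ (p (a + i)) = 2 := by
  classical
  -- Otherwise each of `t` windows of length `K` contains a path vertex of degree other than 2,
  -- hence one with a neighbour off the path. Contracting the path then gives a star with `t`
  -- leaves.
  by_contra! hcon
  have hwin : ∀ w : Fin t, (w : ℕ) * (K + 3) + (K + 3) ≤ t * (K + 3) := by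
    intro w
    have := Nat.mul_le_mul_right (K + 3) (Nat.succ_le_of_lt w.2)
    rwa [Nat.succ_mul] at this
  have h1 : ∀ w : Fin t, ∃ i, i < K ∧
      degIn F Finset.univ (p ((1 + w * (K + 3)) + i)) ≠ 2 := by
    intro w
    have := hwin w
    exact hcon _ (by omega) (by omega)
  choose i hi hi' using h1
  let c : Fin t → ℕ := fun w => (1 + w * (K + 3)) + i w
  have hc1 : ∀ w, 1 ≤ c w := fun w => by simp only [c]; omega
  have hcd : ∀ w, c w + 1 ≤ d := fun w => by
    have := hwin w
    have := hi w
    simp only [c]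
    omega
  have h2 : ∀ w : Fin t, ∃ y, F.Adj (p (c w)) y ∧ ∀ j ≤ d, y ≠ p j := by
    intro w
    have hcw := hc1 w
    have hcw' := hcd w
    have hadj1 : F.Adj (p (c w)) (p (c w - 1)) := by
      have := (hp.adj (c w - 1) (by omega)).symm
      rwa [Nat.sub_add_cancel hcw] at this
    have hadj2 : F.Adj (p (c w)) (p (c w + 1)) := hp.adj _ (by omega)
    have hsub : ({p (c w - 1), p (c w + 1)} : Finset V) ⊆
        Finset.univ.filter (F.Adj (p (c w))) := by
      intro y hy
      rw [Finset.mem_insert, Finset.mem_singleton] at hy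
      rcases hy with rfl | rfl <;> simpa
    have hcard : ({p (c w - 1), p (c w + 1)} : Finset V).card = 2 :=
      Finset.card_pair fun h => by
        have := hp.inj (by omega) (by omega) h
        omega
    have hne : ({p (c w - 1), p (c w + 1)} : Finset V) ≠ Finset.univ.filter (F.Adj (p (c w))) := by
      intro h
      apply hi' w
      show degIn F Finset.univ (p (c w)) = 2
      unfold degIn
      rw [← hcard, h]
    obtain ⟨y, hy, hy'⟩ := Finset.exists_of_ssubset (hsub.ssubset_of_ne hne)
    have hadj : F.Adj (p (c w)) y := by simpa using hy
    refine ⟨y, hadj, ?_⟩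
    rintro j hj rfl
    simp only [Finset.mem_insert, Finset.mem_singleton, not_or] at hy'
    rcases lt_trichotomy j (c w) with h | h | h
    · have := hp.le_of_adj (by omega) h.le hadj.symm
      exact hy'.1 (congrArg p (by omega))
    · exact hadj.ne (by rw [h])
    · have := hp.le_of_adj hj h.le hadj
      exact hy'.2 (congrArg p (by omega))
  choose y hy hy' using h2
  -- The spacing `K + 3` puts the chosen vertices at least 4 apart on the geodesic, too far for a
  -- common neighbour.
  have hlt : ∀ w w' : Fin t, w < w' → y w ≠ y w' := by
    intro w w' hww h
    have h3 : c w + 4 ≤ c w' := by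
      have h4 := Nat.mul_le_mul_right (K + 3) (Nat.succ_le_of_lt hww)
      rw [Nat.succ_mul] at h4
      have := hi w
      simp only [c]
      omega
    have := hp.le_of_common (i := c w) (j := c w') (by have := hcd w'; omega) (by omega) (hy w)
      (h ▸ hy w')
    omega
  have hinj : Function.Injective y := by
    intro w w' h
    rcases lt_trichotomy w w' with h1 | h1 | h1
    · exact absurd h (hlt _ _ h1)
    · exact h1
    · exact absurd h.symm (hlt _ _ h1)
  have := hQ.star hF (p '' Set.Iic d) (connected_induce_of_chain hp.adj) (Finset.univ.image y)
    (by
      intro v hv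
      obtain ⟨w, -, rfl⟩ := Finset.mem_image.1 hv
      rintro ⟨j, hj, h⟩
      exact hy' w j hj h.symm)
    (by
      intro v hv
      obtain ⟨w, -, rfl⟩ := Finset.mem_image.1 hv
      exact ⟨_, ⟨c w, by have := hcd w; simp only [Set.mem_Iic]; omega, rfl⟩, hy w⟩)
  rw [Finset.card_image_of_injective _ hinj, Finset.card_univ, Fintype.card_fin] at this
  omega

/-- Take 3n consecutive path vertices of degree 2. Their degree sum is 6n and only the two ends send
edges out, at most 4 in all, while three disjoint copies of the given graph have degree sum at least
6n + 6. -/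
lemma IsSparseClass.improvable_of_geodesic (hQ : IsSparseClass Q t) [Fintype V]
    {F : SimpleGraph V} (hF : Q V F) {n : ℕ} (hn : Has Q n (2 * n + 2)) {p : ℕ → V} {d : ℕ}
    (hp : IsGeodesic F p d) (hd : t * (3 * n + 3) + 1 ≤ d) : Improvable Q 4 F := by
  classical
  obtain ⟨a, ha, had, ha'⟩ := hQ.exists_run hF hp hd
  set K := 3 * n with hK
  set X : Finset V := (Finset.range K).image (fun i => p (a + i)) with hX
  have hXmem : ∀ i, a ≤ i → i < a + K → p i ∈ X := fun i h1 h2 =>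
    Finset.mem_image.2 ⟨i - a, by simp; omega, by rw [Nat.add_sub_cancel' h1]⟩
  have hXcard : X.card = K := by
    rw [hX, Finset.card_image_of_injOn, Finset.card_range]
    intro i hi j hj hij
    simp only [Finset.coe_range, Set.mem_Iio] at hi hj
    have := hp.inj (by omega) (by omega) hij
    omega
  have hdeg : ∀ v ∈ X, degIn F Finset.univ v = 2 := by
    intro v hv
    obtain ⟨i, hi, rfl⟩ := Finset.mem_image.1 hv
    exact ha' i (Finset.mem_range.1 hi)
  have hcross : ∑ v ∈ X, degIn F Xᶜ v ≤ 4 := by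
    have h1 : ∀ v ∈ X, v ∉ ({p a, p (a + (K - 1))} : Finset V) → degIn F Xᶜ v = 0 := by
      intro v hv hv'
      obtain ⟨i, hi, rfl⟩ := Finset.mem_image.1 hv
      rw [Finset.mem_range] at hi
      simp only [Finset.mem_insert, Finset.mem_singleton, not_or] at hv'
      have hi0 : i ≠ 0 := fun h => hv'.1 (by rw [h, add_zero])
      have hiK : i ≠ K - 1 := fun h => hv'.2 (by rw [h])
      have h2 := degIn_add_degIn_compl F X (p (a + i))
      rw [ha' i hi] at h2
      have h3 : ({p (a + i - 1), p (a + i + 1)} : Finset V) ⊆ X.filter (F.Adj (p (a + i))) := by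
        intro y hy
        rw [Finset.mem_insert, Finset.mem_singleton] at hy
        rcases hy with rfl | rfl
        · refine Finset.mem_filter.2 ⟨hXmem _ (by omega) (by omega), ?_⟩
          have := (hp.adj (a + i - 1) (by omega)).symm
          rwa [Nat.sub_add_cancel (by omega)] at this
        · exact Finset.mem_filter.2 ⟨hXmem _ (by omega) (by omega), hp.adj _ (by omega)⟩
      have h4 : ({p (a + i - 1), p (a + i + 1)} : Finset V).card = 2 :=
        Finset.card_pair fun h => by
          have := hp.inj (by omega) (by omega) h
          omega
      have h5 : 2 ≤ degIn F X (p (a + i)) := by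
        rw [← h4]
        unfold degIn
        convert Finset.card_le_card h3
      omega
    calc ∑ v ∈ X, degIn F Xᶜ v ≤ ∑ v ∈ X.filter (· ∈ ({p a, p (a + (K - 1))} : Finset V)),
          degIn F Xᶜ v := by
          rw [Finset.sum_filter]
          refine Finset.sum_le_sum fun v hv => ?_
          split_ifs with h
          · exact le_rfl
          · exact (h1 v hv h).le
      _ ≤ (X.filter (· ∈ ({p a, p (a + (K - 1))} : Finset V))).card • 2 := by
          refine Finset.sum_le_card_nsmul _ _ _ fun v hv => ?_
          rw [← hdeg v (Finset.mem_filter.1 hv).1]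
          exact degIn_mono (Finset.subset_univ _) v
      _ ≤ 2 • 2 := by
          refine Nat.mul_le_mul_right 2 ?_
          refine (Finset.card_le_card fun v hv => (Finset.mem_filter.1 hv).2).trans
            Finset.card_le_two
  have hhas : Has Q X.card (2 * K + 6) := by
    have := hQ.has_add hn (hQ.has_add hn hn)
    rw [hXcard]
    convert this using 1 <;> omega
  refine hQ.improvable hF hhas ?_ ?_ hcross
  · rw [Finset.sum_congr rfl hdeg, Finset.sum_const, hXcard, smul_eq_mul]
    omega
  · rw [Finset.sum_eq_zero fun v hv => by rw [hdeg v hv]; norm_num]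
    norm_num

end SparseGeodesic

/-! ### Exchanging blocks -/

/-- Meant for the component sizes and degree sums of two graphs on equally many vertices: an
advantage of the second is already visible on boundedly many components. -/
lemma exists_exchange {α : Type u} {β : Type v} [DecidableEq α] [DecidableEq β] (M : ℕ)
    (s e : α → ℕ) (s' e' : β → ℕ) (hs : ∀ a, 1 ≤ s a ∧ s a ≤ M) (hs' : ∀ b, 1 ≤ s' b ∧ s' b ≤ M)
    (n : ℕ) : ∀ (I : Finset α) (J : Finset β), I.card = n → ∑ a ∈ I, s a = ∑ b ∈ J, s' b →
    ∑ a ∈ I, e a < ∑ b ∈ J, e' b → ∃ I' ⊆ I, ∃ J' ⊆ J, I'.card ≤ M ^ 3 ∧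
      ∑ a ∈ I', s a = ∑ b ∈ J', s' b ∧ ∑ a ∈ I', e a < ∑ b ∈ J', e' b := by
  induction n using Nat.strong_induction_on with
  | _ n ih =>
  intro I J hI hsum hlt
  by_cases hn : I.card ≤ M ^ 3
  · exact ⟨I, subset_rfl, J, subset_rfl, hn, hsum, hlt⟩
  push Not at hn
  have hI1 : I.card ≤ ∑ a ∈ I, s a := by
    simpa using Finset.card_nsmul_le_sum I s 1 fun a _ => (hs a).1
  have hJ1 : ∑ b ∈ J, s' b ≤ J.card * M := by
    simpa using Finset.sum_le_card_nsmul J s' M fun b _ => (hs' b).2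
  have hJ : M * M < J.card := by
    by_contra! h
    have := Nat.mul_le_mul_right M h
    have h3 : M ^ 3 = M * M * M := by ring
    omega
  have hM : 1 ≤ M := by
    rcases Nat.eq_zero_or_pos M with h | h
    · obtain ⟨a, -⟩ : I.Nonempty := Finset.card_pos.1 (by omega)
      have := hs a
      omega
    · exact h
  have hI2 : M * M < I.card := by
    refine lt_of_le_of_lt ?_ hn
    calc M * M = M * M * 1 := by ring
      _ ≤ M * M * M := Nat.mul_le_mul_left _ hM
      _ = M ^ 3 := by ring
  have hIcc : (Finset.Icc 1 M).card = M := by simp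
  -- By pigeonhole, many blocks of `I` have size c and many of `J` have size d. Then d of the former
  -- match c of the latter in total size: either this exchange wins, or both groups are removed and
  -- the advantage persists.
  obtain ⟨c, hc, hcI⟩ := Finset.exists_lt_card_fiber_of_mul_lt_card_of_maps_to (s := I)
    (t := Finset.Icc 1 M) (f := s) (n := M) (fun a _ => Finset.mem_Icc.2 (hs a)) (by rwa [hIcc])
  obtain ⟨d, hd, hdJ⟩ := Finset.exists_lt_card_fiber_of_mul_lt_card_of_maps_to (s := J)
    (t := Finset.Icc 1 M) (f := s') (n := M) (fun a _ => Finset.mem_Icc.2 (hs' a)) (by rwa [hIcc])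
  rw [Finset.mem_Icc] at hc hd
  obtain ⟨I₀, hI₀, hI₀c⟩ := Finset.exists_subset_card_eq (hd.2.trans hcI.le)
  obtain ⟨J₀, hJ₀, hJ₀c⟩ := Finset.exists_subset_card_eq (hc.2.trans hdJ.le)
  have hI₀I : I₀ ⊆ I := hI₀.trans (Finset.filter_subset _ _)
  have hJ₀J : J₀ ⊆ J := hJ₀.trans (Finset.filter_subset _ _)
  have hsI : ∑ a ∈ I₀, s a = d * c := by
    rw [Finset.sum_congr rfl fun a ha => (Finset.mem_filter.1 (hI₀ ha)).2, Finset.sum_const,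
      hI₀c, smul_eq_mul]
  have hsJ : ∑ a ∈ J₀, s' a = d * c := by
    rw [Finset.sum_congr rfl fun a ha => (Finset.mem_filter.1 (hJ₀ ha)).2, Finset.sum_const,
      hJ₀c, smul_eq_mul, mul_comm]
  by_cases he : ∑ a ∈ I₀, e a < ∑ b ∈ J₀, e' b
  · refine ⟨I₀, hI₀I, J₀, hJ₀J, ?_, hsI.trans hsJ.symm, he⟩
    rw [hI₀c]
    exact hd.2.trans (Nat.le_self_pow (by norm_num) M)
  · have h1 := Finset.sum_sdiff (f := s) hI₀I
    have h2 := Finset.sum_sdiff (f := s') hJ₀J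
    have h3 := Finset.sum_sdiff (f := e) hI₀I
    have h4 := Finset.sum_sdiff (f := e') hJ₀J
    have h5 := Finset.card_sdiff_of_subset hI₀I
    obtain ⟨I', hI', J', hJ', h⟩ := ih (I \ I₀).card (by omega) (I \ I₀) (J \ J₀) rfl
      (by omega) (by omega)
    exact ⟨I', hI'.trans Finset.sdiff_subset, J', hJ'.trans Finset.sdiff_subset, h⟩

/-! ### Unions of connected components -/

section Components

variable {V : Type u} [Fintype V]

open Classical in
/-- The set of vertices in a given set of connected components. -/
noncomputable def compUnion (F : SimpleGraph V) (I : Finset F.ConnectedComponent) : Finset V :=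
  Finset.univ.filter fun v => F.connectedComponentMk v ∈ I

variable {F : SimpleGraph V}

lemma mem_compUnion {I : Finset F.ConnectedComponent} {v : V} :
    v ∈ compUnion F I ↔ F.connectedComponentMk v ∈ I := by
  simp [compUnion]

lemma degIn_compl_compUnion [DecidableEq V] {I : Finset F.ConnectedComponent} {v : V}
    (hv : v ∈ compUnion F I) : degIn F (compUnion F I)ᶜ v = 0 := by
  classical
  unfold degIn
  rw [Finset.card_eq_zero, Finset.filter_eq_empty_iff]
  intro w hw hadj
  rw [Finset.mem_compl, mem_compUnion] at hw
  rw [mem_compUnion, SimpleGraph.ConnectedComponent.sound hadj.reachable] at hv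
  exact hw hv

lemma degSum_compUnion (I : Finset F.ConnectedComponent) :
    degSum F (compUnion F I) = ∑ v ∈ compUnion F I, degIn F Finset.univ v := by
  classical
  unfold degSum
  refine Finset.sum_congr rfl fun v hv => ?_
  rw [← degIn_add_degIn_compl F (compUnion F I) v, degIn_compl_compUnion hv, add_zero]

lemma sum_compUnion {A : Type*} [AddCommMonoid A] (I : Finset F.ConnectedComponent) (f : V → A) :
    ∑ v ∈ compUnion F I, f v = ∑ c ∈ I, ∑ v ∈ compUnion F {c}, f v := by
  classical
  rw [← Finset.sum_fiberwise_of_maps_to (s := compUnion F I) (t := I)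
    (g := F.connectedComponentMk) fun v hv => mem_compUnion.1 hv]
  refine Finset.sum_congr rfl fun c hc => Finset.sum_congr ?_ fun _ _ => rfl
  ext v
  simp only [Finset.mem_filter, mem_compUnion, Finset.mem_singleton]
  exact ⟨fun h => h.2, fun h => ⟨h ▸ hc, h⟩⟩

lemma card_compUnion (I : Finset F.ConnectedComponent) :
    (compUnion F I).card = ∑ c ∈ I, (compUnion F {c}).card := by
  simp_rw [Finset.card_eq_sum_ones]
  exact sum_compUnion I _

lemma degSum_compUnion_eq_sum (I : Finset F.ConnectedComponent) :
    degSum F (compUnion F I) = ∑ c ∈ I, degSum F (compUnion F {c}) := by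
  rw [degSum_compUnion, sum_compUnion]
  exact Finset.sum_congr rfl fun c _ => (degSum_compUnion {c}).symm

lemma compUnion_nonempty (c : F.ConnectedComponent) : (compUnion F {c}).Nonempty := by
  obtain ⟨v, hv⟩ := c.exists_rep
  exact ⟨v, mem_compUnion.2 (Finset.mem_singleton.2 hv)⟩

lemma reachable_of_mem_compUnion {c : F.ConnectedComponent} {u v : V}
    (hu : u ∈ compUnion F {c}) (hv : v ∈ compUnion F {c}) : F.Reachable u v := by
  rw [mem_compUnion, Finset.mem_singleton] at hu hv
  exact SimpleGraph.ConnectedComponent.exact (hu.trans hv.symm)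

lemma connected_compUnion (c : F.ConnectedComponent) :
    (F.induce (compUnion F {c} : Set V)).Connected := by
  have : (compUnion F {c} : Set V) = c.supp := by
    ext v
    simp [mem_compUnion]
  rw [this]
  exact c.connected_toSimpleGraph

lemma compUnion_univ [Fintype F.ConnectedComponent] :
    compUnion F Finset.univ = Finset.univ := by
  ext v
  simp [mem_compUnion]

end Components

/-! ### Improvement by exchanging components -/

section SparseComponents

variable {Q : ∀ V : Type, SimpleGraph V → Prop} {t : ℕ} {V : Type}

lemma IsSparseClass.improvable_of_compUnion (hQ : IsSparseClass Q t) [Fintype V]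
    {F : SimpleGraph V} (hF : Q V F) {I : Finset F.ConnectedComponent} {B e : ℕ}
    (h : Has Q (compUnion F I).card e) (he : degSum F (compUnion F I) < e)
    (hB : ∑ v ∈ compUnion F I, |(degIn F Finset.univ v : ℝ) - 2| ≤ B) : Improvable Q B F := by
  classical
  have h0 : ∑ v ∈ compUnion F I, degIn F (compUnion F I)ᶜ v = 0 :=
    Finset.sum_eq_zero fun v hv => degIn_compl_compUnion hv
  refine hQ.improvable hF h ?_ hB ?_
  · rw [h0, ← degSum_compUnion]
    exact he
  · rw [h0]
    exact Nat.zero_le _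

lemma IsSparseClass.improvable_of_card_le (hQ : IsSparseClass Q t) [Fintype V]
    {F F' : SimpleGraph V} (hF : Q V F) (hF' : Q V F') {M : ℕ}
    (hM : ∀ c, (compUnion F {c}).card ≤ M) (hM' : ∀ c, (compUnion F' {c}).card ≤ M)
    (h : degSum F Finset.univ < degSum F' Finset.univ) : Improvable Q (M ^ 4 * (t + 2)) F := by
  classical
  have := Fintype.ofFinite F.ConnectedComponent
  have := Fintype.ofFinite F'.ConnectedComponent
  obtain ⟨I, -, J, -, hI, hs, he⟩ := exists_exchange M
    (fun c : F.ConnectedComponent => (compUnion F {c}).card)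
    (fun c => degSum F (compUnion F {c})) (fun c : F'.ConnectedComponent => (compUnion F' {c}).card)
    (fun c => degSum F' (compUnion F' {c}))
    (fun c => ⟨Finset.card_pos.2 (compUnion_nonempty c), hM c⟩)
    (fun c => ⟨Finset.card_pos.2 (compUnion_nonempty c), hM' c⟩) _ Finset.univ Finset.univ rfl
    (by rw [← card_compUnion, ← card_compUnion, compUnion_univ, compUnion_univ])
    (by rwa [← degSum_compUnion_eq_sum, ← degSum_compUnion_eq_sum, compUnion_univ, compUnion_univ])
  have hcard : (compUnion F I).card ≤ M ^ 4 := by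
    rw [card_compUnion]
    calc _ ≤ I.card • M := Finset.sum_le_card_nsmul _ _ _ fun c _ => hM c
      _ ≤ M ^ 3 * M := Nat.mul_le_mul_right _ hI
      _ = M ^ 4 := by ring
  refine hQ.improvable_of_compUnion hF (I := I) (e := degSum F' (compUnion F' J)) ?_ ?_ ?_
  · have := hQ.has_of_finset hF' (compUnion F' J)
    rwa [card_compUnion, ← hs, ← card_compUnion] at this
  · rwa [degSum_compUnion_eq_sum, degSum_compUnion_eq_sum]
  · calc ∑ v ∈ compUnion F I, |(degIn F Finset.univ v : ℝ) - 2|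
        ≤ (compUnion F I).card • ((t : ℝ) + 2) := by
          refine Finset.sum_le_card_nsmul _ _ _ fun v _ => ?_
          have h1 : (degIn F Finset.univ v : ℝ) ≤ t := by exact_mod_cast (hQ.degIn_lt hF v).le
          have h2 : (0 : ℝ) ≤ degIn F Finset.univ v := Nat.cast_nonneg _
          rw [abs_le]
          constructor <;> linarith
      _ ≤ (M ^ 4 : ℕ) * ((t : ℝ) + 2) := by
          rw [nsmul_eq_mul]
          exact mul_le_mul_of_nonneg_right (by exact_mod_cast hcard) (by positivity)
      _ = ((M ^ 4 * (t + 2) : ℕ) : ℝ) := by push_cast; ring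

/-- If all members of the class with a large component are improvable, then so are all members
that do not have the maximum number of edges. -/
lemma IsSparseClass.exists_improvable_of_large (hQ : IsSparseClass Q t) {M B : ℕ}
    (hM : ∀ (V : Type) [Fintype V] (F : SimpleGraph V) (c : F.ConnectedComponent), Q V F →
      M < (compUnion F {c}).card → Improvable Q B F) :
    ∃ B, ∀ (V : Type) [Fintype V] (F F' : SimpleGraph V), Q V F → Q V F' →
      degSum F Finset.univ < degSum F' Finset.univ → Improvable Q B F := by
  classical
  refine ⟨B + M ^ 4 * (t + 2), fun V _ F F' hF hF' h => ?_⟩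
  by_cases h1 : ∃ c, M < (compUnion F {c}).card
  · obtain ⟨c, hc⟩ := h1
    exact (hM V F c hF hc).mono (by omega)
  push Not at h1
  -- `F'` itself may have large components, so an optimal graph replaces it: a large component would
  -- make that graph improvable, contrary to optimality.
  obtain ⟨F'', hF'', hmax⟩ := Finset.exists_max_image (Finset.univ.filter (Q V))
    (fun F => degSum F Finset.univ) ⟨F', by simpa using hF'⟩
  rw [Finset.mem_filter] at hF''
  refine (hQ.improvable_of_card_le hF hF''.2 h1 (fun c => ?_) (lt_of_lt_of_le h
    (hmax F' (by simpa using hF')))).mono (by omega)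
  by_contra! hc
  obtain ⟨X, F₂, h2, -, -, -, -, h3⟩ := hM V F'' c hF''.2 hc
  exact absurd (hmax F₂ (by simpa using h2)) (by omega)

lemma IsSparseClass.exists_geodesic_of_compUnion (hQ : IsSparseClass Q t) [Fintype V]
    {F : SimpleGraph V} (hF : Q V F) {c : F.ConnectedComponent} {k : ℕ}
    (h : t ^ k < (compUnion F {c}).card) : ∃ (p : ℕ → V) (d : ℕ), k < d ∧ IsGeodesic F p d := by
  obtain ⟨u, hu⟩ := compUnion_nonempty c
  exact exists_long_geodesic (hQ.degIn_lt hF) (fun v hv => reachable_of_mem_compUnion hu hv) h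

/-- By bounded degrees a large component has a long geodesic, which contains the excluded path; so
all components are bounded. -/
lemma IsSparseClass.exists_improvable_of_not_pathGraph (hQ : IsSparseClass Q t) {n : ℕ}
    (hn : ¬ Q _ (SimpleGraph.pathGraph n)) :
    ∃ B, ∀ (V : Type) [Fintype V] (F F' : SimpleGraph V), Q V F → Q V F' →
      degSum F Finset.univ < degSum F' Finset.univ → Improvable Q B F := by
  refine hQ.exists_improvable_of_large (M := t ^ n) (B := 0) fun V _ F c hF hc => ?_
  obtain ⟨p, d, hd, hp⟩ := hQ.exists_geodesic_of_compUnion hF hc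
  exact absurd (hQ.pathGraph_of_geodesic hF hp (by omega)) hn

lemma IsSparseClass.exists_improvable_of_has (hQ : IsSparseClass Q t) {n : ℕ}
    (hn : Has Q n (2 * n + 2)) :
    ∃ B, ∀ (V : Type) [Fintype V] (F F' : SimpleGraph V), Q V F → Q V F' →
      degSum F Finset.univ < degSum F' Finset.univ → Improvable Q B F := by
  refine hQ.exists_improvable_of_large (M := t ^ (t * (3 * n + 3) + 1)) (B := 4)
    fun V _ F c hF hc => ?_
  obtain ⟨p, d, hd, hp⟩ := hQ.exists_geodesic_of_compUnion hF hc
  exact hQ.improvable_of_geodesic hF hn hp hd.le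

end SparseComponents

/-! ### Classes whose members have at most as many edges as vertices -/

section Unicyclic

variable {Q : ∀ V : Type, SimpleGraph V → Prop} {t : ℕ} {V : Type}

lemma IsGeodesic.two_le_degIn {V : Type u} [Fintype V] {G : SimpleGraph V} {p : ℕ → V} {d i : ℕ}
    (hp : IsGeodesic G p d) (hi : 1 ≤ i) (hid : i < d) : 2 ≤ degIn G Finset.univ (p i) := by
  classical
  obtain ⟨j, rfl⟩ : ∃ j, i = j + 1 := ⟨i - 1, by omega⟩
  have h4 : ({p j, p (j + 2)} : Finset V).card = 2 := Finset.card_pair fun h => by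
    have := hp.inj (by omega) (by omega) h
    omega
  rw [← h4]
  unfold degIn
  refine Finset.card_le_card fun y hy => ?_
  rw [Finset.mem_insert, Finset.mem_singleton] at hy
  rw [Finset.mem_filter]
  rcases hy with rfl | rfl
  · exact ⟨Finset.mem_univ _, (hp.adj j (by omega)).symm⟩
  · exact ⟨Finset.mem_univ _, hp.adj (j + 1) (by omega)⟩

/-- The vertices of degree at least 2 in a component form a connected set, as interior vertices of
geodesics have degree at least 2. Contracting it makes the remaining vertices the leaves of a star.
-/
lemma IsSparseClass.card_leaves_le (hQ : IsSparseClass Q t) [Fintype V] {F : SimpleGraph V}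
    (hF : Q V F) (c : F.ConnectedComponent) :
    ((compUnion F {c}).filter fun v => degIn F Finset.univ v ≤ 1).card ≤ t + 2 := by
  classical
  set C := compUnion F {c} with hC
  set T := C.filter fun v => degIn F Finset.univ v ≤ 1 with hT
  by_contra! hcard
  have hTC : T ⊆ C := Finset.filter_subset _ _
  have hnext : ∀ v ∈ T, ∃ p ∈ C \ T, F.Adj p v := by
    intro v hv
    -- The component has more than two vertices, so a geodesic from `v` to such a `z` has length at
    -- least 2, and its first interior vertex is a neighbour of `v` outside `T`.
    have h1 : ∃ z ∈ C, z ∉ insert v (Finset.univ.filter (F.Adj v)) := by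
      by_contra! hcon
      have h2 := Finset.card_le_card hcon
      have h3 := Finset.card_insert_le v (Finset.univ.filter (F.Adj v))
      have h4 := (Finset.mem_filter.1 hv).2
      have h5 := Finset.card_le_card hTC
      have h6 : degIn F Finset.univ v = (Finset.univ.filter (F.Adj v)).card := by
        unfold degIn
        congr!
      omega
    obtain ⟨z, hz, hzv⟩ := h1
    have hvC := hTC hv
    obtain ⟨p, hp0, hpd, hp⟩ := exists_isGeodesic (reachable_of_mem_compUnion hvC hz)
    simp only [Finset.mem_insert, Finset.mem_filter, Finset.mem_univ, true_and, not_or] at hzv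
    have hd0 : F.dist v z ≠ 0 := fun h => hzv.1 (by rw [← hpd, h, hp0])
    have hadj : F.Adj v (p 1) := by
      have := hp.adj 0 (by omega)
      rwa [hp0] at this
    have hd1 : F.dist v z ≠ 1 := fun h => hzv.2 (by rw [h] at hpd; rwa [hpd] at hadj)
    refine ⟨p 1, Finset.mem_sdiff.2 ⟨?_, fun h => ?_⟩, hadj.symm⟩
    · rw [hC, mem_compUnion] at hvC ⊢
      rwa [← SimpleGraph.ConnectedComponent.sound hadj.reachable]
    · have h1 := hp.two_le_degIn (i := 1) le_rfl (by omega)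
      have h2 := (Finset.mem_filter.1 h).2
      omega
  have hconn : (F.induce ((C \ T : Finset V) : Set V)).Connected := by
    obtain ⟨v, hv⟩ : T.Nonempty := Finset.card_pos.1 (by omega)
    obtain ⟨b, hb, -⟩ := hnext v hv
    have : Nonempty ((C \ T : Finset V) : Set V) := ⟨⟨b, hb⟩⟩
    refine ⟨fun x y => ?_⟩
    obtain ⟨x, hx⟩ := x
    obtain ⟨y, hy⟩ := y
    have hx' := Finset.mem_sdiff.1 hx
    have hy' := Finset.mem_sdiff.1 hy
    obtain ⟨p, hp0, hpd, hp⟩ := exists_isGeodesic (reachable_of_mem_compUnion hx'.1 hy'.1)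
    generalize F.dist x y = d at hpd hp
    subst hp0
    subst hpd
    have hmemC : ∀ i ≤ d, p i ∈ C := by
      intro i
      induction i with
      | zero => intro _; exact hx'.1
      | succ i ih =>
        intro hi
        have h1 := ih (by omega)
        rw [hC, mem_compUnion] at h1 ⊢
        rwa [← SimpleGraph.ConnectedComponent.sound (hp.adj i (by omega)).reachable]
    have hmem : ∀ i ≤ d, p i ∈ C \ T := by
      intro i hi
      by_cases h0 : i = 0
      · rw [h0]; exact hx
      by_cases h1 : i = d
      · rw [h1]; exact hy
      refine Finset.mem_sdiff.2 ⟨hmemC i hi, fun h => ?_⟩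
      have h2 := hp.two_le_degIn (i := i) (by omega) (by omega)
      have h3 := (Finset.mem_filter.1 h).2
      omega
    have key : ∀ i (hi : i ≤ d), (F.induce ((C \ T : Finset V) : Set V)).Reachable
        ⟨p 0, hx⟩ ⟨p i, hmem i hi⟩ := by
      intro i
      induction i with
      | zero => intro _; exact SimpleGraph.Reachable.refl _
      | succ i ih =>
        intro hi
        refine (ih (by omega)).trans (SimpleGraph.Adj.reachable ?_)
        exact hp.adj i (by omega)
    exact key d le_rfl
  have := hQ.star hF _ hconn T (fun v hv hv' => (Finset.mem_sdiff.1 hv').2 hv) hnext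
  omega

/-- Degree sums are even, so exceeding 2|X| means reaching 2|X| + 2. -/
lemma IsSparseClass.degSum_le (hQ : IsSparseClass Q t) (hE : ∀ n, ¬ Has Q n (2 * n + 2))
    {F : SimpleGraph V} (hF : Q V F) (X : Finset V) : degSum F X ≤ 2 * X.card := by
  by_contra! h
  refine hE X.card ((hQ.has_of_finset hF X).mono ?_)
  rw [← degSum_univ_induce, degSum_univ] at h ⊢
  omega

/-- The signed sum of deg - 2 over a component is at most 0, and the absolute value differs from the
signed one only at the at most t + 2 vertices of degree at most 1, by at most 4 each. The bound does
not depend on the size of the component. -/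
lemma IsSparseClass.sum_abs_le (hQ : IsSparseClass Q t) (hE : ∀ n, ¬ Has Q n (2 * n + 2))
    [Fintype V] {F : SimpleGraph V} (hF : Q V F) (c : F.ConnectedComponent) :
    ∑ v ∈ compUnion F {c}, |(degIn F Finset.univ v : ℝ) - 2| ≤ 4 * t + 8 := by
  classical
  have h1 := hQ.degSum_le hE hF (compUnion F {c})
  rw [degSum_compUnion] at h1
  have h1' : (∑ v ∈ compUnion F {c}, (degIn F Finset.univ v : ℝ)) ≤
      2 * (compUnion F {c}).card := by
    exact_mod_cast h1
  have h2 : (((compUnion F {c}).filter fun v => degIn F Finset.univ v ≤ 1).card : ℝ) ≤ t + 2 := by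
    exact_mod_cast hQ.card_leaves_le hF c
  calc ∑ v ∈ compUnion F {c}, |(degIn F Finset.univ v : ℝ) - 2|
      ≤ ∑ v ∈ compUnion F {c}, (((degIn F Finset.univ v : ℝ) - 2) +
        4 * if degIn F Finset.univ v ≤ 1 then 1 else 0) := by
        refine Finset.sum_le_sum fun v _ => ?_
        split_ifs with h
        · have h3 : (0 : ℝ) ≤ degIn F Finset.univ v := Nat.cast_nonneg _
          rw [abs_le]
          constructor <;> linarith
        · have h3 : (2 : ℝ) ≤ degIn F Finset.univ v := by
            exact_mod_cast (show 2 ≤ degIn F Finset.univ v by omega)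
          rw [abs_of_nonneg (by linarith)]
          linarith
    _ = (∑ v ∈ compUnion F {c}, (degIn F Finset.univ v : ℝ)) - 2 * (compUnion F {c}).card +
        4 * ((compUnion F {c}).filter fun v => degIn F Finset.univ v ≤ 1).card := by
        rw [Finset.sum_add_distrib, Finset.sum_sub_distrib, ← Finset.mul_sum, Finset.sum_boole,
          Finset.sum_const, nsmul_eq_mul]
        ring
    _ ≤ 4 * t + 8 := by linarith

lemma card_le_degSum_compUnion [Fintype V] (F : SimpleGraph V) (c : F.ConnectedComponent) :
    2 * (compUnion F {c}).card ≤ degSum F (compUnion F {c}) + 2 := by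
  classical
  have h := (connected_compUnion c).card_vert_le_card_edgeSet_add_one
  rw [Nat.card_coe_set_eq, Nat.card_coe_set_eq, Set.ncard_coe_finset] at h
  rw [← degSum_univ_induce, degSum_univ]
  omega

lemma has_of_pathGraph {n : ℕ}
    (hP : Q _ (SimpleGraph.pathGraph n)) : Has Q n (2 * n - 2) := by
  classical
  refine ⟨_, hP, ?_⟩
  rcases n with _ | n
  · exact Nat.zero_le _
  have h := (SimpleGraph.pathGraph_connected n).card_vert_le_card_edgeSet_add_one
  rw [Nat.card_coe_set_eq, Nat.card_eq_fintype_card, Fintype.card_fin] at h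
  rw [degSum_univ]
  omega

/-- Every component is a tree or unicyclic, so a graph without the maximum number of edges has a
tree component. Two trees are replaced by one path. A single tree is merged with boundedly many
unicyclic components into a graph with as many edges as vertices. -/
lemma IsSparseClass.exists_improvable_of_unicyclic (hQ : IsSparseClass Q t)
    (hP : ∀ n, Q _ (SimpleGraph.pathGraph n)) (hE : ∀ n, ¬ Has Q n (2 * n + 2)) :
    ∃ B, ∀ (V : Type) [Fintype V] (F F' : SimpleGraph V), Q V F → Q V F' →
      degSum F Finset.univ < degSum F' Finset.univ → Improvable Q B F := by
  classical
  let S : AddSubmonoid ℕ :=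
    { carrier := {n | Has Q n (2 * n)}
      zero_mem' := ⟨_, hP 0, Nat.zero_le _⟩
      add_mem' := fun {a b} ha hb => by
        show Has Q (a + b) (2 * (a + b))
        rw [mul_add]
        exact hQ.has_add ha hb }
  have hS : ∀ n, n ∈ S ↔ Has Q n (2 * n) := fun n => Iff.rfl
  -- Disjoint unions make `S` a numerical semigroup, so it contains every multiple of its gcd from
  -- `N` on.
  obtain ⟨N, hN⟩ := Nat.exists_mem_closure_of_ge (S : Set ℕ)
  rw [AddSubmonoid.closure_eq] at hN
  refine ⟨(N + 2) * (4 * t + 8), fun V _ F F' hF hF' hlt => ?_⟩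
  have := Fintype.ofFinite F.ConnectedComponent
  have habs : ∀ I : Finset F.ConnectedComponent, I.card ≤ N + 2 →
      ∑ v ∈ compUnion F I, |(degIn F Finset.univ v : ℝ) - 2| ≤
        ((N + 2) * (4 * t + 8) : ℕ) := by
    intro I hI
    rw [sum_compUnion]
    refine (Finset.sum_le_card_nsmul _ _ _ fun c _ => hQ.sum_abs_le hE hF c).trans ?_
    rw [nsmul_eq_mul]
    push_cast
    exact mul_le_mul_of_nonneg_right (by exact_mod_cast hI) (by positivity)
  have hle : ∀ c, degSum F (compUnion F {c}) ≤ 2 * (compUnion F {c}).card := fun c =>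
    hQ.degSum_le hE hF _
  have hge : ∀ c, 2 * (compUnion F {c}).card ≤ degSum F (compUnion F {c}) + 2 := fun c =>
    card_le_degSum_compUnion F c
  have heven : ∀ X : Finset V, ∃ k, degSum F X = 2 * k := fun X =>
    ⟨_, by rw [← degSum_univ_induce, degSum_univ]⟩
  have hF'le := hQ.degSum_le hE hF' Finset.univ
  have htot : degSum F Finset.univ = ∑ c, degSum F (compUnion F {c}) := by
    rw [← degSum_compUnion_eq_sum, compUnion_univ]
  have hcard : (Finset.univ : Finset V).card = ∑ c, (compUnion F {c}).card := by
    rw [← card_compUnion, compUnion_univ]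
  obtain ⟨c, hc⟩ : ∃ c, degSum F (compUnion F {c}) < 2 * (compUnion F {c}).card := by
    by_contra! h
    have h1 : ∑ c, 2 * (compUnion F {c}).card ≤ ∑ c, degSum F (compUnion F {c}) :=
      Finset.sum_le_sum fun c _ => h c
    rw [← Finset.mul_sum, ← hcard, ← htot] at h1
    omega
  have hc' : degSum F (compUnion F {c}) + 2 = 2 * (compUnion F {c}).card := by
    obtain ⟨k, hk⟩ := heven (compUnion F {c})
    have := hge c
    omega
  by_cases h2 : ∃ d, d ≠ c ∧ degSum F (compUnion F {d}) < 2 * (compUnion F {d}).card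
  · obtain ⟨d, hdc, hd⟩ := h2
    have hd' : degSum F (compUnion F {d}) + 2 = 2 * (compUnion F {d}).card := by
      obtain ⟨k, hk⟩ := heven (compUnion F {d})
      have := hge d
      omega
    refine hQ.improvable_of_compUnion hF (I := {c, d})
      (has_of_pathGraph (hP _)) ?_ (habs _ ((Finset.card_le_two (a := c) (b := d)).trans (by omega)))
    rw [degSum_compUnion_eq_sum, card_compUnion, Finset.sum_pair hdc.symm, Finset.sum_pair hdc.symm]
    omega
  push Not at h2
  set J : Finset F.ConnectedComponent := Finset.univ.erase c with hJ
  have hJS : ∀ d ∈ J, (compUnion F {d}).card ∈ S := by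
    intro d hd
    rw [hS]
    exact (hQ.has_of_finset hF _).mono (h2 d (Finset.ne_of_mem_erase hd))
  have hIdeg : ∀ I ⊆ J, degSum F (compUnion F (insert c I)) <
      2 * (compUnion F (insert c I)).card := by
    intro I hI
    have hcI : c ∉ I := fun h => Finset.ne_of_mem_erase (hI h) rfl
    rw [degSum_compUnion_eq_sum, card_compUnion, Finset.sum_insert hcI, Finset.sum_insert hcI,
      mul_add, Finset.mul_sum]
    have := Finset.sum_le_sum fun d (_ : d ∈ I) => hle d
    omega
  have htotJ : (Finset.univ : Finset V).card = (compUnion F {c}).card + ∑ d ∈ J, (compUnion F {d}).card := by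
    rw [hcard, hJ, Finset.add_sum_erase _ (fun d => (compUnion F {d}).card) (Finset.mem_univ c)]
  -- With `c` as the only tree, `F` has exactly one edge fewer than vertices, so the better graph
  -- `F'` has as many edges as vertices.
  have hm : (Finset.univ : Finset V).card ∈ S := by
    rw [hS]
    refine (hQ.has_of_finset hF' Finset.univ).mono ?_
    have h3 : ∑ d ∈ J, 2 * (compUnion F {d}).card ≤ ∑ d ∈ J, degSum F (compUnion F {d}) :=
      Finset.sum_le_sum fun d hd => h2 d (Finset.ne_of_mem_erase hd)
    rw [← Finset.mul_sum] at h3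
    rw [← Finset.add_sum_erase _ _ (Finset.mem_univ c), ← hJ] at htot
    have h4 := degSum_univ F'
    omega
  -- The gcd divides the total number of vertices and the size of every unicyclic component, hence
  -- also the size of the tree `c`.
  have hdvd : ∀ I ⊆ J, Nat.setGcd (S : Set ℕ) ∣ (compUnion F (insert c I)).card := by
    intro I hI
    have hcI : c ∉ I := fun h => Finset.ne_of_mem_erase (hI h) rfl
    have h1 : ∀ I ⊆ J, Nat.setGcd (S : Set ℕ) ∣ ∑ d ∈ I, (compUnion F {d}).card := fun I hI =>
      Finset.dvd_sum fun d hd => Nat.setGcd_dvd_of_mem (hJS d (hI hd))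
    have h3 : Nat.setGcd (S : Set ℕ) ∣ (compUnion F {c}).card :=
      (Nat.dvd_add_left (h1 J subset_rfl)).1 (htotJ ▸ Nat.setGcd_dvd_of_mem hm)
    rw [card_compUnion, Finset.sum_insert hcI]
    exact dvd_add h3 (h1 I hI)
  -- `N` components already have `N` vertices together, enough for membership in `S`; if there are
  -- fewer components, all of them are taken and the total order is used.
  obtain ⟨I, hI, hIN, hIS⟩ : ∃ I ⊆ J, I.card ≤ N ∧ (compUnion F (insert c I)).card ∈ S := by
    by_cases hJN : J.card ≤ N
    · refine ⟨J, subset_rfl, hJN, ?_⟩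
      rwa [hJ, Finset.insert_erase (Finset.mem_univ c), compUnion_univ]
    · obtain ⟨I, hI, hIN⟩ := Finset.exists_subset_card_eq (show N ≤ J.card by omega)
      refine ⟨I, hI, hIN.le, hN _ ?_ (hdvd I hI)⟩
      have hcI : c ∉ I := fun h => Finset.ne_of_mem_erase (hI h) rfl
      rw [card_compUnion, Finset.sum_insert hcI]
      have : I.card ≤ ∑ d ∈ I, (compUnion F {d}).card := by
        simpa using Finset.card_nsmul_le_sum I (fun d => (compUnion F {d}).card) 1
          fun d _ => Finset.card_pos.2 (compUnion_nonempty d)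
      omega
  exact hQ.improvable_of_compUnion hF (I := insert c I) ((hS _).1 hIS) (hIdeg I hI)
    (habs _ ((Finset.card_insert_le _ _).trans (by omega)))

/-- In a class of sparse graphs, every graph that does not have the maximum number of edges can be
improved by a bounded change. -/
theorem IsSparseClass.exists_improvable (hQ : IsSparseClass Q t) :
    ∃ B, ∀ (V : Type) [Fintype V] (F F' : SimpleGraph V), Q V F → Q V F' →
      degSum F Finset.univ < degSum F' Finset.univ → Improvable Q B F := by
  by_cases hP : ∀ n, Q _ (SimpleGraph.pathGraph n)
  · by_cases hE : ∀ n, ¬ Has Q n (2 * n + 2)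
    · exact hQ.exists_improvable_of_unicyclic hP hE
    · push Not at hE
      obtain ⟨n, hn⟩ := hE
      exact hQ.exists_improvable_of_has hn
  · push Not at hP
    obtain ⟨n, hn⟩ := hP
    exact hQ.exists_improvable_of_not_pathGraph hn

end Unicyclic

/-! ### The complement of the dominating clique -/

section MapGraph

variable {V : Type u} {V' : Type v}

lemma degIn_eq_zero {F : SimpleGraph V} {A : Finset V} {v : V} (h : ∀ w ∈ A, ¬ F.Adj v w) :
    degIn F A v = 0 := by
  classical
  unfold degIn
  rwa [Finset.card_eq_zero, Finset.filter_eq_empty_iff]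

lemma degIn_eq_of_subset {F : SimpleGraph V} {A A' : Finset V} {v : V} (hA : A ⊆ A')
    (h : ∀ w ∈ A', F.Adj v w → w ∈ A) : degIn F A' v = degIn F A v := by
  unfold degIn
  congr 1
  ext w
  simp only [Finset.mem_filter]
  exact ⟨fun h' => ⟨h w h'.1 h'.2, h'.2⟩, fun h' => ⟨hA h'.1, h'.2⟩⟩

lemma degIn_univ_map_of_notMem [Fintype V'] (F : SimpleGraph V) (f : V ↪ V') {w : V'} (hw : w ∉ Set.range f) :
    degIn (F.map f) Finset.univ w = 0 := by
  refine degIn_eq_zero fun x _ h => ?_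
  obtain ⟨a, b, -, ha, -⟩ := (SimpleGraph.map_adj f _ _ _).1 h
  exact hw ⟨a, ha⟩

variable [Fintype V] [Fintype V'] (F : SimpleGraph V) (f : V ↪ V')

lemma degIn_univ_map (v : V) :
    degIn (F.map f) Finset.univ (f v) = degIn F Finset.univ v := by
  rw [← degIn_map f (fun _ _ => SimpleGraph.map_adj_apply) Finset.univ v]
  refine degIn_eq_of_subset (Finset.subset_univ _) fun w _ h => ?_
  obtain ⟨a, b, -, -, rfl⟩ := (SimpleGraph.map_adj f _ _ _).1 h
  exact Finset.mem_map_of_mem f (Finset.mem_univ b)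

lemma degSum_univ_map : degSum (F.map f) Finset.univ = degSum F Finset.univ := by
  classical
  unfold degSum
  rw [← Finset.sum_subset (Finset.subset_univ (Finset.univ.map f)), Finset.sum_map]
  · exact Finset.sum_congr rfl fun v _ => degIn_univ_map F f v
  · intro w _ hw
    refine degIn_univ_map_of_notMem F f ?_
    rintro ⟨a, rfl⟩
    exact hw (Finset.mem_map_of_mem f (Finset.mem_univ a))

lemma boundary_map (X : Finset V) : boundary (F.map f) (X.map f) = boundary F X := by
  classical
  rw [boundary_eq, boundary_eq, Finset.sum_map]
  congr 1
  refine Finset.sum_congr rfl fun v _ => ?_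
  have h1 := degIn_add_degIn_compl F X v
  have h2 := degIn_add_degIn_compl (F.map f) (X.map f) (f v)
  rw [degIn_univ_map, degIn_map f (fun _ _ => SimpleGraph.map_adj_apply)] at h2
  omega

lemma quad_one : quad F (fun _ => 1) = (degSum F Finset.univ : ℝ) := by
  classical
  unfold quad nbrSum degSum
  push_cast
  exact Finset.sum_congr rfl fun v _ => by rw [one_mul, sum_adj_one]

end MapGraph

/-! ### Extremal graphs have an edge-maximal complement of the dominating clique -/

section Final

variable {ι : Type u} {W : ι → Type v} [∀ i, Fintype (W i)] {H : ∀ i, SimpleGraph (W i)}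

lemma isSparseClass_minorFree (hconn : ∀ p : GammaIndex H, (Gamma H p).Connected) {i : ι}
    (hi : gamma (H i) = gammaFam H) (hlt : (H i).indepNum < Fintype.card (W i)) {t : ℕ}
    (ht : (H i).indepNum ≤ t) :
    IsSparseClass (fun (V : Type) (F : SimpleGraph V) => MinorFree (Gamma H) F) t where
  comap g hg hadj h := h.comap g hg hadj
  union _ hX h1 h2 := minorFree_of_disjoint_union hconn hX h1 h2
  star hF B hB T hTB hT := (no_star_minor hi hlt hF B hB T hTB hT).trans_le ht

lemma minorFree_map_subtype [∀ i, Nonempty (W i)]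
    (hdeg : ∀ i, ∀ a : W i, ∃ b, (H i).Adj a b)
    (hconn : ∀ p : GammaIndex H, (Gamma H p).Connected) {V : Type w} {R : Set V}
    {F : SimpleGraph R} (hF : MinorFree (Gamma H) F) :
    MinorFree (Gamma H) (F.map (Function.Embedding.subtype (· ∈ R))) := by
  refine minorFree_of_disjoint_union hconn (X := R) ?_ ?_ ?_
  · intro p _ q hq h
    obtain ⟨a, b, -, -, rfl⟩ := (SimpleGraph.map_adj _ _ _ _).1 h
    exact hq b.2
  · refine hF.comap id Function.injective_id fun p q hpq => ?_
    exact (SimpleGraph.map_adj_apply (f := Function.Embedding.subtype (· ∈ R))).1 hpq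
  · refine (minorFree_Gamma_bot (V := V) hdeg hconn).comap Subtype.val Subtype.val_injective ?_
    intro p q hpq
    have h : (F.map (Function.Embedding.subtype (· ∈ R))).Adj p q := hpq
    obtain ⟨a, b, -, ha, -⟩ := (SimpleGraph.map_adj _ _ _ _).1 h
    exact absurd (ha ▸ a.2) p.2

lemma eq_join_induce {V : Type w} {G : SimpleGraph V} {L : Finset V}
    (hL : ∀ a ∈ L, ∀ v, a ≠ v → G.Adj a v) :
    G = join L ((G.induce ((L : Set V)ᶜ)).map
      (Function.Embedding.subtype (· ∈ (L : Set V)ᶜ))) := by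
  ext a b
  constructor
  · intro h
    refine ⟨h.ne, ?_⟩
    by_cases ha : a ∈ L
    · exact Or.inl ha
    by_cases hb : b ∈ L
    · exact Or.inr (Or.inl hb)
    · exact Or.inr (Or.inr ((SimpleGraph.map_adj _ _ _ _).2 ⟨⟨a, ha⟩, ⟨b, hb⟩, h, rfl, rfl⟩))
  · rintro ⟨hne, h | h | h⟩
    · exact hL a h b hne
    · exact (hL b h a hne.symm).symm
    · obtain ⟨a, b, h', rfl, rfl⟩ := (SimpleGraph.map_adj _ _ _ _).1 h
      exact h'

theorem exists_isEX_deleteDominating [Nonempty ι] [∀ i, Nonempty (W i)]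
    (hdeg : ∀ i, ∀ a : W i, ∃ b, (H i).Adj a b)
    (hstar : ∀ i, ∀ r : W i, H i ≠ SimpleGraph.starGraph r)
    (hconn : ∀ p : GammaIndex H, (Gamma H p).Connected) :
    ∃ N : ℕ, ∀ n : ℕ, N ≤ n → ∀ G ∈ SPEX n H,
      IsEX (n - gammaFam H) (Gamma H) (deleteDominating G) := by
  classical
  obtain ⟨i, hi⟩ := exists_gammaFam_eq H
  have hg : 1 ≤ gammaFam H := by
    rw [← hi]
    exact gamma_pos (hdeg i) (hstar i)
  -- The summand 2 provides t ≥ 2, as `exists_rho_join_lt` requires.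
  set t := (H i).indepNum + 2 with ht
  have hQ := isSparseClass_minorFree hconn hi (indepNum_lt_card (hdeg i)) (t := t) (by omega)
  obtain ⟨B, hB⟩ := hQ.exists_improvable
  obtain ⟨N₁, hN₁⟩ := exists_dominating_clique hdeg hstar hconn
  obtain ⟨N₂, hN₂⟩ := exists_rho_join_lt.{0} (gammaFam H) t B hg (by omega)
  refine ⟨N₁ + N₂ + gammaFam H + t + 1, fun n hn G hG => ?_⟩
  obtain ⟨L, hLc, hL⟩ := hN₁ n (by omega) G hG
  have hcardR : Fintype.card ((L : Set (Fin n))ᶜ : Set (Fin n)) = n - gammaFam H := by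
    rw [Fintype.card_compl_set, Fintype.card_fin]
    simp [hLc]
  have hfree : MinorFree (Gamma H) (G.induce ((L : Set (Fin n))ᶜ)) :=
    minorFree_Gamma_induce hG.1 (L := L) (R₁ := Lᶜ) (Z := ∅) hLc disjoint_compl_right
      (Finset.empty_subset _)
      (fun a ha v hv => hL a ha v fun h => Finset.mem_compl.1 hv (h ▸ ha))
      (Or.inl fun a ha a' _ h => hL a ha a' h) (fun v hv => by simpa using hv)
  -- No vertex outside `L` dominates: its degree off `L` is below t, while n - γ - 1 other vertices
  -- lie there.
  have huniv : G.universalVerts = (L : Set (Fin n)) := by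
    ext v
    refine ⟨fun hv => ?_, fun hv w hvw => hL v hv w hvw⟩
    by_contra hvL
    have h1 := hQ.degIn_lt hfree (⟨v, hvL⟩ : ((L : Set (Fin n))ᶜ : Set (Fin n)))
    have h2 : degIn (G.induce ((L : Set (Fin n))ᶜ)) Finset.univ ⟨v, hvL⟩ =
        Fintype.card ((L : Set (Fin n))ᶜ : Set (Fin n)) - 1 := by
      rw [← Finset.card_univ, ← Finset.card_erase_of_mem (Finset.mem_univ
        (⟨v, hvL⟩ : ((L : Set (Fin n))ᶜ : Set (Fin n))))]
      unfold degIn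
      congr 1
      ext w
      simp only [Finset.mem_filter, Finset.mem_univ, true_and, Finset.mem_erase, and_true]
      exact ⟨fun h => h.ne', fun h => hv fun h' => h (Subtype.ext h'.symm)⟩
    omega
  suffices h : IsEX (n - gammaFam H) (Gamma H) (G.induce ((L : Set (Fin n))ᶜ)) by
    unfold deleteDominating
    generalize G.universalVerts = S at huniv
    subst huniv
    exact h
  refine ⟨by rw [Nat.card_eq_fintype_card, hcardR], hfree, fun G' hG' => ?_⟩
  -- A graph with more edges makes the part off `L` improvable by a controlled change; joined to
  -- `L`, the improved graph is still H-minor-free and has a larger spectral radius.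
  by_contra! hlt
  obtain ⟨F', hF', hlt'⟩ := hQ.has_of_fintype hG' (Fintype.card_fin _)
  let e := Fintype.equivFinOfCardEq hcardR
  have he := degSum_map (F := F'.comap e) (F' := F') e.toEmbedding (fun _ _ => Iff.rfl) Finset.univ
  rw [Finset.map_univ_equiv] at he
  obtain ⟨X, F₂, h1, h2, h3, h4, h5, h6⟩ := hB _ (G.induce ((L : Set (Fin n))ᶜ)) (F'.comap e)
    hfree (hF'.comap e e.injective fun _ _ h => h) (by
      rw [← he, degSum_univ]
      rw [degSum_univ] at hlt'
      omega)
  have hGj := eq_join_induce hL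
  set f := Function.Embedding.subtype (· ∈ (L : Set (Fin n))ᶜ) with hf
  set F := G.induce ((L : Set (Fin n))ᶜ) with hFdef
  have havoid : ∀ F : SimpleGraph ((L : Set (Fin n))ᶜ : Set (Fin n)), Avoids (F.map f) L := by
    intro F a ha b h
    obtain ⟨c, d, -, rfl, -⟩ := (SimpleGraph.map_adj _ _ _ _).1 h
    exact c.2 ha
  have hmem : ∀ x : ((L : Set (Fin n))ᶜ : Set (Fin n)), f x ∈ X.map f ↔ x ∈ X := fun x =>
    Finset.mem_map' f
  have hrho := hN₂ (Fin n) (F.map f) (F₂.map f) L (X.map f) (by simp; omega) hLc (havoid F)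
    (havoid F₂)
    (by
      rw [Finset.disjoint_left]
      intro v hv hvL
      obtain ⟨x, -, rfl⟩ := Finset.mem_map.1 hv
      exact x.2 hvL)
    (by
      intro v
      by_cases hv : v ∈ Set.range f
      · obtain ⟨x, rfl⟩ := hv
        rw [degIn_univ_map]
        exact (hQ.degIn_lt hfree x).le
      · rw [degIn_univ_map_of_notMem F f hv]
        exact Nat.zero_le _)
    (by
      intro a b ha hb
      rw [SimpleGraph.map_adj, SimpleGraph.map_adj]
      constructor
      · rintro ⟨x, y, hxy, rfl, rfl⟩
        exact ⟨x, y, (h2 x y ((hmem x).not.1 ha) ((hmem y).not.1 hb)).1 hxy, rfl, rfl⟩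
      · rintro ⟨x, y, hxy, rfl, rfl⟩
        exact ⟨x, y, (h2 x y ((hmem x).not.1 ha) ((hmem y).not.1 hb)).2 hxy, rfl, rfl⟩)
    (by
      intro a b ha hb h
      obtain ⟨x, y, hxy, rfl, rfl⟩ := (SimpleGraph.map_adj _ _ _ _).1 h
      exact h3 x y ((hmem x).1 ha) ((hmem y).not.1 hb) hxy)
    (by
      rw [Finset.sum_map]
      simp only [degIn_univ_map]
      exact h4)
    (by rw [boundary_map]; exact h5)
    (by
      rw [quad_one, quad_one, degSum_univ_map, degSum_univ_map]
      rw [degSum_univ, degSum_univ] at h6 ⊢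
      exact_mod_cast (show 2 * F.edgeSet.ncard + 2 ≤ 2 * F₂.edgeSet.ncard by omega))
  rw [← hGj] at hrho
  exact absurd (hG.2 _ (minorFree_join (minorFree_map_subtype hdeg hconn h1) hLc))
    (not_le.2 hrho)

end Final

end MinorSpex

theorem theorem1p3 {ι : Type*} [Nonempty ι] {W : ι → Type*} [∀ i, Fintype (W i)]
    [∀ i, Nonempty (W i)] (H : ∀ i, SimpleGraph (W i))
    (hdeg : ∀ i, ∀ a : W i, ∃ b, (H i).Adj a b)
    (hstar : ∀ i, ∀ r : W i, H i ≠ SimpleGraph.starGraph r)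
    (hconn : ∀ p : MinorSpex.GammaIndex H, (MinorSpex.Gamma H p).Connected) :
    ∃ N : ℕ, ∀ n : ℕ, N ≤ n → ∀ G ∈ MinorSpex.SPEX n H,
      MinorSpex.IsEX (n - MinorSpex.gammaFam H) (MinorSpex.Gamma H)
        (MinorSpex.deleteDominating G) :=
  MinorSpex.exists_isEX_deleteDominating hdeg hstar hconn
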